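/- An $\varepsilon$NFA is a tuple $A=(Q,\Sigma,q_0,q_f,\delta)$ with $Q=\{1,\dots,n\}$, $\Sigma=\{1,\dots,\sigma\}$, one initial state $q_0$, one final state $q_f$, and a set $\delta\subseteq Q\times(\Sigma\cup\{\varepsilon\})\times Q$ of transitions; its size is $m=|\delta|$, and $L(A)$ is the set of strings labelling a path from $q_0$ to $q_f$. All $\varepsilon$NFAs are assumed to be trimmed (every state is reachable from $q_0$ and can reach $q_f$), and every letter of $\Sigma$ is assumed to label at least one transition. For strings $u,w\in\Sigma^*$ let $u\preceq w$ be one of the following six relations: - infix: $w=vuv'$ for some $v,v'\in\Sigma^*$; - prefix: $w=uv$ for some $v\in\Sigma^*$; - extension: $u=vwv'$ for some $v,v'\in\Sigma^*$; - left-extension: $u=vw$ for some $v\in\Sigma^*$; - subsequence: $u$ is a (scattered) subsequence of $w$; - supersequence: $w$ is a (scattered) subsequence of $u$. The min-variant of the $\preceq$-matching problem is: given $A$ and $w\in\Sigma^*$, compute a shortest string $u\in L(A)$ with $u\preceq w$, or report that no such string exists. The max-variant is: given $A$ and $w$, report that there are arbitrarily long strings $u\in L(A)$ with $u\preceq w$,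 or compute a longest such string, or report that no such string exists. The input consists of $n,\sigma,q_0,q_f,m,|w|$, a list of the $m$ transitions in arbitrary order, and the letters of $w$; let $N=|w|+3m+6$ be the number of words needed to store it. The model of computation is the unit-cost word RAM with logarithmic word size: words have at least $\kappa\log_2 N$ bits for a constant $\kappa$; indirect addressing and the basic arithmetical, bitwise and comparison operations on words take one step each; and memory outside the input is uninitialised. **Theorem.** For each of the six relations $\preceq$, both the min-variant and the max-variant of the $\preceq$-matching problem, including the output of the string $u$, can be solved in time $O(|w|\,m)$. That is, for each relation and each variant there are a word RAM program and constants $\kappa, c$ such that, on every input and for every word size of at least $\kappa\log_2 N$ bits, the program halts with a correct answer after at most $c\cdot\max(|w|,1)\cdot\max(m,1)$ steps. -/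

import Mathlib

/-! ## Nondeterministic finite automata with ε-transitions -/

/-- An NFA with ε-transitions with state set `{1, …, n}`, alphabet `{1, …, σ}` (both represented
by `Fin`), one initial state, one final state and a finite set of transitions; a transition
labelled `none` is an ε-transition. -/
structure EpsAutomaton where
  n : ℕ
  σ : ℕ
  init : Fin n
  final : Fin n
  δ : Finset (Fin n × Option (Fin σ) × Fin n)

namespace EpsAutomaton

/-- The type of potential transitions. -/
abbrev Transition (A : EpsAutomaton) : Type := Fin A.n × Option (Fin A.σ) × Fin A.n

/-- The size of the automaton: its number of transitions. -/
def size (A : EpsAutomaton) : ℕ := A.δ.card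

/-- The automaton as an `εNFA` of Mathlib. -/
def toεNFA (A : EpsAutomaton) : εNFA (Fin A.σ) (Fin A.n) where
  step p a := {q | (p, a, q) ∈ A.δ}
  start := {A.init}
  accept := {A.final}

/-- The accepted language. -/
def language (A : EpsAutomaton) : Language (Fin A.σ) := A.toεNFA.accepts

/-- There is a transition from `p` to `q`, whatever its label. -/
def Edge (A : EpsAutomaton) (p q : Fin A.n) : Prop := ∃ a, (p, a, q) ∈ A.δ

/-- Every state is reachable from the initial state and can reach the final state. -/
def Trimmed (A : EpsAutomaton) : Prop :=
  ∀ q, Relation.ReflTransGen A.Edge A.init q ∧ Relation.ReflTransGen A.Edge q A.final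

/-- Every letter of the alphabet labels at least one transition. -/
def UsesAllLetters (A : EpsAutomaton) : Prop := ∀ a, ∃ p q, (p, some a, q) ∈ A.δ

/-- `l` lists the transitions, in any order and without repetition. -/
def Lists (A : EpsAutomaton) (l : List A.Transition) : Prop :=
  l.Nodup ∧ ∀ x, x ∈ l ↔ x ∈ A.δ

/-- States are the numbers `1, …, n`, letters the numbers `1, …, σ`, and `0` stands for `ε`. -/
def encodeTransition (A : EpsAutomaton) (x : A.Transition) : List ℕ :=
  [(x.1 : ℕ) + 1, x.2.1.elim 0 (fun a => (a : ℕ) + 1), (x.2.2 : ℕ) + 1]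

/-- The input of the matching problems as a sequence of numbers: number of states, size of the
alphabet, initial state, final state, number of transitions, length of the word, the list of
transitions, and the word. -/
def encodeInput (A : EpsAutomaton) (l : List A.Transition) (w : List (Fin A.σ)) : List ℕ :=
  [A.n, A.σ, (A.init : ℕ) + 1, (A.final : ℕ) + 1, l.length, w.length]
    ++ l.flatMap A.encodeTransition ++ w.map (fun a => (a : ℕ) + 1)

end EpsAutomaton

/-! ## String relations and the quantitative matching problems -/

/-- Names of the six string relations. -/
inductive StringRel where
  | isInfix | isPrefix | extension | leftExtension | subsequence | supersequence

/-- `r.Holds u w` is the relation `u ⪯ w`. -/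
def StringRel.Holds {α : Type*} : StringRel → List α → List α → Prop
  | .isInfix, u, w => ∃ v v', w = v ++ u ++ v'
  | .isPrefix, u, w => ∃ v, w = u ++ v
  | .extension, u, w => ∃ v v', u = v ++ w ++ v'
  | .leftExtension, u, w => ∃ v, u = v ++ w
  | .subsequence, u, w => List.Sublist u w
  | .supersequence, u, w => List.Sublist w u

/-- The strings among which a shortest or a longest one is sought: those `u` that are accepted
by `A` and satisfy `u ⪯ w`. -/
def StringRel.candidates (r : StringRel) (A : EpsAutomaton) (w : List (Fin A.σ)) :
    Set (List (Fin A.σ)) :=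
  {u | r.Holds u w ∧ u ∈ A.language}

/-- The possible answers: there is no candidate, a particular candidate, or there are
arbitrarily long candidates. -/
inductive Answer (α : Type*) where
  | noString
  | string (u : List α)
  | unbounded

/-- The two quantitative variants of the matching problem. -/
inductive Variant where
  | min | max

/-- Correctness of an answer, given the set `C` of candidates. -/
def Variant.Correct {α : Type*} (C : Set (List α)) : Variant → Answer α → Prop
  | .min, .string u => u ∈ C ∧ ∀ v ∈ C, u.length ≤ v.length
  | .min, .noString => C = ∅
  | .min, .unbounded => False
  | .max, .string u => u ∈ C ∧ ∀ v ∈ C, v.length ≤ u.length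
  | .max, .noString => C = ∅
  | .max, .unbounded => ∀ k : ℕ, ∃ u ∈ C, k ≤ u.length

/-! ## The unit-cost word RAM

Words have `W` bits. A machine has registers, of which a program uses finitely many, and a memory
with one cell for each of the `2 ^ W` addresses. Programs do not depend on `W`. -/

namespace WordRAM

/-- Arithmetical, bitwise and comparison operations on words. -/
inductive BinOp where
  | add | sub | mul | div | mod | and | or | xor | shl | shr | eq | lt

/-- Unsigned arithmetic modulo `2 ^ W`; comparisons return `1` or `0`. -/
def BinOp.eval {W : ℕ} : BinOp → BitVec W → BitVec W → BitVec W
  | .add, x, y => x + y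
  | .sub, x, y => x - y
  | .mul, x, y => x * y
  | .div, x, y => x / y
  | .mod, x, y => x % y
  | .and, x, y => x &&& y
  | .or, x, y => x ||| y
  | .xor, x, y => x ^^^ y
  | .shl, x, y => x <<< y
  | .shr, x, y => x >>> y
  | .eq, x, y => if x = y then 1 else 0
  | .lt, x, y => if x < y then 1 else 0

/-- Elementary instructions; the parameters other than the constant `c` are register numbers. -/
inductive Instr where
  | const (r c : ℕ)
  | copy (r a : ℕ)
  | op (o : BinOp) (r a b : ℕ)
  | load (r a : ℕ)
  | store (a b : ℕ)

/-- Programs. -/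
inductive Program where
  | instr (i : Instr)
  | seq (p q : Program)
  | ite (r : ℕ) (p q : Program)
  | loop (r : ℕ) (p : Program)

/-- The contents of the registers and of the memory. -/
structure State (W : ℕ) where
  reg : ℕ → BitVec W
  mem : BitVec W → BitVec W

/-- The effect of an elementary instruction. `load` and `store` use indirect addressing: the
address is the content of register `a`. -/
def Instr.exec {W : ℕ} (s : State W) : Instr → State W
  | .const r c => { s with reg := Function.update s.reg r (BitVec.ofNat W c) }
  | .copy r a => { s with reg := Function.update s.reg r (s.reg a) }
  | .op o r a b => { s with reg := Function.update s.reg r (o.eval (s.reg a) (s.reg b)) }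
  | .load r a => { s with reg := Function.update s.reg r (s.mem (s.reg a)) }
  | .store a b => { s with mem := Function.update s.mem (s.reg a) (s.reg b) }

/-- `Exec p s t s'`: started in state `s`, the program `p` halts after exactly `t` steps, in
state `s'`. Every elementary instruction and every test of a register for being nonzero (in
`ite`, and before each round of `loop`) takes one step. -/
inductive Exec {W : ℕ} : Program → State W → ℕ → State W → Prop where
  | instr (i : Instr) (s : State W) : Exec (.instr i) s 1 (i.exec s)
  | seq {p q : Program} {s₁ s₂ s₃ : State W} {t₁ t₂ : ℕ} :
      Exec p s₁ t₁ s₂ → Exec q s₂ t₂ s₃ → Exec (.seq p q) s₁ (t₁ + t₂) s₃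
  | ite_true {r : ℕ} {p q : Program} {s₁ s₂ : State W} {t : ℕ} :
      s₁.reg r ≠ 0 → Exec p s₁ t s₂ → Exec (.ite r p q) s₁ (1 + t) s₂
  | ite_false {r : ℕ} {p q : Program} {s₁ s₂ : State W} {t : ℕ} :
      s₁.reg r = 0 → Exec q s₁ t s₂ → Exec (.ite r p q) s₁ (1 + t) s₂
  | loop_stop {r : ℕ} {p : Program} {s : State W} :
      s.reg r = 0 → Exec (.loop r p) s 1 s
  | loop_step {r : ℕ} {p : Program} {s₁ s₂ s₃ : State W} {t₁ t₂ : ℕ} :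
      s₁.reg r ≠ 0 → Exec p s₁ t₁ s₂ → Exec (.loop r p) s₂ t₂ s₃ →
        Exec (.loop r p) s₁ (1 + t₁ + t₂) s₃

/-- The numbers of the list `l` are stored in the cells `0, 1, 2, …`. Nothing is assumed about the
other cells and the registers. -/
def State.HoldsInput {W : ℕ} (s : State W) (l : List ℕ) : Prop :=
  ∀ (i : ℕ) (hi : i < l.length), s.mem (BitVec.ofNat W i) = BitVec.ofNat W l[i]

/-- Register `0` tells the kind of answer. A string is given by an address in register `1` and
its length in register `2`, and its letters, as numbers `1, …, σ`, are stored from that address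
on. -/
def State.Outputs {W σ : ℕ} (s : State W) : Answer (Fin σ) → Prop
  | .noString => (s.reg 0).toNat = 0
  | .string u => (s.reg 0).toNat = 1 ∧ (s.reg 2).toNat = u.length ∧
      ∀ (i : ℕ) (hi : i < u.length), (s.mem (s.reg 1 + BitVec.ofNat W i)).toNat = (u[i] : ℕ) + 1
  | .unbounded => (s.reg 0).toNat = 2

end WordRAM

/-!
All twelve problems are path problems in one product graph. Its vertices are the pairs of a state
and of a position in the word, together with a source and a sink, and the number of its edges
is in `O((|w| + 1) (m + 1))`. An edge either follows a transition without moving in the word (always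
possible for ε-transitions, and possible for letters at positions where the relation allows letters
to be inserted), or follows a transition with the next letter of the word, or moves in the word alone
(where the relation allows letters to be skipped). The relations differ only in six `Flags`, and by
`walk_iff` the strings on walks from the source to the sink are the candidates. For subsequences,
skips are offered once for each transition, at its source; at the last state of a path, which need
not have an outgoing transition, the rest of the word can be ignored instead.

A shortest candidate is found by a breadth-first search from the sink against the edges in which
edges with the empty label have length `0`, with one list for the current and one for the next
distance (`wp_minSearch`). For a longest candidate, the strongly connected components of the part
of the graph from which the sink can be reached are computed by two depth-first searches
(`wp_dfs`, `wp_maxSearch`). In the second one, components are completed in an order in which all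
edges that leave a component lead to components completed before, so that the longest string from
a component is determined on the way; a component with an edge inside it that carries a letter, or
from which such a component can be reached, yields arbitrarily long strings.

The algorithms are written in a small structured language, whose states hold natural numbers and
arrays of natural numbers and count the rounds of loops. `Cmd.exec_code` shows that the compiled
code simulates a structured program on the word RAM, in a number of steps bounded by a constant for
each round, as long as numbers and array indices stay below given bounds. All arrays have length
`S = N ^ 2`, where `N` is the length of the input, and array `f` starts at address `f.code * S`; the
first array is the input itself. Total correctness with these bounds is expressed by `wp`. As memory
outside the input is uninitialised, a first loop clears the arrays that are indexed by vertices,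
at the cost of one round for each vertex; there are at most `(|w| + 1) (m + 1) + 2` vertices since
the automaton is trimmed.
-/

set_option linter.constructorNameAsVariable false

/-! ### A structured language compiled to the word RAM -/

namespace QuantMatch

open WordRAM

/-- Names of the registers used by structured programs. The first three are the output registers of
the word RAM; `addr` is set only after the structured program. -/
inductive Reg
  | kind | addr | len | n | k | m | s | t | nE | base | layer | j | wl | p | a | q
  | e | x | y | r | v | la | lb | fin
  deriving DecidableEq

/-- Names of the arrays used by structured programs. The first one, `inp`, starts at address `0`, so
that it contains the input. -/
inductive Fld
  | inp | src | dst | lab | hIn | nIn | hOut | nOut | comp | col | val | inf | ch | lk1 | lk2 | out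
  deriving DecidableEq

/-- The register of the word RAM that implements a named register. -/
def Reg.code (r : Reg) : ℕ := r.ctorIdx

/-- The position of an array in the memory, in multiples of the common array length. -/
def Fld.code (f : Fld) : ℕ := f.ctorIdx

theorem Reg.code_injective : Function.Injective Reg.code := fun a b h => by
  rw [← Reg.ofNat_ctorIdx a, ← Reg.ofNat_ctorIdx b]
  exact congrArg _ h

theorem Fld.code_injective : Function.Injective Fld.code := fun a b h => by
  rw [← Fld.ofNat_ctorIdx a, ← Fld.ofNat_ctorIdx b]
  exact congrArg _ h

theorem Reg.code_lt (r : Reg) : r.code < 99 := by cases r <;> decide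

theorem Fld.code_lt (f : Fld) : f.code < 16 := by cases f <;> decide

/-- The state of a structured program: registers and arrays hold natural numbers, and `ticks`
counts the rounds of loops executed so far. -/
@[ext] structure St where
  reg : Reg → ℕ
  fld : Fld → ℕ → ℕ
  ticks : ℕ

namespace St

/-- Assignment to a register. -/
def set (σ : St) (r : Reg) (v : ℕ) : St := { σ with reg := Function.update σ.reg r v }

/-- Assignment to an array entry. -/
def put (σ : St) (f : Fld) (i v : ℕ) : St :=
  { σ with fld := Function.update σ.fld f (Function.update (σ.fld f) i v) }

/-- One more round of a loop. -/
def tick (σ : St) : St := { σ with ticks := σ.ticks + 1 }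

variable (σ : St) (r r' : Reg) (f f' : Fld) (i v : ℕ)

@[simp] theorem set_reg_self : (σ.set r v).reg r = v := by simp [set]
@[simp] theorem set_reg_of_ne (h : r' ≠ r) : (σ.set r v).reg r' = σ.reg r' := by simp [set, h]
@[simp] theorem set_fld : (σ.set r v).fld = σ.fld := rfl
@[simp] theorem set_ticks : (σ.set r v).ticks = σ.ticks := rfl
@[simp] theorem put_reg : (σ.put f i v).reg = σ.reg := rfl
@[simp] theorem put_ticks : (σ.put f i v).ticks = σ.ticks := rfl
@[simp] theorem put_fld_self :
    (σ.put f i v).fld f = Function.update (σ.fld f) i v := by simp [put]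
@[simp] theorem put_fld_of_ne (h : f' ≠ f) : (σ.put f i v).fld f' = σ.fld f' := by simp [put, h]
@[simp] theorem tick_reg : σ.tick.reg = σ.reg := rfl
@[simp] theorem tick_fld : σ.tick.fld = σ.fld := rfl
@[simp] theorem tick_ticks : σ.tick.ticks = σ.ticks + 1 := rfl

end St

/-- Binary operations in expressions. -/
inductive BOp
  | add | mul | eq | lt

/-- The operation on natural numbers. -/
def BOp.ev : BOp → ℕ → ℕ → ℕ
  | .add, x, y => x + y
  | .mul, x, y => x * y
  | .eq, x, y => if x = y then 1 else 0
  | .lt, x, y => if x < y then 1 else 0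

/-- The corresponding operation of the word RAM. -/
def BOp.word : BOp → BinOp
  | .add => .add
  | .mul => .mul
  | .eq => .eq
  | .lt => .lt

/-- Expressions. -/
inductive Ex
  | var (r : Reg)
  | lit (c : ℕ)
  | bin (o : BOp) (x y : Ex)
  | get (f : Fld) (x : Ex)

instance : Add Ex := ⟨Ex.bin .add⟩
instance : Mul Ex := ⟨Ex.bin .mul⟩

/-- Comparison for equality, with value `1` or `0`. -/
def Ex.eq (x y : Ex) : Ex := .bin .eq x y

/-- Comparison for order, with value `1` or `0`. -/
def Ex.lt (x y : Ex) : Ex := .bin .lt x y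

/-- The value of an expression. -/
def Ex.ev (σ : St) : Ex → ℕ
  | .var r => σ.reg r
  | .lit c => c
  | .bin o x y => o.ev (x.ev σ) (y.ev σ)
  | .get f x => σ.fld f (x.ev σ)

/-- The evaluation of the expression stays below the bound `M` on numbers and below the bound
`S` on array indices, so that it can be performed with words. -/
def Ex.ok (M S : ℕ) (σ : St) : Ex → Prop
  | .var _ => True
  | .lit c => c < M
  | .bin o x y => x.ok M S σ ∧ y.ok M S σ ∧ o.ev (x.ev σ) (y.ev σ) < M
  | .get _ x => x.ok M S σ ∧ x.ev σ < S

section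

variable {M S : ℕ} (σ : St) (x y : Ex)

@[simp] theorem ev_var (r : Reg) : (Ex.var r).ev σ = σ.reg r := rfl
@[simp] theorem ev_lit (c : ℕ) : (Ex.lit c).ev σ = c := rfl
@[simp] theorem ev_add : (x + y).ev σ = x.ev σ + y.ev σ := rfl
@[simp] theorem ev_mul : (x * y).ev σ = x.ev σ * y.ev σ := rfl
@[simp] theorem ev_eq : (x.eq y).ev σ = if x.ev σ = y.ev σ then 1 else 0 := rfl
@[simp] theorem ev_lt : (x.lt y).ev σ = if x.ev σ < y.ev σ then 1 else 0 := rfl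
@[simp] theorem ev_get (f : Fld) : (Ex.get f x).ev σ = σ.fld f (x.ev σ) := rfl

@[simp] theorem ok_var (r : Reg) : (Ex.var r).ok M S σ := trivial
@[simp] theorem ok_lit (c : ℕ) : (Ex.lit c).ok M S σ ↔ c < M := Iff.rfl
@[simp] theorem ok_add :
    (x + y).ok M S σ ↔ x.ok M S σ ∧ y.ok M S σ ∧ x.ev σ + y.ev σ < M := Iff.rfl
@[simp] theorem ok_mul :
    (x * y).ok M S σ ↔ x.ok M S σ ∧ y.ok M S σ ∧ x.ev σ * y.ev σ < M := Iff.rfl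
@[simp] theorem ok_get (f : Fld) : (Ex.get f x).ok M S σ ↔ x.ok M S σ ∧ x.ev σ < S := Iff.rfl

@[simp] theorem ok_eq [hM : Fact (1 < M)] :
    (x.eq y).ok M S σ ↔ x.ok M S σ ∧ y.ok M S σ := by
  have h : (x.eq y).ev σ < M := by
    have := hM.out
    rw [ev_eq]
    split_ifs <;> omega
  exact ⟨fun h => ⟨h.1, h.2.1⟩, fun h' => ⟨h'.1, h'.2, h⟩⟩

@[simp] theorem ok_lt [hM : Fact (1 < M)] :
    (x.lt y).ok M S σ ↔ x.ok M S σ ∧ y.ok M S σ := by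
  have h : (x.lt y).ev σ < M := by
    have := hM.out
    rw [ev_lt]
    split_ifs <;> omega
  exact ⟨fun h => ⟨h.1, h.2.1⟩, fun h' => ⟨h'.1, h'.2, h⟩⟩

end

/-- Structured programs. -/
inductive Cmd
  | skip
  | assign (r : Reg) (x : Ex)
  | store (f : Fld) (i x : Ex)
  | seq (p q : Cmd)
  | ite (c : Ex) (p q : Cmd)
  | while (c : Ex) (p : Cmd)

/-- Sequential composition. -/
infixr:60 " ;; " => Cmd.seq

/-- Assignment to a register. -/
infix:62 " ≔ " => Cmd.assign

/-- The content of a register, as an expression. -/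
prefix:max "◇" => Ex.var

/-- `Ev M S p σ σ'`: started in state `σ`, the program `p` halts in state `σ'`, without exceeding
the bounds `M` on numbers and `S` on array indices. -/
inductive Ev (M S : ℕ) : Cmd → St → St → Prop
  | skip (σ) : Ev M S .skip σ σ
  | assign {r x σ} : x.ok M S σ → Ev M S (.assign r x) σ (σ.set r (x.ev σ))
  | store {f i x σ} : i.ok M S σ → x.ok M S σ → i.ev σ < S →
      Ev M S (.store f i x) σ (σ.put f (i.ev σ) (x.ev σ))
  | seq {p q σ₁ σ₂ σ₃} : Ev M S p σ₁ σ₂ → Ev M S q σ₂ σ₃ → Ev M S (.seq p q) σ₁ σ₃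
  | ite_true {c p q σ σ'} : c.ok M S σ → c.ev σ ≠ 0 → Ev M S p σ σ' → Ev M S (.ite c p q) σ σ'
  | ite_false {c p q σ σ'} : c.ok M S σ → c.ev σ = 0 → Ev M S q σ σ' → Ev M S (.ite c p q) σ σ'
  | while_exit {c p σ} : c.ok M S σ → c.ev σ = 0 → Ev M S (.while c p) σ σ
  | while_step {c p σ₁ σ₂ σ₃} : c.ok M S σ₁ → c.ev σ₁ ≠ 0 → Ev M S p σ₁.tick σ₂ →
      Ev M S (.while c p) σ₂ σ₃ → Ev M S (.while c p) σ₁ σ₃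

theorem Ev.ticks_le {M S p σ σ'} (h : Ev M S p σ σ') : σ.ticks ≤ σ'.ticks := by
  induction h with
  | while_step _ _ _ _ h₁ h₂ => rw [St.tick_ticks] at h₁; omega
  | seq _ _ h₁ h₂ => exact h₁.trans h₂
  | ite_true _ _ _ h => exact h
  | ite_false _ _ _ h => exact h
  | _ => simp

/-! #### Compilation -/

/-- Code that puts the value of an expression into register `d`, using registers from `d` on as
temporary storage. Register `99` holds the common length of the arrays. -/
def Ex.code : Ex → ℕ → Program
  | .var r, d => .instr (.copy d r.code)
  | .lit c, d => .instr (.const d c)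
  | .bin o x y, d => .seq (x.code d) (.seq (y.code (d + 1)) (.instr (.op o.word d d (d + 1))))
  | .get f x, d => .seq (x.code d) (.seq (.instr (.const (d + 1) f.code))
      (.seq (.instr (.op .mul (d + 1) (d + 1) 99)) (.seq (.instr (.op .add d d (d + 1)))
        (.instr (.load d d)))))

/-- The number of steps of the code of an expression. -/
def Ex.cost : Ex → ℕ
  | .var _ => 1
  | .lit _ => 1
  | .bin _ x y => x.cost + (y.cost + 1)
  | .get _ x => x.cost + (1 + (1 + (1 + 1)))

/-- The code of a structured program. -/
def Cmd.code : Cmd → Program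
  | .skip => .instr (.copy 100 100)
  | .assign r x => .seq (x.code 100) (.instr (.copy r.code 100))
  | .store f i x => .seq (i.code 100) (.seq (x.code 101) (.seq (.instr (.const 102 f.code))
      (.seq (.instr (.op .mul 102 102 99)) (.seq (.instr (.op .add 100 100 102))
        (.instr (.store 100 101))))))
  | .seq p q => .seq p.code q.code
  | .ite c p q => .seq (c.code 100) (.ite 100 p.code q.code)
  | .while c p => .seq (c.code 100) (.loop 100 (.seq p.code (c.code 100)))

/-- The number of steps of the code of a structured program per round of a loop. -/
def Cmd.cost : Cmd → ℕ
  | .skip => 1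
  | .assign _ x => x.cost + 1
  | .store _ i x => i.cost + x.cost + 4
  | .seq p q => p.cost + q.cost
  | .ite c p q => c.cost + 1 + p.cost + q.cost
  | .while c p => c.cost + 1 + p.cost

/-- The state `s` of the word RAM represents the state `σ`: array `f` occupies `S` cells from
address `f.code * S` on. -/
structure Represents {W : ℕ} (S : ℕ) (σ : St) (s : State W) : Prop where
  reg : ∀ r : Reg, (s.reg r.code).toNat = σ.reg r
  fld : ∀ f : Fld, ∀ i < S, (s.mem (BitVec.ofNat W (f.code * S + i))).toNat = σ.fld f i
  stride : (s.reg 99).toNat = S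

theorem Represents.tick {W S : ℕ} {σ : St} {s : State W} (h : Represents S σ s) :
    Represents S σ.tick s := ⟨h.reg, h.fld, h.stride⟩

theorem Fld.address_lt {S i : ℕ} (f : Fld) (hi : i < S) : f.code * S + i < 16 * S := by
  have := f.code_lt
  nlinarith

/-- Different array entries have different addresses. -/
theorem Fld.address_inj {S i j : ℕ} {f g : Fld} (hi : i < S) (hj : j < S)
    (h : f.code * S + i = g.code * S + j) : f = g ∧ i = j := by
  have hS : 0 < S := by omega
  have h1 : (f.code * S + i) / S = f.code := by
    rw [mul_comm, Nat.mul_add_div hS, Nat.div_eq_of_lt hi, add_zero]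
  have h2 : (g.code * S + j) / S = g.code := by
    rw [mul_comm, Nat.mul_add_div hS, Nat.div_eq_of_lt hj, add_zero]
  have h3 : f.code = g.code := by rw [← h1, ← h2, h]
  exact ⟨Fld.code_injective h3, by rw [h3] at h; omega⟩

/-- As long as its result fits into a word, an operation on words computes the operation on natural
numbers. -/
theorem BOp.toNat_eval {W : ℕ} (o : BOp) (x y : BitVec W) (h : o.ev x.toNat y.toNat < 2 ^ W) :
    (o.word.eval x y).toNat = o.ev x.toNat y.toNat := by
  cases o
  · simp only [BOp.ev] at h
    simp [word, BinOp.eval, ev, Nat.mod_eq_of_lt h]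
  · simp only [BOp.ev] at h
    simp [word, BinOp.eval, ev, Nat.mod_eq_of_lt h]
  all_goals
    simp only [BOp.ev] at h
    simp only [word, BinOp.eval, ev]
    simp only [← BitVec.toNat_inj, BitVec.lt_def]
    split_ifs at h ⊢ <;> simp at h ⊢
    omega

/-- The code of an expression computes its value in register `d` and changes only registers from `d`
on. -/
theorem Ex.exec_code {W S : ℕ} {σ : St} (x : Ex) :
    ∀ (d : ℕ) (s : State W), 100 ≤ d → Represents S σ s → x.ok (2 ^ W) S σ →
      ∃ s', Exec (x.code d) s x.cost s' ∧ (s'.reg d).toNat = x.ev σ ∧ s'.mem = s.mem ∧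
        ∀ i < d, s'.reg i = s.reg i := by
  induction x with
  | var r =>
    intro d s hd hs _
    exact ⟨_, .instr _ _, by simp [Instr.exec, hs.reg, ev], rfl,
      fun i hi => by simp [Instr.exec, hi.ne]⟩
  | lit c =>
    intro d s hd hs h
    exact ⟨_, .instr _ _, by simpa [Instr.exec, ev] using Nat.mod_eq_of_lt h, rfl,
      fun i hi => by simp [Instr.exec, hi.ne]⟩
  | bin o x y ihx ihy =>
    intro d s hd hs h
    obtain ⟨s₁, e₁, v₁, m₁, r₁⟩ := ihx d s hd hs h.1
    have hs₁ : Represents S σ s₁ := by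
      refine ⟨fun r => ?_, fun f i hi => ?_, ?_⟩
      · rw [r₁ _ (by have := r.code_lt; omega), hs.reg]
      · rw [m₁, hs.fld f i hi]
      · rw [r₁ _ (by omega), hs.stride]
    obtain ⟨s₂, e₂, v₂, m₂, r₂⟩ := ihy (d + 1) s₁ (by omega) hs₁ h.2.1
    refine ⟨_, .seq e₁ (.seq e₂ (.instr _ _)), ?_, by simp [Instr.exec, m₁, m₂], fun i hi => ?_⟩
    · have hv : (s₂.reg d).toNat = x.ev σ := by rw [r₂ d (by omega), v₁]
      have := h.2.2
      rw [← hv, ← v₂] at this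
      simp [Instr.exec, BOp.toNat_eval _ _ _ this, ev, hv, v₂]
    · simp [Instr.exec, hi.ne, r₂ i (by omega), r₁ i hi]
  | get f x ih =>
    intro d s hd hs h
    obtain ⟨s₁, e₁, v₁, m₁, r₁⟩ := ih d s hd hs h.1
    refine ⟨_, .seq e₁ (.seq (.instr _ _) (.seq (.instr _ _) (.seq (.instr _ _) (.instr _ _)))),
      ?_, by simp [Instr.exec, m₁], fun i hi => ?_⟩
    · have h99 : s₁.reg 99 = s.reg 99 := r₁ _ (by omega)
      have hne : (99 : ℕ) ≠ d + 1 := by omega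
      have hst : s.reg 99 = BitVec.ofNat W S := by
        rw [← hs.stride, BitVec.ofNat_toNat, BitVec.setWidth_eq]
      have hv : s₁.reg d = BitVec.ofNat W (x.ev σ) := by
        rw [← v₁, BitVec.ofNat_toNat, BitVec.setWidth_eq]
      rw [Ex.ev, ← hs.fld f _ h.2, ← m₁]
      simp only [Instr.exec, BinOp.eval]
      congr 2
      simp [hne, h99, hst, hv, BitVec.ofNat_add, BitVec.ofNat_mul, BitVec.add_comm]
    · simp [Instr.exec, hi.ne, (show i ≠ d + 1 by omega), r₁ i hi]

/-- The code of an expression in register `100` leaves the represented state unchanged. -/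
theorem Ex.exec_code_represents {W S : ℕ} {σ : St} {s : State W} (x : Ex)
    (hs : Represents S σ s) (hx : x.ok (2 ^ W) S σ) :
    ∃ s', Exec (x.code 100) s x.cost s' ∧ (s'.reg 100).toNat = x.ev σ ∧ Represents S σ s' := by
  obtain ⟨s', e, v, m, r⟩ := x.exec_code 100 s le_rfl hs hx
  refine ⟨s', e, v, fun r' => ?_, fun f i hi => ?_, ?_⟩
  · rw [r _ (by have := r'.code_lt; omega), hs.reg]
  · rw [m, hs.fld f i hi]
  · rw [r _ (by omega), hs.stride]

theorem toNat_ne_zero {W : ℕ} {x : BitVec W} (h : x.toNat ≠ 0) : x ≠ 0 := by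
  rintro rfl
  simp at h

theorem toNat_eq_zero {W : ℕ} {x : BitVec W} (h : x.toNat = 0) : x = 0 :=
  BitVec.eq_of_toNat_eq (by simpa using h)

/-- Compilation is correct, with a constant number of steps per round of a loop. -/
theorem Cmd.exec_code {W S : ℕ} (hS : 16 * S ≤ 2 ^ W) {p : Cmd} {σ σ' : St}
    (h : Ev (2 ^ W) S p σ σ') :
    ∀ s : State W, Represents S σ s → ∃ t s', Exec p.code s t s' ∧ Represents S σ' s' ∧
      t ≤ p.cost * (σ'.ticks - σ.ticks + 1) := by
  induction h with
  | skip σ =>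
    intro s hs
    refine ⟨_, _, .instr _ _, ⟨fun r => ?_, hs.fld, ?_⟩, by simp [cost]⟩
    · have := r.code_lt
      simp [Instr.exec, hs.reg]
    · simp [Instr.exec, hs.stride]
  | @assign r x σ hx =>
    intro s hs
    obtain ⟨s₁, e₁, v₁, h₁⟩ := x.exec_code_represents hs hx
    refine ⟨_, _, .seq e₁ (.instr _ _), ⟨fun r' => ?_, fun f i hi => ?_, ?_⟩, by simp [cost]⟩
    · by_cases hr : r' = r
      · subst hr
        simp [Instr.exec, v₁]
      · have : r'.code ≠ r.code := fun h => hr (Reg.code_injective h)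
        simp [Instr.exec, this, hr, h₁.reg]
    · simpa [Instr.exec] using h₁.fld f i hi
    · have := r.code_lt
      simp [Instr.exec, (show 99 ≠ r.code by omega), h₁.stride]
  | @store f i x σ hi hx hl =>
    intro s hs
    obtain ⟨s₁, e₁, v₁, h₁⟩ := i.exec_code_represents hs hi
    obtain ⟨s₂, e₂, v₂, m₂, r₂⟩ := x.exec_code 101 s₁ (by omega) h₁ hx
    have hst : s₂.reg 99 = BitVec.ofNat W S := by
      rw [r₂ _ (by omega), ← h₁.stride, BitVec.ofNat_toNat, BitVec.setWidth_eq]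
    have hv : s₂.reg 100 = BitVec.ofNat W (i.ev σ) := by
      rw [r₂ _ (by omega), ← v₁, BitVec.ofNat_toNat, BitVec.setWidth_eq]
    refine ⟨_, _, .seq e₁ (.seq e₂ (.seq (.instr _ _) (.seq (.instr _ _) (.seq (.instr _ _)
      (.instr _ _))))), ⟨fun r' => ?_, fun f' i' hi' => ?_, ?_⟩, by simp [cost]; omega⟩
    · have := r'.code_lt
      simp [Instr.exec, (show r'.code ≠ 102 by omega), (show r'.code ≠ 100 by omega),
        r₂ r'.code (by omega), h₁.reg]
    · have ha : BitVec.ofNat W (i.ev σ) + BitVec.ofNat W f.code * BitVec.ofNat W S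
          = BitVec.ofNat W (f.code * S + i.ev σ) := by
        simp [BitVec.ofNat_add, BitVec.ofNat_mul, BitVec.add_comm]
      simp only [Instr.exec, BinOp.eval]
      simp only [Function.update_self, ne_eq, Nat.reduceEqDiff, not_false_eq_true,
        Function.update_of_ne, hst, hv, ha]
      by_cases hc : f' = f ∧ i' = i.ev σ
      · obtain ⟨rfl, rfl⟩ := hc
        simp [v₂]
      · have hne : BitVec.ofNat W (f'.code * S + i') ≠ BitVec.ofNat W (f.code * S + i.ev σ) := by
          intro heq
          have := congrArg BitVec.toNat heq
          rw [BitVec.toNat_ofNat, BitVec.toNat_ofNat,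
            Nat.mod_eq_of_lt ((f'.address_lt hi').trans_le hS),
            Nat.mod_eq_of_lt ((f.address_lt hl).trans_le hS)] at this
          exact hc (Fld.address_inj hi' hl this)
        rw [Function.update_of_ne hne, m₂, h₁.fld f' i' hi']
        by_cases hf : f' = f
        · subst hf
          have : i' ≠ i.ev σ := fun h => hc ⟨rfl, h⟩
          simp [this]
        · simp [hf]
    · simp [Instr.exec, r₂ 99 (by omega), h₁.stride]
  | seq h₁ h₂ ih₁ ih₂ =>
    intro s hs
    obtain ⟨t₁, s₁, e₁, r₁, b₁⟩ := ih₁ s hs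
    obtain ⟨t₂, s₂, e₂, r₂, b₂⟩ := ih₂ s₁ r₁
    refine ⟨_, _, .seq e₁ e₂, r₂, ?_⟩
    have l₁ := h₁.ticks_le
    have l₂ := h₂.ticks_le
    rw [cost, add_mul]
    refine add_le_add (b₁.trans (Nat.mul_le_mul_left _ ?_)) (b₂.trans (Nat.mul_le_mul_left _ ?_))
      <;>
      omega
  | ite_true hc hz h₁ ih₁ =>
    intro s hs
    obtain ⟨s₁, e₁, v₁, h₁⟩ := Ex.exec_code_represents _ hs hc
    obtain ⟨t₂, s₂, e₂, r₂, b₂⟩ := ih₁ s₁ h₁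
    refine ⟨_, _, .seq e₁ (.ite_true (toNat_ne_zero (by rwa [v₁])) e₂), r₂, ?_⟩
    rw [cost]
    nlinarith
  | ite_false hc hz h₁ ih₁ =>
    intro s hs
    obtain ⟨s₁, e₁, v₁, h₁⟩ := Ex.exec_code_represents _ hs hc
    obtain ⟨t₂, s₂, e₂, r₂, b₂⟩ := ih₁ s₁ h₁
    refine ⟨_, _, .seq e₁ (.ite_false (toNat_eq_zero (by rwa [v₁])) e₂), r₂, ?_⟩
    rw [cost]
    nlinarith
  | while_exit hc hz =>
    intro s hs
    obtain ⟨s₁, e₁, v₁, h₁⟩ := Ex.exec_code_represents _ hs hc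
    refine ⟨_, _, .seq e₁ (Exec.loop_stop (toNat_eq_zero (by rwa [v₁]))), h₁, ?_⟩
    rw [cost]
    simp
  | @while_step c p σ₁ σ₂ σ₃ hc hz hb hw ihb ihw =>
    intro s hs
    obtain ⟨s₁, e₁, v₁, h₁⟩ := Ex.exec_code_represents _ hs hc
    obtain ⟨t₂, s₂, e₂, r₂, b₂⟩ := ihb s₁ h₁.tick
    obtain ⟨t₃, s₃, e₃, r₃, b₃⟩ := ihw s₂ r₂
    cases e₃ with
    | @seq _ _ _ s₄ _ ta tb ea eb =>
      refine ⟨_, _, .seq e₁ (.loop_step (toNat_ne_zero (by rwa [v₁])) (.seq e₂ ea) eb), r₃, ?_⟩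
      have l₁ := hb.ticks_le
      have l₂ := hw.ticks_le
      rw [St.tick_ticks] at l₁ b₂
      obtain ⟨d₁, hd₁⟩ := Nat.exists_eq_add_of_le l₁
      obtain ⟨d₂, hd₂⟩ := Nat.exists_eq_add_of_le l₂
      have e1 : σ₂.ticks - (σ₁.ticks + 1) = d₁ := by omega
      have e2 : σ₃.ticks - σ₂.ticks = d₂ := by omega
      have e3 : σ₃.ticks - σ₁.ticks = d₁ + d₂ + 1 := by omega
      rw [e1] at b₂
      rw [e2] at b₃
      rw [e3]
      rw [cost] at b₃ ⊢
      nlinarith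

/-! #### Total correctness -/

/-- Started in `σ`, the program halts within the bounds in a state with property `Q`. -/
def wp (M S : ℕ) (p : Cmd) (Q : St → Prop) (σ : St) : Prop := ∃ σ', Ev M S p σ σ' ∧ Q σ'

section wp

variable {M S : ℕ} {Q Q' : St → Prop} {σ : St}

theorem wp.mono {p : Cmd} (h : wp M S p Q σ) (hQ : ∀ σ', Q σ' → Q' σ') : wp M S p Q' σ :=
  let ⟨σ', e, q⟩ := h
  ⟨σ', e, hQ σ' q⟩

theorem wp_skip : wp M S .skip Q σ ↔ Q σ :=
  ⟨fun ⟨_, e, q⟩ => by cases e; exact q, fun h => ⟨_, .skip σ, h⟩⟩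

theorem wp_assign {r : Reg} {x : Ex} :
    wp M S (r ≔ x) Q σ ↔ x.ok M S σ ∧ Q (σ.set r (x.ev σ)) :=
  ⟨fun ⟨_, e, q⟩ => by cases e with | assign h => exact ⟨h, q⟩, fun h => ⟨_, .assign h.1, h.2⟩⟩

theorem wp_store {f : Fld} {i x : Ex} : wp M S (.store f i x) Q σ ↔
    i.ok M S σ ∧ x.ok M S σ ∧ i.ev σ < S ∧ Q (σ.put f (i.ev σ) (x.ev σ)) :=
  ⟨fun ⟨_, e, q⟩ => by cases e with | store h₁ h₂ h₃ => exact ⟨h₁, h₂, h₃, q⟩,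
    fun h => ⟨_, .store h.1 h.2.1 h.2.2.1, h.2.2.2⟩⟩

theorem wp_seq {p q : Cmd} : wp M S (p ;; q) Q σ ↔ wp M S p (wp M S q Q) σ :=
  ⟨fun ⟨_, e, h⟩ => by cases e with | seq h₁ h₂ => exact ⟨_, h₁, _, h₂, h⟩,
    fun ⟨_, e₁, _, e₂, h₂⟩ => ⟨_, .seq e₁ e₂, h₂⟩⟩

theorem wp_ite {c : Ex} {p q : Cmd} : wp M S (.ite c p q) Q σ ↔
    c.ok M S σ ∧ (c.ev σ ≠ 0 → wp M S p Q σ) ∧ (c.ev σ = 0 → wp M S q Q σ) := by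
  constructor
  · rintro ⟨σ', e, h⟩
    cases e with
    | ite_true h₁ h₂ h₃ => exact ⟨h₁, fun _ => ⟨_, h₃, h⟩, fun h₀ => absurd h₀ h₂⟩
    | ite_false h₁ h₂ h₃ => exact ⟨h₁, fun h₀ => absurd h₂ h₀, fun _ => ⟨_, h₃, h⟩⟩
  · rintro ⟨hc, h₁, h₂⟩
    by_cases h : c.ev σ = 0
    · obtain ⟨σ', e, q⟩ := h₂ h
      exact ⟨σ', .ite_false hc h e, q⟩
    · obtain ⟨σ', e, q⟩ := h₁ h
      exact ⟨σ', .ite_true hc h e, q⟩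

/-- The rule for loops. Since every round is counted, a bound on the counter that is part of the
invariant ensures termination. -/
theorem wp_while {c : Ex} {p : Cmd} (I : St → Prop) (T : ℕ) (h₀ : I σ)
    (hT : ∀ σ, I σ → σ.ticks ≤ T) (hc : ∀ σ, I σ → c.ok M S σ)
    (hb : ∀ σ, I σ → c.ev σ ≠ 0 → wp M S p I σ.tick)
    (hQ : ∀ σ, I σ → c.ev σ = 0 → Q σ) : wp M S (.while c p) Q σ := by
  obtain ⟨d, hd⟩ : ∃ d, T - σ.ticks ≤ d := ⟨_, le_rfl⟩
  induction d generalizing σ with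
  | zero =>
    by_cases h : c.ev σ = 0
    · exact ⟨σ, .while_exit (hc σ h₀) h, hQ σ h₀ h⟩
    · obtain ⟨σ', e, hI⟩ := hb σ h₀ h
      have h1 := e.ticks_le
      have h2 := hT σ' hI
      have h3 := hT σ h₀
      rw [St.tick_ticks] at h1
      omega
  | succ d ih =>
    by_cases h : c.ev σ = 0
    · exact ⟨σ, .while_exit (hc σ h₀) h, hQ σ h₀ h⟩
    · obtain ⟨σ₁, e₁, hI⟩ := hb σ h₀ h
      have h1 := e₁.ticks_le
      rw [St.tick_ticks] at h1
      obtain ⟨σ₂, e₂, q⟩ := ih hI (by omega)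
      exact ⟨σ₂, .while_step (hc σ h₀) h e₁ e₂, q⟩

end wp

end QuantMatch

/-! ### Labelled graphs and their representation -/

namespace QuantMatch

/-- The string contributed by an edge label; the label `0` stands for the empty string. -/
def lb (c : ℕ) : List ℕ := if c = 0 then [] else [c]

theorem lb_zero : lb 0 = [] := rfl

theorem lb_of_ne {c : ℕ} (h : c ≠ 0) : lb c = [c] := if_neg h

/-- Walks in a graph, given as a set of triples (source, target, label), with the string of their
labels. -/
inductive Walk (Γ : Set (ℕ × ℕ × ℕ)) : ℕ → List ℕ → ℕ → Prop
  | nil (v) : Walk Γ v [] v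
  | cons {a b c u t} : (a, b, c) ∈ Γ → Walk Γ b u t → Walk Γ a (lb c ++ u) t

theorem Walk.trans {Γ : Set (ℕ × ℕ × ℕ)} {a b c u v} (h : Walk Γ a u b) (h' : Walk Γ b v c) :
    Walk Γ a (u ++ v) c := by
  induction h with
  | nil => exact h'
  | cons hm _ ih => rw [List.append_assoc]; exact .cons hm (ih h')

theorem Walk.single {Γ : Set (ℕ × ℕ × ℕ)} {a b c} (h : (a, b, c) ∈ Γ) : Walk Γ a (lb c) b := by
  simpa using Walk.cons h (.nil b)

/-- Reachability by a walk with any labels. -/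
def Reach (Γ : Set (ℕ × ℕ × ℕ)) (a b : ℕ) : Prop := ∃ u, Walk Γ a u b

theorem Reach.refl {Γ : Set (ℕ × ℕ × ℕ)} (a : ℕ) : Reach Γ a a := ⟨_, .nil a⟩

theorem Reach.trans {Γ : Set (ℕ × ℕ × ℕ)} {a b c} (h : Reach Γ a b) (h' : Reach Γ b c) :
    Reach Γ a c := let ⟨_, h⟩ := h; let ⟨_, h'⟩ := h'; ⟨_, h.trans h'⟩

/-- The functions `head` and `next` describe, for every `v ≤ V`, the list in decreasing order of
the edges `e` among `1, …, E` with `key e = v`; `0` marks the end of a list. -/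
structure Adj (E V : ℕ) (key head next : ℕ → ℕ) : Prop where
  head_le : ∀ v ≤ V, head v ≤ E
  key_head : ∀ v ≤ V, head v ≠ 0 → key (head v) = v
  le_head : ∀ e, 1 ≤ e → e ≤ E → e ≤ head (key e)
  next_lt : ∀ e, 1 ≤ e → e ≤ E → next e < e
  key_next : ∀ e, 1 ≤ e → e ≤ E → next e ≠ 0 → key (next e) = key e
  le_next : ∀ e, 1 ≤ e → e ≤ E → ∀ e', 1 ≤ e' → e' < e → key e' = key e → e' ≤ next e

theorem Adj.insert {E V v : ℕ} {key head next : ℕ → ℕ} (h : Adj E V key head next)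
    (hv : v ≤ V) :
    Adj (E + 1) V (Function.update key (E + 1) v) (Function.update head v (E + 1))
      (Function.update next (E + 1) (head v)) := by
  have key_old : ∀ e ≤ E, Function.update key (E + 1) v e = key e := fun e he => by
    rw [Function.update_of_ne (by omega)]
  have next_old : ∀ e ≤ E, Function.update next (E + 1) (head v) e = next e := fun e he => by
    rw [Function.update_of_ne (by omega)]
  constructor
  · intro w hw
    by_cases hwv : w = v
    · simp [hwv]
    · simpa [hwv] using (h.head_le w hw).trans (Nat.le_succ E)
  · intro w hw
    by_cases hwv : w = v
    · simp [hwv]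
    · intro hz
      simp only [ne_eq, hwv, not_false_eq_true, Function.update_of_ne] at hz ⊢
      rw [key_old _ (h.head_le w hw), h.key_head w hw hz]
  · intro e h1 h2
    by_cases he : e = E + 1
    · simp [he]
    · rw [key_old e (by omega)]
      by_cases hwv : key e = v
      · simp only [hwv, Function.update_self]; omega
      · simpa [hwv] using h.le_head e h1 (by omega)
  · intro e h1 h2
    by_cases he : e = E + 1
    · have := h.head_le v hv
      simp only [he, Function.update_self]; omega
    · rw [next_old e (by omega)]
      exact h.next_lt e h1 (by omega)
  · intro e h1 h2
    by_cases he : e = E + 1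
    · subst he
      intro hz
      simp only [Function.update_self] at hz ⊢
      rw [key_old _ (h.head_le v hv), h.key_head v hv hz]
    · have := h.next_lt e h1 (by omega)
      rw [next_old e (by omega), key_old e (by omega), key_old _ (by omega)]
      exact h.key_next e h1 (by omega)
  · intro e h1 h2 e' h3 h4 h5
    by_cases he : e = E + 1
    · subst he
      rw [key_old e' (by omega), Function.update_self] at h5
      rw [Function.update_self, ← h5]
      exact h.le_head e' h3 (by omega)
    · rw [key_old e' (by omega), key_old e (by omega)] at h5
      rw [next_old e (by omega)]
      exact h.le_next e h1 (by omega) e' h3 h4 h5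

/-- The edges `1, …, E` with vertices among `1, …, V` form the graph `Γ`. -/
structure IsGraph (E V : ℕ) (src dst lab : ℕ → ℕ) (Γ : Set (ℕ × ℕ × ℕ)) : Prop where
  src_pos : ∀ e, 1 ≤ e → e ≤ E → 1 ≤ src e
  src_le : ∀ e, 1 ≤ e → e ≤ E → src e ≤ V
  dst_pos : ∀ e, 1 ≤ e → e ≤ E → 1 ≤ dst e
  dst_le : ∀ e, 1 ≤ e → e ≤ E → dst e ≤ V
  mem : ∀ e, 1 ≤ e → e ≤ E → (src e, dst e, lab e) ∈ Γ
  exists_edge : ∀ x y c, (x, y, c) ∈ Γ → ∃ e, 1 ≤ e ∧ e ≤ E ∧ src e = x ∧ dst e = y ∧ lab e = c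

/-- The state contains the graph `Γ` with lists of the incoming and of the outgoing edges of
every vertex. -/
structure GraphRep (V : ℕ) (Γ : Set (ℕ × ℕ × ℕ)) (σ : St) : Prop where
  graph : IsGraph (σ.reg .nE) V (σ.fld .src) (σ.fld .dst) (σ.fld .lab) Γ
  adjIn : Adj (σ.reg .nE) V (σ.fld .dst) (σ.fld .hIn) (σ.fld .nIn)
  adjOut : Adj (σ.reg .nE) V (σ.fld .src) (σ.fld .hOut) (σ.fld .nOut)

/-- Appends an edge from the vertex in register `x` to the vertex in register `y` with the label
in register `v`. -/
def emit : Cmd :=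
  .nE ≔ ◇.nE + .lit 1 ;;
  .store .src ◇.nE ◇.x ;;
  .store .dst ◇.nE ◇.y ;;
  .store .lab ◇.nE ◇.v ;;
  .store .nIn ◇.nE (.get .hIn ◇.y) ;;
  .store .hIn ◇.y ◇.nE ;;
  .store .nOut ◇.nE (.get .hOut ◇.x) ;;
  .store .hOut ◇.x ◇.nE

/-- The arrays that hold the graph. -/
def Fld.isGraph : Fld → Bool
  | .src | .dst | .lab | .hIn | .nIn | .hOut | .nOut => true
  | _ => false

/-- After `emit`, the state contains the graph with one more edge. -/
theorem wp_emit {M S V : ℕ} {Γ : Set (ℕ × ℕ × ℕ)} {σ : St} {Q : St → Prop} [hM : Fact (1 < M)]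
    (hS : S ≤ M) (hV : V < S) (hE : σ.reg .nE + 1 < S) (h : GraphRep V Γ σ)
    (hx : 1 ≤ σ.reg .x) (hx' : σ.reg .x ≤ V) (hy : 1 ≤ σ.reg .y) (hy' : σ.reg .y ≤ V)
    (hQ : ∀ σ', GraphRep V (insert (σ.reg .x, σ.reg .y, σ.reg .v) Γ) σ' →
      (∀ r, r ≠ .nE → σ'.reg r = σ.reg r) → σ'.reg .nE = σ.reg .nE + 1 → σ'.ticks = σ.ticks →
      (∀ f, f.isGraph = false → σ'.fld f = σ.fld f) → Q σ') : wp M S emit Q σ := by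
  have hM1 := hM.out
  simp only [emit, wp_seq, wp_assign, wp_store, ok_add, ok_var, ok_lit, ok_get, ev_add, ev_var,
    ev_lit, ev_get, true_and, St.set_reg_self, St.set_reg_of_ne, St.put_reg, ne_eq, reduceCtorEq,
    not_false_eq_true, St.put_fld_of_ne, St.set_fld]
  have hxS := hx'.trans_lt hV
  have hyS := hy'.trans_lt hV
  refine ⟨⟨hM1, by omega⟩, hE, hE, hE, hyS, hE, hyS, hxS, hE, hxS, hQ _ ⟨?_, ?_, ?_⟩ ?_ ?_ ?_ ?_⟩
  · simp only [St.put_reg, St.set_reg_self, St.put_fld_self, St.put_fld_of_ne, St.set_fld, ne_eq,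
      reduceCtorEq, not_false_eq_true]
    constructor
    · intro e h1 h2
      by_cases he : e = σ.reg .nE + 1
      · simpa [he] using hx
      · simpa [he] using h.graph.src_pos e h1 (by omega)
    · intro e h1 h2
      by_cases he : e = σ.reg .nE + 1
      · simpa [he] using hx'
      · simpa [he] using h.graph.src_le e h1 (by omega)
    · intro e h1 h2
      by_cases he : e = σ.reg .nE + 1
      · simpa [he] using hy
      · simpa [he] using h.graph.dst_pos e h1 (by omega)
    · intro e h1 h2
      by_cases he : e = σ.reg .nE + 1
      · simpa [he] using hy'
      · simpa [he] using h.graph.dst_le e h1 (by omega)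
    · intro e h1 h2
      by_cases he : e = σ.reg .nE + 1
      · simp [he]
      · simpa [he] using .inr (h.graph.mem e h1 (by omega))
    · rintro x y c (hm | hm)
      · refine ⟨_, by omega, le_rfl, ?_⟩
        simp only [Prod.mk.injEq] at hm
        simp [hm]
      · obtain ⟨e, h1, h2, h3⟩ := h.graph.exists_edge x y c hm
        refine ⟨e, h1, by omega, ?_⟩
        simpa [show e ≠ σ.reg .nE + 1 by omega] using h3
  · simpa using h.adjIn.insert hy'
  · simpa using h.adjOut.insert hx'
  · intro r hr
    simp [hr]
  · simp
  · simp
  · intro f hf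
    cases f <;> simp_all [Fld.isGraph]

end QuantMatch

/-! ### Linked lists and the output of a string -/

namespace QuantMatch

/-- The list `l` is stored as a linked list with first element `a` and successor function `f`;
`0` marks the end. -/
def Linked (f : ℕ → ℕ) : ℕ → List ℕ → Prop
  | a, [] => a = 0
  | a, x :: l => a = x ∧ x ≠ 0 ∧ Linked f (f x) l

theorem Linked.eq_nil {f : ℕ → ℕ} {l : List ℕ} (h : Linked f 0 l) : l = [] := by
  cases l with
  | nil => rfl
  | cons x l => exact absurd h.1.symm h.2.1

theorem Linked.exists_cons {f : ℕ → ℕ} {a : ℕ} {l : List ℕ} (h : Linked f a l) (ha : a ≠ 0) :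
    ∃ l', l = a :: l' ∧ Linked f (f a) l' := by
  cases l with
  | nil => exact absurd h ha
  | cons x l => obtain ⟨rfl, _, h⟩ := h; exact ⟨l, rfl, h⟩

theorem Linked.update {f : ℕ → ℕ} {a x v : ℕ} {l : List ℕ} (h : Linked f a l) (hx : x ∉ l) :
    Linked (Function.update f x v) a l := by
  induction l generalizing a with
  | nil => exact h
  | cons y l ih =>
    obtain ⟨rfl, h1, h2⟩ := h
    simp only [List.mem_cons, not_or] at hx
    exact ⟨rfl, h1, by rw [Function.update_of_ne (Ne.symm hx.1)]; exact ih h2 hx.2⟩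

theorem Linked.push {f : ℕ → ℕ} {a x : ℕ} {l : List ℕ} (h : Linked f a l) (hx : x ∉ l)
    (h0 : x ≠ 0) : Linked (Function.update f x a) x (x :: l) :=
  ⟨rfl, h0, by rw [Function.update_self]; exact h.update hx⟩

/-- A system of choices of outgoing edges: vertices are grouped by `comp`, each group is named by
one of its vertices with property `R`, and `ch z` is the edge by which the string `str z` leaves
the group `z`, or `0` if this string is empty. The rank `rk` decreases along the choices. -/
structure Choices (E V : ℕ) (dst lab comp ch : ℕ → ℕ) (R : ℕ → Prop) (str : ℕ → List ℕ)
    (rk : ℕ → ℕ) : Prop where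
  le : ∀ z, R z → z ≤ V
  rk_le : ∀ z, R z → rk z ≤ V
  finish : ∀ z, R z → ch z = 0 → str z = []
  ch_le : ∀ z, R z → ch z ≤ E
  dst_le : ∀ z, R z → ch z ≠ 0 → dst (ch z) ≤ V
  next : ∀ z, R z → ch z ≠ 0 → R (comp (dst (ch z)))
  rk_lt : ∀ z, R z → ch z ≠ 0 → rk (comp (dst (ch z))) < rk z
  str_eq : ∀ z, R z → ch z ≠ 0 → str z = lb (lab (ch z)) ++ str (comp (dst (ch z)))

/-- Reads off the answer from the arrays computed by the search. -/
def report : Cmd :=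
  .y ≔ .get .comp ◇.s ;;
  .ite ◇.y
    (.ite (.get .inf ◇.y)
      (.kind ≔ .lit 2)
      (.kind ≔ .lit 1 ;;
        .len ≔ .lit 0 ;;
        .e ≔ .get .ch ◇.y ;;
        .while ◇.e
          (.ite (.get .lab ◇.e)
            (.store .out ◇.len (.get .lab ◇.e) ;; .len ≔ ◇.len + .lit 1)
            .skip ;;
          .e ≔ .get .ch (.get .comp (.get .dst ◇.e)))))
    (.kind ≔ .lit 0)

/-- The answer to a matching problem as it is read off by `report`; letters are numbers. A string
has at most `V` letters. -/
def Reported (V : ℕ) (ans : Answer ℕ) (σ : St) : Prop :=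
  match ans with
  | .noString => σ.reg .kind = 0
  | .unbounded => σ.reg .kind = 2
  | .string u => σ.reg .kind = 1 ∧ σ.reg .len ≤ V ∧
      (List.range (σ.reg .len)).map (σ.fld .out) = u

/-- The arrays computed by the search determine the answer `ans`. -/
inductive Solution (V : ℕ) (σ : St) : Answer ℕ → Prop
  | noString : σ.fld .comp (σ.reg .s) = 0 → Solution V σ .noString
  | unbounded : σ.fld .comp (σ.reg .s) ≠ 0 → σ.fld .inf (σ.fld .comp (σ.reg .s)) ≠ 0 →
      Solution V σ .unbounded
  | string {R str rk} : σ.fld .comp (σ.reg .s) ≠ 0 → σ.fld .inf (σ.fld .comp (σ.reg .s)) = 0 →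
      R (σ.fld .comp (σ.reg .s)) → Choices (σ.reg .nE) V (σ.fld .dst) (σ.fld .lab) (σ.fld .comp)
        (σ.fld .ch) R str rk → Solution V σ (.string (str (σ.fld .comp (σ.reg .s))))

theorem map_range_update {f : ℕ → ℕ} {n v : ℕ} :
    (List.range (n + 1)).map (Function.update f n v) = (List.range n).map f ++ [v] := by
  rw [List.range_succ, List.map_append]
  congr 1
  · refine List.map_congr_left fun i hi => ?_
    rw [Function.update_of_ne (List.mem_range.1 hi).ne]
  · simp

/-- Following the choices from the group of `s`, at most one round for each group, yields the string
of this group, since ranks decrease. -/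
theorem wp_report {M S V : ℕ} [hM : Fact (2 < M)] (hV : V < S) (hS : S ≤ M) {σ : St}
    {ans : Answer ℕ} (hs : σ.reg .s ≤ V) (hc : σ.fld .comp (σ.reg .s) ≤ V)
    (hE : σ.reg .nE < S) (h : Solution V σ ans) :
    wp M S report (fun σ' => Reported V ans σ' ∧ σ'.ticks ≤ σ.ticks + V) σ := by
  have hM2 := hM.out
  simp only [report, wp_seq, wp_assign, wp_ite, ok_var, ok_lit, ok_get, ev_var, ev_lit, ev_get,
    true_and, St.set_reg_self, St.set_reg_of_ne, ne_eq, reduceCtorEq, not_false_eq_true,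
    St.set_fld]
  refine ⟨by omega, fun h0 => ⟨by omega, fun h1 => ⟨by omega, ?_⟩, fun h1 => ⟨by omega, by omega,
    by omega, ?_⟩⟩, fun h0 => ⟨by omega, ?_⟩⟩
  · cases h with
    | noString h => exact absurd h h0
    | unbounded => simp [Reported]
    | string _ h => exact absurd h h1
  · cases h with
    | noString h => exact absurd h h0
    | unbounded _ h => exact absurd h1 h
    | @string R str rk _ _ hR hC =>
      set σ₁ := (((σ.set .y (σ.fld .comp (σ.reg .s))).set .kind 1).set .len 0).set .e
        (σ.fld .ch (σ.fld .comp (σ.reg .s))) with hσ₁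
      refine wp_while (fun τ => τ.fld .dst = σ.fld .dst ∧ τ.fld .lab = σ.fld .lab ∧
        τ.fld .comp = σ.fld .comp ∧ τ.fld .ch = σ.fld .ch ∧ τ.reg .kind = 1 ∧
        ∃ z, R z ∧ τ.reg .e = σ.fld .ch z ∧ τ.reg .len + rk z ≤ V ∧
          τ.ticks + rk z ≤ σ.ticks + V ∧
          (List.range (τ.reg .len)).map (τ.fld .out) ++ str z =
            str (σ.fld .comp (σ.reg .s))) (σ.ticks + V) ?_ ?_ ?_ ?_ ?_
      · have := hC.rk_le _ hR
        refine ⟨rfl, rfl, rfl, rfl, by simp [hσ₁], _, hR, ?_, ?_, ?_, ?_⟩ <;> simp [hσ₁] <;> omega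
      · rintro τ ⟨_, _, _, _, _, z, _, _, _, h, _⟩
        omega
      · intros; trivial
      · rintro τ ⟨d1, d2, d3, d4, hk, z, hz, he, hl, ht, hout⟩ hne
        rw [ev_var, he] at hne
        have e1 := hC.ch_le z hz
        have e2 := hC.dst_le z hz hne
        have e3 := hC.next z hz hne
        have e4 := hC.rk_lt z hz hne
        have e5 := hC.str_eq z hz hne
        have e6 := hC.le _ e3
        simp only [wp_seq, wp_assign, wp_store, wp_skip, wp_ite, ok_add, ok_var, ok_lit, ok_get,
          ev_add, ev_var, ev_lit, ev_get, true_and, St.set_reg_self, St.set_reg_of_ne, St.put_reg,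
          ne_eq, reduceCtorEq, not_false_eq_true, St.put_fld_of_ne, St.set_fld, St.tick_reg,
          St.tick_fld, d1, d2, d3, d4, he]
        refine ⟨by omega, fun hlab => ⟨by omega, by omega, by omega, by omega, ?_⟩,
          fun hlab => ⟨by omega, ?_⟩⟩
        · refine ⟨hk, _, e3, rfl, by omega, ?_, ?_⟩
          · simp only [St.set_ticks, St.put_ticks, St.tick_ticks]
            omega
          · simp only [St.put_fld_self, St.tick_fld, map_range_update]
            rw [← hout, e5, lb_of_ne hlab, List.append_assoc]
        · refine ⟨hk, _, e3, rfl, by omega, ?_, ?_⟩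
          · simp only [St.set_ticks, St.tick_ticks]
            omega
          · rw [← hout, e5, hlab, lb_zero, List.nil_append]
      · rintro τ ⟨d1, d2, d3, d4, hk, z, hz, he, hl, ht, hout⟩ h0
        rw [ev_var, he] at h0
        rw [hC.finish z hz h0, List.append_nil] at hout
        exact ⟨⟨hk, by omega, hout⟩, by omega⟩
  · cases h with
    | noString => simp [Reported]
    | unbounded h => exact absurd h0 h
    | string h => exact absurd h0 h

end QuantMatch

/-! ### Shortest walks -/

namespace QuantMatch

/-- One round of the search for shortest walks to `t`. Register `e` runs through the incoming
edges of the vertex reached last. Edges with label `0` go to the list `la` and are followed first,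
the others go to the list `lb` of edges to be followed when `la` is exhausted. -/
def minStep : Cmd :=
  .ite ◇.e
    (.ite (.get .lab ◇.e)
      (.store .lk1 ◇.e ◇.lb ;; .lb ≔ ◇.e)
      (.store .lk1 ◇.e ◇.la ;; .la ≔ ◇.e) ;;
    .e ≔ .get .nIn ◇.e)
    (.ite ◇.la
      (.x ≔ ◇.la ;;
        .la ≔ .get .lk1 ◇.x ;;
        .y ≔ .get .src ◇.x ;;
        .ite (.get .comp ◇.y)
          .skip
          (.store .comp ◇.y ◇.y ;; .store .ch ◇.y ◇.x ;; .e ≔ .get .hIn ◇.y))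
      (.la ≔ ◇.lb ;; .lb ≔ .lit 0))

/-- Breadth-first search for shortest walks to the vertex `t`. -/
def minSearch : Cmd :=
  .store .comp ◇.t ◇.t ;;
  .e ≔ .get .hIn ◇.t ;;
  .la ≔ .lit 0 ;;
  .lb ≔ .lit 0 ;;
  .while (◇.e + ◇.la + ◇.lb) minStep

/-- The invariant of the search for shortest walks, which starts in state `ρ`. The vertices in
`U` have been reached, by way of the walks with strings `str`; none of them is farther than `d`
from `t`. The lists `A` and `B` contain edges that complete walks of length `d` and `d + 1`, and
`P` is the set of all edges that have been put into these lists so far. -/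
structure MinInv (ρ : St) (V : ℕ) (Γ : Set (ℕ × ℕ × ℕ)) (str : ℕ → List ℕ) (rk : ℕ → ℕ) (d : ℕ)
    (A B : List ℕ) (P U : Finset ℕ) (σ : St) : Prop where
  fld : ∀ f, f ≠ .comp → f ≠ .ch → f ≠ .lk1 → σ.fld f = ρ.fld f
  reg : ∀ r, r ≠ .e → r ≠ .x → r ≠ .y → r ≠ .la → r ≠ .lb → σ.reg r = ρ.reg r
  U_bound : ∀ v ∈ U, 1 ≤ v ∧ v ≤ V
  comp : ∀ v ≤ V, σ.fld .comp v = if v ∈ U then v else 0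
  walk : ∀ v ∈ U, Walk Γ v (str v) (ρ.reg .t)
  len : ∀ v ∈ U, (str v).length ≤ d
  t_mem : ρ.reg .t ∈ U
  t_str : str (ρ.reg .t) = []
  finish : ∀ v ∈ U, σ.fld .ch v = 0 → str v = []
  choice : ∀ v ∈ U, σ.fld .ch v ≠ 0 → σ.fld .ch v ≤ ρ.reg .nE ∧
    ρ.fld .dst (σ.fld .ch v) ∈ U ∧
    str v = lb (ρ.fld .lab (σ.fld .ch v)) ++ str (ρ.fld .dst (σ.fld .ch v)) ∧
    rk (ρ.fld .dst (σ.fld .ch v)) < rk v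
  rk_le : ∀ v ∈ U, rk v ≤ U.card
  linkA : Linked (σ.fld .lk1) (σ.reg .la) A
  linkB : Linked (σ.fld .lk1) (σ.reg .lb) B
  A_sub : ∀ e ∈ A, e ∈ P ∧ (lb (ρ.fld .lab e)).length + (str (ρ.fld .dst e)).length = d
  B_sub : ∀ e ∈ B, e ∈ P ∧ (lb (ρ.fld .lab e)).length + (str (ρ.fld .dst e)).length = d + 1
  P_bound : ∀ e ∈ P, 1 ≤ e ∧ e ≤ ρ.reg .nE
  P_dst : ∀ e ∈ P, ρ.fld .dst e ∈ U
  e_le : σ.reg .e ≤ ρ.reg .nE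
  e_spec : σ.reg .e ≠ 0 → ρ.fld .dst (σ.reg .e) ∈ U ∧ (str (ρ.fld .dst (σ.reg .e))).length = d ∧
    ∀ e', e' ≤ σ.reg .e → ρ.fld .dst e' = ρ.fld .dst (σ.reg .e) → e' ∉ P
  processed : ∀ e ∈ P, e ∈ A ∨ e ∈ B ∨ (ρ.fld .src e ∈ U ∧
    (str (ρ.fld .src e)).length ≤ (lb (ρ.fld .lab e)).length + (str (ρ.fld .dst e)).length)
  complete : ∀ e, 1 ≤ e → e ≤ ρ.reg .nE → ρ.fld .dst e ∈ U → e ∈ P ∨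
    (σ.reg .e ≠ 0 ∧ ρ.fld .dst e = ρ.fld .dst (σ.reg .e) ∧ e ≤ σ.reg .e)
  ticks : σ.ticks + A.length + 2 * B.length ≤ ρ.ticks + 3 * P.card

theorem card_le_of_bound {V : ℕ} {U : Finset ℕ} (h : ∀ v ∈ U, 1 ≤ v ∧ v ≤ V) : U.card ≤ V := by
  calc U.card ≤ (Finset.Icc 1 V).card :=
        Finset.card_le_card fun v hv => Finset.mem_Icc.2 (h v hv)
    _ = V := by simp

variable {M S V : ℕ} {Γ : Set (ℕ × ℕ × ℕ)} {ρ : St}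

section

variable {str : ℕ → List ℕ} {rk : ℕ → ℕ} {d : ℕ} {A B : List ℕ} {P U : Finset ℕ} {σ : St}

/-- Advancing to the next incoming edge after the current one has been put into a list. -/
theorem MinInv.scan {A' B' : List ℕ} {σ' : St} (hG : GraphRep V Γ ρ)
    (h : MinInv ρ V Γ str rk d A B P U σ) (he : σ.reg .e ≠ 0)
    (hfld : ∀ f, f ≠ .lk1 → σ'.fld f = σ.fld f)
    (hreg : ∀ r, r ≠ .e → r ≠ .la → r ≠ .lb → σ'.reg r = σ.reg r)
    (hA : Linked (σ'.fld .lk1) (σ'.reg .la) A') (hB : Linked (σ'.fld .lk1) (σ'.reg .lb) B')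
    (hAB : A' = σ.reg .e :: A ∧ B' = B ∧ ρ.fld .lab (σ.reg .e) = 0 ∨
      A' = A ∧ B' = σ.reg .e :: B ∧ ρ.fld .lab (σ.reg .e) ≠ 0)
    (hnext : σ'.reg .e = ρ.fld .nIn (σ.reg .e)) (ht : σ'.ticks = σ.ticks + 1) :
    MinInv ρ V Γ str rk d A' B' (insert (σ.reg .e) P) U σ' := by
  obtain ⟨he1, he2, he3⟩ := h.e_spec he
  have hpos : 1 ≤ σ.reg .e := Nat.one_le_iff_ne_zero.2 he
  have hP : σ.reg .e ∉ P := he3 _ le_rfl rfl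
  have hlt := hG.adjIn.next_lt _ hpos h.e_le
  have hcard := Finset.card_insert_of_notMem hP
  constructor
  case fld => intro f h1 h2 h3; rw [hfld f h3, h.fld f h1 h2 h3]
  case reg => intro r h1 h2 h3 h4 h5; rw [hreg r h1 h4 h5, h.reg r h1 h2 h3 h4 h5]
  case comp => rw [hfld _ (by simp)]; exact h.comp
  case finish => rw [hfld _ (by simp)]; exact h.finish
  case choice => rw [hfld _ (by simp)]; exact h.choice
  case linkA => exact hA
  case linkB => exact hB
  case U_bound => exact h.U_bound
  case walk => exact h.walk
  case len => exact h.len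
  case t_mem => exact h.t_mem
  case t_str => exact h.t_str
  case rk_le => exact h.rk_le
  case A_sub =>
    intro e hm
    have old : e ∈ A → e ∈ insert (σ.reg .e) P ∧
        (lb (ρ.fld .lab e)).length + (str (ρ.fld .dst e)).length = d := fun hm =>
      ⟨Finset.mem_insert_of_mem (h.A_sub e hm).1, (h.A_sub e hm).2⟩
    rcases hAB with ⟨rfl, -, h0⟩ | ⟨rfl, -, -⟩
    · rcases List.mem_cons.1 hm with rfl | hm
      · exact ⟨Finset.mem_insert_self _ _, by rw [h0, he2, lb_zero, List.length_nil, zero_add]⟩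
      · exact old hm
    · exact old hm
  case B_sub =>
    intro e hm
    have old : e ∈ B → e ∈ insert (σ.reg .e) P ∧
        (lb (ρ.fld .lab e)).length + (str (ρ.fld .dst e)).length = d + 1 := fun hm =>
      ⟨Finset.mem_insert_of_mem (h.B_sub e hm).1, (h.B_sub e hm).2⟩
    rcases hAB with ⟨-, rfl, -⟩ | ⟨-, rfl, h0⟩
    · exact old hm
    · rcases List.mem_cons.1 hm with rfl | hm
      · exact ⟨Finset.mem_insert_self _ _, by
          rw [lb_of_ne h0, he2, List.length_singleton, add_comm]⟩
      · exact old hm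
  case P_bound =>
    intro e hm
    rcases Finset.mem_insert.1 hm with rfl | hm
    · exact ⟨hpos, h.e_le⟩
    · exact h.P_bound e hm
  case P_dst =>
    intro e hm
    rcases Finset.mem_insert.1 hm with rfl | hm
    · exact he1
    · exact h.P_dst e hm
  case e_le => rw [hnext]; exact hlt.le.trans h.e_le
  case e_spec =>
    rw [hnext]
    intro hz
    have hk := hG.adjIn.key_next _ hpos h.e_le hz
    rw [hk]
    refine ⟨he1, he2, fun e' h1 h2 hm => ?_⟩
    rcases Finset.mem_insert.1 hm with rfl | hm
    · omega
    · exact he3 e' (by omega) h2 hm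
  case processed =>
    intro e hm
    rcases Finset.mem_insert.1 hm with rfl | hm
    · rcases hAB with ⟨rfl, -, -⟩ | ⟨-, rfl, -⟩ <;> simp
    · rcases hAB with ⟨rfl, rfl, -⟩ | ⟨rfl, rfl, -⟩
      · rcases h.processed e hm with h1 | h1 | h1
        · exact .inl (List.mem_cons_of_mem _ h1)
        · exact .inr (.inl h1)
        · exact .inr (.inr h1)
      · rcases h.processed e hm with h1 | h1 | h1
        · exact .inl h1
        · exact .inr (.inl (List.mem_cons_of_mem _ h1))
        · exact .inr (.inr h1)
  case complete =>
    rw [hnext]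
    intro e h1 h2 h3
    rcases h.complete e h1 h2 h3 with h4 | ⟨-, h5, h6⟩
    · exact .inl (Finset.mem_insert_of_mem h4)
    · rcases h6.lt_or_eq with h6 | rfl
      · have hle := hG.adjIn.le_next _ hpos h.e_le e h1 h6 h5
        have hz : ρ.fld .nIn (σ.reg .e) ≠ 0 := by omega
        exact .inr ⟨hz, by rw [h5, hG.adjIn.key_next _ hpos h.e_le hz], hle⟩
      · exact .inl (Finset.mem_insert_self _ _)
  case ticks =>
    have := h.ticks
    rw [hcard, ht]
    rcases hAB with ⟨rfl, rfl, -⟩ | ⟨rfl, rfl, -⟩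
    · rw [List.length_cons]; omega
    · rw [List.length_cons]; omega

/-- Dropping an edge whose source has been reached already. -/
theorem MinInv.drop {x : ℕ} {σ' : St} (h : MinInv ρ V Γ str rk d (x :: A) B P U σ)
    (hx : ρ.fld .src x ∈ U) (hfld : σ'.fld = σ.fld)
    (hreg : ∀ r, r ≠ .x → r ≠ .y → r ≠ .la → σ'.reg r = σ.reg r)
    (hA : Linked (σ.fld .lk1) (σ'.reg .la) A) (ht : σ'.ticks = σ.ticks + 1) :
    MinInv ρ V Γ str rk d A B P U σ' := by
  constructor
  case fld => rw [hfld]; exact h.fld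
  case reg => intro r h1 h2 h3 h4 h5; rw [hreg r h2 h3 h4, h.reg r h1 h2 h3 h4 h5]
  case comp => rw [hfld]; exact h.comp
  case finish => rw [hfld]; exact h.finish
  case choice => rw [hfld]; exact h.choice
  case linkA => rw [hfld]; exact hA
  case linkB => rw [hfld, hreg _ (by simp) (by simp) (by simp)]; exact h.linkB
  case U_bound => exact h.U_bound
  case walk => exact h.walk
  case len => exact h.len
  case t_mem => exact h.t_mem
  case t_str => exact h.t_str
  case rk_le => exact h.rk_le
  case A_sub => exact fun e hm => h.A_sub e (List.mem_cons_of_mem _ hm)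
  case B_sub => exact h.B_sub
  case P_bound => exact h.P_bound
  case P_dst => exact h.P_dst
  case e_le => rw [hreg _ (by simp) (by simp) (by simp)]; exact h.e_le
  case e_spec => rw [hreg _ (by simp) (by simp) (by simp)]; exact h.e_spec
  case processed =>
    intro e hm
    rcases h.processed e hm with h1 | h1
    · rcases List.mem_cons.1 h1 with rfl | h1
      · refine .inr (.inr ⟨hx, ?_⟩)
        rw [(h.A_sub e List.mem_cons_self).2]
        exact h.len _ hx
      · exact .inl h1
    · exact .inr h1
  case complete => rw [hreg _ (by simp) (by simp) (by simp)]; exact h.complete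
  case ticks =>
    have := h.ticks
    rw [List.length_cons] at this
    omega

/-- Following an edge to a vertex that has not been reached before. -/
theorem MinInv.visit {x : ℕ} {σ' : St} (hG : GraphRep V Γ ρ)
    (h : MinInv ρ V Γ str rk d (x :: A) B P U σ)
    (hx : ρ.fld .src x ∉ U) (he : σ.reg .e = 0)
    (hcomp : σ'.fld .comp = Function.update (σ.fld .comp) (ρ.fld .src x) (ρ.fld .src x))
    (hch : σ'.fld .ch = Function.update (σ.fld .ch) (ρ.fld .src x) x)
    (hfld : ∀ f, f ≠ .comp → f ≠ .ch → σ'.fld f = σ.fld f)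
    (hreg : ∀ r, r ≠ .e → r ≠ .x → r ≠ .y → r ≠ .la → σ'.reg r = σ.reg r)
    (he' : σ'.reg .e = ρ.fld .hIn (ρ.fld .src x))
    (hA : Linked (σ.fld .lk1) (σ'.reg .la) A) (ht : σ'.ticks = σ.ticks + 1) :
    MinInv ρ V Γ (Function.update str (ρ.fld .src x) (lb (ρ.fld .lab x) ++ str (ρ.fld .dst x)))
      (Function.update rk (ρ.fld .src x) (U.card + 1)) d A B P (insert (ρ.fld .src x) U) σ' := by
  obtain ⟨hxP, hxd⟩ := h.A_sub x List.mem_cons_self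
  obtain ⟨hx1, hx2⟩ := h.P_bound x hxP
  have hxdst := h.P_dst x hxP
  set y := ρ.fld .src x with hy
  have hy1 : 1 ≤ y := hG.graph.src_pos x hx1 hx2
  have hyV : y ≤ V := hG.graph.src_le x hx1 hx2
  have hne : ∀ v ∈ U, v ≠ y := fun v hv hvy => hx (hvy ▸ hv)
  set str' := Function.update str y (lb (ρ.fld .lab x) ++ str (ρ.fld .dst x)) with hstr'
  have str_old : ∀ v ∈ U, str' v = str v := fun v hv => by
    rw [hstr', Function.update_of_ne (hne v hv)]
  have str_y : str' y = lb (ρ.fld .lab x) ++ str (ρ.fld .dst x) := by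
    rw [hstr', Function.update_self]
  -- The new vertex has the rank `U.card + 1`, which is larger than all ranks before.
  have hcard := Finset.card_insert_of_notMem hx
  constructor
  case fld => intro f h1 h2 h3; rw [hfld f h1 h2, h.fld f h1 h2 h3]
  case reg => intro r h1 h2 h3 h4 h5; rw [hreg r h1 h2 h3 h4, h.reg r h1 h2 h3 h4 h5]
  case U_bound =>
    intro v hv
    rcases Finset.mem_insert.1 hv with rfl | hv
    · exact ⟨hy1, hyV⟩
    · exact h.U_bound v hv
  case comp =>
    intro v hv
    rw [hcomp]
    by_cases hvy : v = y
    · simp [hvy]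
    · simpa [hvy] using h.comp v hv
  case walk =>
    intro v hv
    rcases Finset.mem_insert.1 hv with rfl | hv
    · rw [str_y]
      exact .cons (hG.graph.mem x hx1 hx2) (h.walk _ hxdst)
    · rw [str_old v hv]; exact h.walk v hv
  case len =>
    intro v hv
    rcases Finset.mem_insert.1 hv with rfl | hv
    · rw [str_y, List.length_append, hxd]
    · rw [str_old v hv]; exact h.len v hv
  case t_mem => exact Finset.mem_insert_of_mem h.t_mem
  case t_str => rw [str_old _ h.t_mem]; exact h.t_str
  case finish =>
    intro v hv
    rw [hch]
    rcases Finset.mem_insert.1 hv with rfl | hv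
    · rw [Function.update_self]; omega
    · rw [Function.update_of_ne (hne v hv), str_old v hv]; exact h.finish v hv
  case choice =>
    intro v hv
    rw [hch]
    rcases Finset.mem_insert.1 hv with rfl | hv
    · rw [Function.update_self, str_y, str_old _ hxdst, Function.update_self,
        Function.update_of_ne (hne _ hxdst)]
      exact fun _ => ⟨hx2, Finset.mem_insert_of_mem hxdst, rfl,
        Nat.lt_succ_of_le (h.rk_le _ hxdst)⟩
    · rw [Function.update_of_ne (hne v hv), str_old v hv, Function.update_of_ne (hne v hv)]
      intro hz
      obtain ⟨h1, h2, h3, h4⟩ := h.choice v hv hz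
      rw [str_old _ h2, Function.update_of_ne (hne _ h2)]
      exact ⟨h1, Finset.mem_insert_of_mem h2, h3, h4⟩
  case rk_le =>
    intro v hv
    rw [hcard]
    rcases Finset.mem_insert.1 hv with rfl | hv
    · rw [Function.update_self]
    · rw [Function.update_of_ne (hne v hv)]
      exact (h.rk_le v hv).trans (Nat.le_succ _)
  case linkA => rw [hfld _ (by simp) (by simp)]; exact hA
  case linkB =>
    rw [hfld _ (by simp) (by simp), hreg _ (by simp) (by simp) (by simp) (by simp)]
    exact h.linkB
  case A_sub =>
    intro e hm
    obtain ⟨h1, h2⟩ := h.A_sub e (List.mem_cons_of_mem _ hm)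
    rw [str_old _ (h.P_dst e h1)]
    exact ⟨h1, h2⟩
  case B_sub =>
    intro e hm
    obtain ⟨h1, h2⟩ := h.B_sub e hm
    rw [str_old _ (h.P_dst e h1)]
    exact ⟨h1, h2⟩
  case P_bound => exact h.P_bound
  case P_dst => exact fun e hm => Finset.mem_insert_of_mem (h.P_dst e hm)
  case e_le => rw [he']; exact hG.adjIn.head_le y hyV
  case e_spec =>
    rw [he']
    intro hz
    rw [hG.adjIn.key_head y hyV hz]
    refine ⟨Finset.mem_insert_self _ _, by rw [str_y, List.length_append, hxd], ?_⟩
    intro e' _ h2 hm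
    exact hx (h2 ▸ h.P_dst e' hm)
  case processed =>
    intro e hm
    rw [str_old _ (h.P_dst e hm)]
    rcases h.processed e hm with h1 | h1 | ⟨h1, h2⟩
    · rcases List.mem_cons.1 h1 with rfl | h1
      · refine .inr (.inr ⟨Finset.mem_insert_self _ _, ?_⟩)
        rw [← hy, str_y, List.length_append]
      · exact .inl h1
    · exact .inr (.inl h1)
    · exact .inr (.inr ⟨Finset.mem_insert_of_mem h1, by rw [str_old _ h1]; exact h2⟩)
  case complete =>
    rw [he']
    intro e h1 h2 h3
    rcases Finset.mem_insert.1 h3 with h3 | h3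
    · have hle := hG.adjIn.le_head e h1 h2
      rw [h3] at hle
      have hz : ρ.fld .hIn y ≠ 0 := by omega
      exact .inr ⟨hz, by rw [h3, hG.adjIn.key_head y hyV hz], hle⟩
    · rcases h.complete e h1 h2 h3 with h4 | ⟨h4, _⟩
      · exact .inl h4
      · exact absurd he h4
  case ticks =>
    have := h.ticks
    rw [List.length_cons] at this
    omega

/-- Turning to the walks that are longer by one. -/
theorem MinInv.advance {σ' : St} (h : MinInv ρ V Γ str rk d [] B P U σ)
    (he : σ.reg .e = 0) (hB : B ≠ []) (hfld : σ'.fld = σ.fld)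
    (hreg : ∀ r, r ≠ .la → r ≠ .lb → σ'.reg r = σ.reg r)
    (hla : σ'.reg .la = σ.reg .lb) (hlb : σ'.reg .lb = 0) (ht : σ'.ticks = σ.ticks + 1) :
    MinInv ρ V Γ str rk (d + 1) B [] P U σ' := by
  have he' : σ'.reg .e = 0 := by rw [hreg _ (by simp) (by simp), he]
  constructor
  case fld => rw [hfld]; exact h.fld
  case reg => intro r h1 h2 h3 h4 h5; rw [hreg r h4 h5, h.reg r h1 h2 h3 h4 h5]
  case comp => rw [hfld]; exact h.comp
  case finish => rw [hfld]; exact h.finish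
  case choice => rw [hfld]; exact h.choice
  case linkA => rw [hfld, hla]; exact h.linkB
  case linkB => exact hlb
  case U_bound => exact h.U_bound
  case walk => exact h.walk
  case len => exact fun v hv => (h.len v hv).trans (Nat.le_succ d)
  case t_mem => exact h.t_mem
  case t_str => exact h.t_str
  case rk_le => exact h.rk_le
  case A_sub => exact h.B_sub
  case B_sub => simp
  case P_bound => exact h.P_bound
  case P_dst => exact h.P_dst
  case e_le => omega
  case e_spec => exact fun hz => absurd he' hz
  case processed =>
    intro e hm
    rcases h.processed e hm with h1 | h1 | h1
    · simp at h1
    · exact .inl h1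
    · exact .inr (.inr h1)
  case complete =>
    intro e h1 h2 h3
    rcases h.complete e h1 h2 h3 with h4 | ⟨h4, _⟩
    · exact .inl h4
    · exact absurd he h4
  case ticks =>
    have := h.ticks
    have := List.length_pos_iff.2 hB
    simp only [List.length_nil] at *
    omega

/-- Every round of the search preserves the invariant. If an incoming edge is being looked at, it is
put into a list; otherwise an edge of the current distance is followed, or the next distance
begins. -/
theorem MinInv.wp_step (hG : GraphRep V Γ ρ) (hV : V < S) (hE : ρ.reg .nE < S) (hS : 3 * S ≤ M)
    (h : MinInv ρ V Γ str rk d A B P U σ) (hne : σ.reg .e + σ.reg .la + σ.reg .lb ≠ 0) :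
    wp M S minStep (fun σ' => ∃ str rk d A B P U, MinInv ρ V Γ str rk d A B P U σ') σ.tick := by
  have hlab := h.fld .lab (by simp) (by simp) (by simp)
  have hnIn := h.fld .nIn (by simp) (by simp) (by simp)
  have hhIn := h.fld .hIn (by simp) (by simp) (by simp)
  have hsrc := h.fld .src (by simp) (by simp) (by simp)
  have he := h.e_le
  have heP : σ.reg .e ≠ 0 → σ.reg .e ∉ P := fun hz => (h.e_spec hz).2.2 _ le_rfl rfl
  rw [minStep, wp_ite]
  refine ⟨trivial, fun h0 => ?_, fun h0 => ?_⟩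
  · rw [ev_var, St.tick_reg] at h0
    have hA : σ.reg .e ∉ A := fun hm => heP h0 (h.A_sub _ hm).1
    have hB : σ.reg .e ∉ B := fun hm => heP h0 (h.B_sub _ hm).1
    simp only [wp_seq, wp_assign, wp_store, wp_ite, ok_var, ok_get, ev_var, ev_get, true_and,
      St.set_reg_of_ne, St.put_reg, ne_eq, reduceCtorEq, not_false_eq_true, St.put_fld_of_ne,
      St.set_fld, St.tick_reg, St.tick_fld]
    refine ⟨by omega, fun h1 => ⟨by omega, by omega, ?_⟩, fun h1 => ⟨by omega, by omega, ?_⟩⟩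
    · refine ⟨_, _, _, _, _, _, _, h.scan hG h0 ?_ ?_ (A' := A) (B' := σ.reg .e :: B) ?_ ?_
        (.inr ⟨rfl, rfl, by rwa [← hlab]⟩) ?_ ?_⟩
      · intro f hf; simp [hf]
      · intro r h1 h2 h3; simp [h1, h3]
      · simpa using h.linkA.update hA
      · simpa using h.linkB.push hB h0
      · simp [hnIn]
      · simp
    · refine ⟨_, _, _, _, _, _, _, h.scan hG h0 ?_ ?_ (A' := σ.reg .e :: A) (B' := B) ?_ ?_
        (.inl ⟨rfl, rfl, by rwa [← hlab]⟩) ?_ ?_⟩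
      · intro f hf; simp [hf]
      · intro r h1 h2 h3; simp [h1, h2]
      · simpa using h.linkA.push hA h0
      · simpa using h.linkB.update hB
      · simp [hnIn]
      · simp
  · rw [ev_var, St.tick_reg] at h0
    rw [wp_ite]
    refine ⟨trivial, fun h1 => ?_, fun h1 => ?_⟩
    · rw [ev_var, St.tick_reg] at h1
      obtain ⟨A, rfl, hA⟩ := h.linkA.exists_cons h1
      obtain ⟨hxP, -⟩ := h.A_sub _ List.mem_cons_self
      obtain ⟨hx1, hx2⟩ := h.P_bound _ hxP
      have hy := hG.graph.src_le _ hx1 hx2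
      have hy1 := hG.graph.src_pos _ hx1 hx2
      have hc := h.comp _ hy
      simp only [wp_seq, wp_assign, wp_store, wp_ite, wp_skip, ok_var, ok_get, ev_var, ev_get,
        true_and, St.set_reg_of_ne, St.set_reg_self, St.put_reg, ne_eq, reduceCtorEq,
        not_false_eq_true, St.put_fld_of_ne, St.set_fld, St.tick_reg, St.tick_fld, hsrc]
      refine ⟨by omega, by omega, by omega, fun h2 => ?_, fun h2 => ⟨by omega, by omega,
        by omega, ?_⟩⟩
      · refine ⟨_, _, _, _, _, _, _, h.drop (σ' := _) ?_ ?_ ?_ ?_ ?_⟩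
        · by_contra hU
          rw [if_neg hU] at hc
          exact h2 hc
        · rfl
        · intro r h1 h2 h3; simp [h1, h2, h3]
        · simpa using hA
        · simp
      · refine ⟨_, _, _, _, _, _, _, h.visit hG (σ' := _) ?_ h0 ?_ ?_ ?_ ?_ ?_ ?_ ?_⟩
        · intro hU
          rw [if_pos hU] at hc
          omega
        · simp
        · simp
        · intro f h1 h2; simp [h1, h2]
        · intro r h1 h2 h3 h4; simp [h1, h2, h3, h4]
        · simp [hhIn]
        · simpa using hA
        · simp
    · rw [ev_var, St.tick_reg] at h1
      have hA := h.linkA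
      rw [h1] at hA
      obtain rfl := hA.eq_nil
      simp only [wp_seq, wp_assign, ok_var, ok_lit, ev_var, ev_lit, true_and, St.tick_reg]
      refine ⟨by omega, _, _, _, _, _, _, _, h.advance h0 ?_ ?_ ?_ ?_ ?_ ?_⟩
      · rintro rfl
        have := h.linkB
        simp only [Linked] at this
        omega
      · simp
      · intro r h1 h2; simp [h1, h2]
      · simp
      · simp
      · simp

end

/-- The search is correct: when both lists are empty, the lengths of the strings found satisfy the
triangle inequality along every edge, so that no walk to `t` is shorter than the one found. Every
edge accounts for at most three rounds: one in which it is put into a list, one in which it is taken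
out, and, for each change of the distance, one of the edges of the next distance. -/
theorem wp_minSearch (hG : GraphRep V Γ ρ) (hV : V < S) (hE : ρ.reg .nE < S) (hS : 3 * S ≤ M)
    (ht : 1 ≤ ρ.reg .t) (htV : ρ.reg .t ≤ V) (hs : ρ.reg .s ≤ V) (hs1 : 1 ≤ ρ.reg .s)
    (hcomp : ∀ v ≤ V, ρ.fld .comp v = 0) (hch : ∀ v ≤ V, ρ.fld .ch v = 0)
    (hinf : ∀ v ≤ V, ρ.fld .inf v = 0) :
    wp M S minSearch (fun σ => (∃ ans, Solution V σ ans ∧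
        Variant.Correct {u | Walk Γ (ρ.reg .s) u (ρ.reg .t)} .min ans) ∧
      σ.reg .s = ρ.reg .s ∧ σ.reg .nE = ρ.reg .nE ∧ σ.fld .comp (σ.reg .s) ≤ V ∧
      σ.ticks ≤ ρ.ticks + 3 * ρ.reg .nE) ρ := by
  simp only [minSearch, wp_seq, wp_assign, wp_store, ok_var, ok_lit, ok_get, ev_var, ev_lit,
    ev_get, true_and, St.put_reg, ne_eq, reduceCtorEq, not_false_eq_true, St.put_fld_of_ne]
  refine ⟨by omega, by omega, by omega, by omega, ?_⟩
  refine wp_while (fun σ => ∃ str rk d A B P U, MinInv ρ V Γ str rk d A B P U σ)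
    (ρ.ticks + 3 * ρ.reg .nE) ⟨fun _ => [], fun _ => 0, 0, [], [], ∅, {ρ.reg .t}, ?_⟩ ?_ ?_ ?_ ?_
  · constructor
    case fld => intro f h1 h2 h3; simp [h1]
    case reg => intro r h1 h2 h3 h4 h5; simp [h1, h4, h5]
    case comp =>
      intro v hv
      by_cases h : v = ρ.reg .t
      · simp [h]
      · simpa [h] using hcomp v hv
    case choice =>
      intro v hv hz
      rw [Finset.mem_singleton.1 hv] at hz
      exact absurd (hch _ htV) (by simpa using hz)
    case linkA => simp [Linked]
    case linkB => simp [Linked]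
    case walk => intro v hv; rw [Finset.mem_singleton.1 hv]; exact .nil _
    case e_le => simpa using hG.adjIn.head_le _ htV
    case e_spec =>
      intro hz
      have hz' : ρ.fld .hIn (ρ.reg .t) ≠ 0 := by simpa using hz
      simpa using hG.adjIn.key_head _ htV hz'
    case complete =>
      intro e h1 h2 h3
      have h3' : ρ.fld .dst e = ρ.reg .t := by simpa using h3
      have h4 := hG.adjIn.le_head e h1 h2
      rw [h3'] at h4
      have hz : ρ.fld .hIn (ρ.reg .t) ≠ 0 := by omega
      refine .inr ⟨by simpa using hz, ?_, by simpa using h4⟩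
      simpa [h3'] using (hG.adjIn.key_head _ htV hz).symm
    all_goals simp
    exact ⟨ht, htV⟩
  · rintro σ ⟨str, rk, d, A, B, P, U, h⟩
    have := h.ticks
    have := card_le_of_bound h.P_bound
    omega
  · rintro σ ⟨str, rk, d, A, B, P, U, h⟩
    have h1 := h.e_le
    have h2 : σ.reg .la ≤ ρ.reg .nE := by
      by_cases hz : σ.reg .la = 0
      · omega
      · obtain ⟨A', rfl, -⟩ := h.linkA.exists_cons hz
        exact (h.P_bound _ (h.A_sub _ List.mem_cons_self).1).2
    have h3 : σ.reg .lb ≤ ρ.reg .nE := by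
      by_cases hz : σ.reg .lb = 0
      · omega
      · obtain ⟨B', rfl, -⟩ := h.linkB.exists_cons hz
        exact (h.P_bound _ (h.B_sub _ List.mem_cons_self).1).2
    simp only [ok_add, ok_var, ev_add, ev_var, true_and]
    omega
  · rintro σ ⟨str, rk, d, A, B, P, U, h⟩ hne
    exact h.wp_step hG hV hE hS hne
  · rintro σ ⟨str, rk, d, A, B, P, U, h⟩ h0
    simp only [ev_add, ev_var] at h0
    have hA := h.linkA
    have hB := h.linkB
    rw [show σ.reg .la = 0 by omega] at hA
    rw [show σ.reg .lb = 0 by omega] at hB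
    obtain rfl := hA.eq_nil
    obtain rfl := hB.eq_nil
    have hes : σ.reg .s = ρ.reg .s := h.reg _ (by simp) (by simp) (by simp) (by simp) (by simp)
    have heE : σ.reg .nE = ρ.reg .nE := h.reg _ (by simp) (by simp) (by simp) (by simp) (by simp)
    have hfin : ∀ x c y, (x, y, c) ∈ Γ → y ∈ U →
        x ∈ U ∧ (str x).length ≤ (lb c).length + (str y).length := by
      intro x c y hm hy
      obtain ⟨e, h1, h2, rfl, rfl, rfl⟩ := hG.graph.exists_edge x y c hm
      rcases h.complete e h1 h2 hy with h3 | ⟨h3, -⟩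
      · simpa using h.processed e h3
      · omega
    have hmin : ∀ x u y, Walk Γ x u y → y = ρ.reg .t → x ∈ U ∧ (str x).length ≤ u.length := by
      intro x u y hw
      induction hw with
      | nil v => rintro rfl; exact ⟨h.t_mem, by simp [h.t_str]⟩
      | cons hm _ ih =>
        intro ht
        obtain ⟨h1, h2⟩ := ih ht
        obtain ⟨h3, h4⟩ := hfin _ _ _ hm h1
        rw [List.length_append]
        exact ⟨h3, by omega⟩
    have hcs := h.comp _ hs
    have hcard := card_le_of_bound h.U_bound
    refine ⟨?_, hes, heE, ?_, ?_⟩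
    · by_cases hU : ρ.reg .s ∈ U
      · rw [if_pos hU] at hcs
        have hsol : Solution V σ (.string (str (σ.fld .comp (σ.reg .s)))) := by
          refine .string (R := (· ∈ U)) (rk := rk) ?_ ?_ ?_ ?_
          · rw [hes, hcs]; omega
          · rw [hes, hcs, h.fld _ (by simp) (by simp) (by simp)]; exact hinf _ hs
          · rw [hes, hcs]; exact hU
          · rw [heE, h.fld .dst (by simp) (by simp) (by simp),
              h.fld .lab (by simp) (by simp) (by simp)]
            have hcd : ∀ z ∈ U, σ.fld .ch z ≠ 0 → σ.fld .comp (ρ.fld .dst (σ.fld .ch z)) =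
                ρ.fld .dst (σ.fld .ch z) := fun z hz h0 => by
              have h1 := (h.choice z hz h0).2.1
              rw [h.comp _ (h.U_bound _ h1).2, if_pos h1]
            constructor
            · exact fun z hz => (h.U_bound z hz).2
            · exact fun z hz => (h.rk_le z hz).trans hcard
            · exact h.finish
            · intro z hz
              by_cases h0 : σ.fld .ch z = 0
              · omega
              · exact (h.choice z hz h0).1
            · exact fun z hz h0 => (h.U_bound _ (h.choice z hz h0).2.1).2
            · exact fun z hz h0 => by rw [hcd z hz h0]; exact (h.choice z hz h0).2.1
            · exact fun z hz h0 => by rw [hcd z hz h0]; exact (h.choice z hz h0).2.2.2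
            · exact fun z hz h0 => by rw [hcd z hz h0]; exact (h.choice z hz h0).2.2.1
        refine ⟨_, hsol, ?_⟩
        rw [hes, hcs]
        exact ⟨h.walk _ hU, fun v hv => (hmin _ _ _ hv rfl).2⟩
      · rw [if_neg hU] at hcs
        refine ⟨.noString, .noString (by rw [hes, hcs]), ?_⟩
        refine Set.eq_empty_iff_forall_notMem.2 fun u hu => hU (hmin _ _ _ hu rfl).1
    · rw [hes, hcs]; split_ifs <;> omega
    · have := h.ticks
      have := card_le_of_bound h.P_bound
      omega

end QuantMatch

/-! ### Depth-first search -/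

namespace QuantMatch

/-- One round of the depth-first search along incoming edges. The array `hIn` holds for every
vertex the next edge to be looked at. The stack of open vertices is the list `la`, the list `fin`
holds the finished vertices, the last one first. -/
def dfsStep : Cmd :=
  .x ≔ ◇.la ;;
  .e ≔ .get .hIn ◇.x ;;
  .ite ◇.e
    (.store .hIn ◇.x (.get .nIn ◇.e) ;;
      .y ≔ .get .src ◇.e ;;
      .ite (.get .col ◇.y)
        .skip
        (.store .col ◇.y (.lit 1) ;; .store .lk1 ◇.y ◇.la ;; .la ≔ ◇.y))
    (.la ≔ .get .lk1 ◇.x ;; .store .lk2 ◇.x ◇.fin ;; .fin ≔ ◇.x)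

/-- Depth-first search from `t` along incoming edges. -/
def dfs : Cmd :=
  .store .col ◇.t (.lit 1) ;;
  .store .lk1 ◇.t (.lit 0) ;;
  .la ≔ ◇.t ;;
  .fin ≔ .lit 0 ;;
  .while ◇.la dfsStep

/-- The invariant of the depth-first search, which starts in state `ρ`: the list `K` is the stack,
`F` lists the finished vertices, the last one first, `τ` is the time of finishing, and `P`
contains edges that have been looked at. -/
structure DfsInv (ρ : St) (V : ℕ) (Γ : Set (ℕ × ℕ × ℕ)) (K F : List ℕ) (τ : ℕ → ℕ)
    (P : Finset ℕ) (σ : St) : Prop where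
  fld : ∀ f, f ≠ .col → f ≠ .hIn → f ≠ .lk1 → f ≠ .lk2 → σ.fld f = ρ.fld f
  reg : ∀ r, r ≠ .e → r ≠ .x → r ≠ .y → r ≠ .la → r ≠ .fin → σ.reg r = ρ.reg r
  col : ∀ v ≤ V, σ.fld .col v ≠ 0 ↔ v ∈ K ∨ v ∈ F
  nodup : (K ++ F).Nodup
  bound : ∀ v, v ∈ K ∨ v ∈ F → 1 ≤ v ∧ v ≤ V
  linkK : Linked (σ.fld .lk1) (σ.reg .la) K
  linkF : Linked (σ.fld .lk2) (σ.reg .fin) F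
  stack : K.Pairwise (Reach Γ)
  bottom : (∃ l, K = l ++ [ρ.reg .t]) ∨ K = [] ∧ ∃ l, F = ρ.reg .t :: l
  reach : ∀ v, v ∈ K ∨ v ∈ F → Reach Γ v (ρ.reg .t)
  sorted : F.Pairwise (fun a b => τ b < τ a)
  time_lt : ∀ v ∈ F, τ v < F.length
  ptr_le : ∀ v ≤ V, σ.fld .hIn v ≤ ρ.reg .nE
  ptr_dst : ∀ v ≤ V, σ.fld .hIn v ≠ 0 → ρ.fld .dst (σ.fld .hIn v) = v
  ptr_old : ∀ v ≤ V, v ∉ K → v ∉ F → σ.fld .hIn v = ρ.fld .hIn v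
  ptr_fin : ∀ v ∈ F, σ.fld .hIn v = 0
  scanned : ∀ e, 1 ≤ e → e ≤ ρ.reg .nE → σ.fld .hIn (ρ.fld .dst e) < e →
    ρ.fld .src e ∈ K ∨ ρ.fld .src e ∈ F
  back_open : ∀ e, 1 ≤ e → e ≤ ρ.reg .nE → ρ.fld .dst e ∈ F → ρ.fld .src e ∈ K →
    ∀ x ∈ F, τ (ρ.fld .dst e) ≤ τ x → Reach Γ x (ρ.fld .src e)
  back : ∀ e, 1 ≤ e → e ≤ ρ.reg .nE → ρ.fld .dst e ∈ F → ρ.fld .src e ∈ F →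
    τ (ρ.fld .dst e) < τ (ρ.fld .src e) → ∀ x ∈ F, τ (ρ.fld .dst e) ≤ τ x →
      τ x ≤ τ (ρ.fld .src e) → Reach Γ x (ρ.fld .src e)
  P_bound : ∀ e ∈ P, 1 ≤ e ∧ e ≤ ρ.reg .nE
  P_ptr : ∀ e ∈ P, σ.fld .hIn (ρ.fld .dst e) < e
  ticks : σ.ticks ≤ ρ.ticks + P.card + F.length

/-- The result of the depth-first search from `t` along incoming edges: `F` lists the vertices
from which `t` can be reached in the reverse order of their finishing times `τ`. If an edge leads
from a vertex to one that was finished earlier, then the former can be reached from all vertices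
finished in between. -/
structure DfsDone (ρ : St) (V : ℕ) (Γ : Set (ℕ × ℕ × ℕ)) (F : List ℕ) (τ : ℕ → ℕ) : Prop where
  graph : IsGraph (ρ.reg .nE) V (ρ.fld .src) (ρ.fld .dst) (ρ.fld .lab) Γ
  adjOut : Adj (ρ.reg .nE) V (ρ.fld .src) (ρ.fld .hOut) (ρ.fld .nOut)
  col : ∀ v ≤ V, ρ.fld .col v ≠ 0 ↔ v ∈ F
  bound : ∀ v ∈ F, 1 ≤ v ∧ v ≤ V
  nodup : F.Nodup
  link : Linked (ρ.fld .lk2) (ρ.reg .fin) F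
  head : ∃ l, F = ρ.reg .t :: l
  reach : ∀ v ∈ F, Reach Γ v (ρ.reg .t)
  sorted : F.Pairwise (fun a b => τ b < τ a)
  closed : ∀ e, 1 ≤ e → e ≤ ρ.reg .nE → ρ.fld .dst e ∈ F → ρ.fld .src e ∈ F
  back : ∀ e, 1 ≤ e → e ≤ ρ.reg .nE → ρ.fld .dst e ∈ F → ρ.fld .src e ∈ F →
    τ (ρ.fld .dst e) < τ (ρ.fld .src e) → ∀ x ∈ F, τ (ρ.fld .dst e) ≤ τ x →
      τ x ≤ τ (ρ.fld .src e) → Reach Γ x (ρ.fld .src e)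

section

variable {M S V : ℕ} {Γ : Set (ℕ × ℕ × ℕ)} {ρ σ σ' : St} {K F : List ℕ} {τ : ℕ → ℕ}
  {P : Finset ℕ}

/-- Looking at the next incoming edge of the topmost open vertex `x`; if its source has not been
seen before, it becomes the topmost open vertex. -/
theorem DfsInv.scan {K' : List ℕ} {x e : ℕ} (hG : GraphRep V Γ ρ)
    (h : DfsInv ρ V Γ (x :: K) F τ P σ) (he : σ.fld .hIn x = e) (h0 : e ≠ 0)
    (hK : K' = x :: K ∧ (ρ.fld .src e ∈ x :: K ∨ ρ.fld .src e ∈ F) ∧ σ'.fld .col = σ.fld .col ∨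
      K' = ρ.fld .src e :: x :: K ∧ ρ.fld .src e ∉ x :: K ∧ ρ.fld .src e ∉ F ∧
        σ'.fld .col = Function.update (σ.fld .col) (ρ.fld .src e) 1)
    (hfld : ∀ f, f ≠ .col → f ≠ .hIn → f ≠ .lk1 → σ'.fld f = σ.fld f)
    (hreg : ∀ r, r ≠ .e → r ≠ .x → r ≠ .y → r ≠ .la → σ'.reg r = σ.reg r)
    (hptr : σ'.fld .hIn = Function.update (σ.fld .hIn) x (ρ.fld .nIn e))
    (hlink : Linked (σ'.fld .lk1) (σ'.reg .la) K') (ht : σ'.ticks = σ.ticks + 1) :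
    DfsInv ρ V Γ K' F τ (insert e P) σ' := by
  have hxV := h.bound x (.inl List.mem_cons_self)
  have heE : e ≤ ρ.reg .nE := he ▸ h.ptr_le x hxV.2
  have hed : ρ.fld .dst e = x := he ▸ h.ptr_dst x hxV.2 (by rwa [he])
  have he1 : 1 ≤ e := Nat.one_le_iff_ne_zero.2 h0
  have hlt := hG.adjIn.next_lt e he1 heE
  have hs1 := hG.graph.src_pos e he1 heE
  have hsV := hG.graph.src_le e he1 heE
  have hreach : Reach Γ (ρ.fld .src e) x := ⟨_, .single (hed ▸ hG.graph.mem e he1 heE)⟩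
  have hxF : x ∉ F := fun hx => by
    have := h.nodup
    rw [List.nodup_append] at this
    exact this.2.2 x List.mem_cons_self x hx rfl
  have heP : e ∉ P := fun hm => by
    have := h.P_ptr e hm
    rw [hed, he] at this
    exact this.false
  have hsub : ∀ v, v ∈ x :: K → v ∈ K' := by
    rcases hK with ⟨rfl, -⟩ | ⟨rfl, -⟩
    · exact fun v hv => hv
    · exact fun v hv => List.mem_cons_of_mem _ hv
  have hsub' : ∀ v, v ∈ K' → v ∈ x :: K ∨ v = ρ.fld .src e := by
    rcases hK with ⟨rfl, -⟩ | ⟨rfl, -⟩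
    · exact fun v hv => .inl hv
    · exact fun v hv => (List.mem_cons.1 hv).symm
  have hseen : ρ.fld .src e ∈ K' ∨ ρ.fld .src e ∈ F := by
    rcases hK with ⟨rfl, h1, -⟩ | ⟨rfl, -⟩
    · exact h1
    · exact .inl List.mem_cons_self
  have hdec : ∀ v, σ'.fld .hIn v ≤ σ.fld .hIn v := fun v => by
    rw [hptr]
    by_cases hv : v = x
    · subst hv; simp only [Function.update_self]; omega
    · simp [hv]
  constructor
  case fld => intro f h1 h2 h3 h4; rw [hfld f h1 h2 h3, h.fld f h1 h2 h3 h4]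
  case reg => intro r h1 h2 h3 h4 h5; rw [hreg r h1 h2 h3 h4, h.reg r h1 h2 h3 h4 h5]
  case col =>
    intro v hv
    rcases hK with ⟨rfl, -, hc⟩ | ⟨rfl, -, -, hc⟩
    · rw [hc]; exact h.col v hv
    · rw [hc]
      by_cases hve : v = ρ.fld .src e
      · simp [hve]
      · rw [Function.update_of_ne hve, h.col v hv, List.mem_cons (a := v) (b := ρ.fld .src e)]
        simp [hve]
  case nodup =>
    rcases hK with ⟨rfl, -⟩ | ⟨rfl, h1, h2, -⟩
    · exact h.nodup
    · rw [List.cons_append, List.nodup_cons]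
      exact ⟨by rw [List.mem_append]; exact not_or.2 ⟨h1, h2⟩, h.nodup⟩
  case bound =>
    rintro v (hv | hv)
    · rcases hsub' v hv with hv | rfl
      · exact h.bound v (.inl hv)
      · exact ⟨hs1, hsV⟩
    · exact h.bound v (.inr hv)
  case linkK => exact hlink
  case linkF =>
    rw [hfld _ (by simp) (by simp) (by simp), hreg _ (by simp) (by simp) (by simp) (by simp)]
    exact h.linkF
  case stack =>
    rcases hK with ⟨rfl, -⟩ | ⟨rfl, -⟩
    · exact h.stack
    · refine List.pairwise_cons.2 ⟨fun v hv => ?_, h.stack⟩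
      rcases List.mem_cons.1 hv with rfl | hv
      · exact hreach
      · exact hreach.trans ((List.pairwise_cons.1 h.stack).1 v hv)
  case bottom =>
    rcases h.bottom with ⟨l, hl⟩ | ⟨hl, -⟩
    · rcases hK with ⟨rfl, -⟩ | ⟨rfl, -⟩
      · exact .inl ⟨l, hl⟩
      · exact .inl ⟨ρ.fld .src e :: l, by rw [hl]; rfl⟩
    · simp at hl
  case reach =>
    rintro v (hv | hv)
    · rcases hsub' v hv with hv | rfl
      · exact h.reach v (.inl hv)
      · exact hreach.trans (h.reach x (.inl List.mem_cons_self))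
    · exact h.reach v (.inr hv)
  case sorted => exact h.sorted
  case time_lt => exact h.time_lt
  case ptr_le => exact fun v hv => (hdec v).trans (h.ptr_le v hv)
  case ptr_dst =>
    intro v hv
    rw [hptr]
    by_cases hvx : v = x
    · subst hvx
      rw [Function.update_self]
      intro hz
      rw [hG.adjIn.key_next e he1 heE hz, hed]
    · rw [Function.update_of_ne hvx]
      exact h.ptr_dst v hv
  case ptr_old =>
    intro v hv h1 h2
    have h3 : v ∉ x :: K := fun hm => h1 (hsub v hm)
    have h4 : v ≠ x := fun hvx => h3 (by rw [hvx]; exact List.mem_cons_self)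
    rw [hptr, Function.update_of_ne h4]
    exact h.ptr_old v hv h3 h2
  case ptr_fin =>
    intro v hv
    have := hdec v
    rw [h.ptr_fin v hv] at this
    omega
  case scanned =>
    intro e' h1 h2 h3
    by_cases hee : e' = e
    · rw [hee]; exact hseen
    · have h4 : σ.fld .hIn (ρ.fld .dst e') < e' := by
        rw [hptr] at h3
        by_cases hd : ρ.fld .dst e' = x
        · rw [hd, Function.update_self] at h3
          rw [hd, he]
          by_contra hlt'
          have := hG.adjIn.le_next e he1 heE e' h1 (by omega) (hd.trans hed.symm)
          omega
        · rwa [Function.update_of_ne hd] at h3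
      rcases h.scanned e' h1 h2 h4 with h5 | h5
      · exact .inl (hsub _ h5)
      · exact .inr h5
  case back_open =>
    intro e' h1 h2 h3 h4
    have h5 : ρ.fld .src e' ∈ x :: K ∨ ρ.fld .src e' ∈ F :=
      h.scanned e' h1 h2 (by rw [h.ptr_fin _ h3]; omega)
    have h6 : ρ.fld .src e' ∈ x :: K := by
      rcases hK with ⟨rfl, -⟩ | ⟨rfl, h7, h8, -⟩
      · exact h4
      · rcases List.mem_cons.1 h4 with h9 | h9
        · rw [h9] at h5
          exact absurd h5 (not_or.2 ⟨h7, h8⟩)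
        · exact h9
    exact h.back_open e' h1 h2 h3 h6
  case back => exact h.back
  case P_bound =>
    intro e' hm
    rcases Finset.mem_insert.1 hm with rfl | hm
    · exact ⟨he1, heE⟩
    · exact h.P_bound e' hm
  case P_ptr =>
    intro e' hm
    rcases Finset.mem_insert.1 hm with rfl | hm
    · rw [hed, hptr, Function.update_self]
      exact hlt
    · exact (hdec _).trans_lt (h.P_ptr e' hm)
  case ticks =>
    rw [Finset.card_insert_of_notMem heP, ht]
    have := h.ticks
    omega

/-- The topmost open vertex `x` is finished. -/
theorem DfsInv.finish {x : ℕ} (h : DfsInv ρ V Γ (x :: K) F τ P σ) (h0 : σ.fld .hIn x = 0)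
    (hfld : ∀ f, f ≠ .lk2 → σ'.fld f = σ.fld f)
    (hreg : ∀ r, r ≠ .e → r ≠ .x → r ≠ .la → r ≠ .fin → σ'.reg r = σ.reg r)
    (hlinkK : Linked (σ.fld .lk1) (σ'.reg .la) K)
    (hlinkF : Linked (σ'.fld .lk2) (σ'.reg .fin) (x :: F)) (ht : σ'.ticks = σ.ticks + 1) :
    DfsInv ρ V Γ K (x :: F) (Function.update τ x F.length) P σ' := by
  have hxF : x ∉ F := fun hx => by
    have := h.nodup
    rw [List.nodup_append] at this
    exact this.2.2 x List.mem_cons_self x hx rfl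
  have hxK : x ∉ K := by
    have := (List.nodup_append.1 h.nodup).1
    exact (List.nodup_cons.1 this).1
  have hperm : ∀ v, v ∈ x :: K ∨ v ∈ F ↔ v ∈ K ∨ v ∈ x :: F := by
    intro v; simp only [List.mem_cons]; tauto
  have hne : ∀ v ∈ F, v ≠ x := fun v hv hvx => hxF (hvx ▸ hv)
  have told : ∀ v ∈ F, Function.update τ x F.length v = τ v := fun v hv =>
    Function.update_of_ne (hne v hv) _ _
  have hstack := (List.pairwise_cons.1 h.stack).1
  constructor
  case fld => intro f h1 h2 h3 h4; rw [hfld f h4, h.fld f h1 h2 h3 h4]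
  case reg => intro r h1 h2 h3 h4 h5; rw [hreg r h1 h2 h4 h5, h.reg r h1 h2 h3 h4 h5]
  case col => intro v hv; rw [hfld _ (by simp), h.col v hv, hperm]
  case nodup => exact (List.perm_middle.nodup_iff).2 h.nodup
  case bound => exact fun v hv => h.bound v ((hperm v).2 hv)
  case linkK => rw [hfld _ (by simp)]; exact hlinkK
  case linkF => exact hlinkF
  case stack => exact (List.pairwise_cons.1 h.stack).2
  case bottom =>
    rcases h.bottom with ⟨l, hl⟩ | ⟨hl, -⟩
    · cases l with
      | nil =>
        simp only [List.nil_append, List.cons.injEq] at hl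
        exact .inr ⟨hl.2, F, by rw [hl.1]⟩
      | cons y l =>
        simp only [List.cons_append, List.cons.injEq] at hl
        exact .inl ⟨l, hl.2⟩
    · simp at hl
  case reach => exact fun v hv => h.reach v ((hperm v).2 hv)
  case sorted =>
    refine List.pairwise_cons.2 ⟨fun v hv => ?_, ?_⟩
    · rw [told v hv, Function.update_self]; exact h.time_lt v hv
    · refine h.sorted.imp_of_mem fun {a b} ha hb hab => ?_
      rwa [told a ha, told b hb]
  case time_lt =>
    intro v hv
    rw [List.length_cons]
    rcases List.mem_cons.1 hv with rfl | hv
    · rw [Function.update_self]; omega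
    · rw [told v hv]; exact (h.time_lt v hv).trans (Nat.lt_succ_self _)
  case ptr_le => rw [hfld _ (by simp)]; exact h.ptr_le
  case ptr_dst => rw [hfld _ (by simp)]; exact h.ptr_dst
  case ptr_old =>
    intro v hv h1 h2
    rw [hfld _ (by simp)]
    have := not_or.2 ⟨h1, h2⟩
    rw [← hperm, not_or] at this
    exact h.ptr_old v hv this.1 this.2
  case ptr_fin =>
    intro v hv
    rw [hfld _ (by simp)]
    rcases List.mem_cons.1 hv with rfl | hv
    · exact h0
    · exact h.ptr_fin v hv
  case scanned =>
    intro e h1 h2 h3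
    rw [hfld _ (by simp)] at h3
    exact (hperm _).1 (h.scanned e h1 h2 h3)
  case back_open =>
    intro e h1 h2 h3 h4 v hv hle
    have hs := hstack _ h4
    rcases List.mem_cons.1 hv with rfl | hv
    · exact hs
    · rcases List.mem_cons.1 h3 with h3 | h3
      · rw [h3, Function.update_self, told v hv] at hle
        exact absurd (h.time_lt v hv) (by omega)
      · rw [told v hv, told _ h3] at hle
        exact h.back_open e h1 h2 h3 (List.mem_cons_of_mem _ h4) v hv hle
  case back =>
    intro e h1 h2 h3 h4 hlt v hv hle hle'
    rcases List.mem_cons.1 h3 with h3 | h3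
    · exfalso
      rw [h3, Function.update_self] at hlt
      rcases List.mem_cons.1 h4 with h4 | h4
      · rw [h4, Function.update_self] at hlt
        exact hlt.false
      · rw [told _ h4] at hlt
        exact absurd (h.time_lt _ h4) (by omega)
    · rw [told _ h3] at hle hlt
      rcases List.mem_cons.1 h4 with h5 | h5
      · rcases List.mem_cons.1 hv with rfl | hv
        · rw [h5]; exact .refl v
        · rw [told v hv] at hle
          exact h.back_open e h1 h2 h3 (h5 ▸ List.mem_cons_self) v hv hle
      · have h6 := h.time_lt _ h5
        rw [told _ h5] at hlt hle'
        rcases List.mem_cons.1 hv with rfl | hv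
        · rw [Function.update_self] at hle'
          omega
        · rw [told v hv] at hle hle'
          exact h.back e h1 h2 h3 h5 hlt v hv hle hle'
  case P_bound => exact h.P_bound
  case P_ptr => rw [hfld _ (by simp)]; exact h.P_ptr
  case ticks =>
    have := h.ticks
    rw [List.length_cons]
    omega

/-- Every round of the depth-first search preserves the invariant. -/
theorem DfsInv.wp_step (hG : GraphRep V Γ ρ) (hV : V < S) (hE : ρ.reg .nE < S) (hS : S ≤ M)
    (h : DfsInv ρ V Γ K F τ P σ) (hne : σ.reg .la ≠ 0) :
    wp M S dfsStep (fun σ' => ∃ K F τ P, DfsInv ρ V Γ K F τ P σ') σ.tick := by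
  obtain ⟨K, rfl, hK⟩ := h.linkK.exists_cons hne
  have hx := h.bound _ (.inl List.mem_cons_self)
  have hM : 1 < M := by omega
  have hnIn := h.fld .nIn (by simp) (by simp) (by simp) (by simp)
  have hsrc := h.fld .src (by simp) (by simp) (by simp) (by simp)
  have he := h.ptr_le _ hx.2
  simp only [dfsStep, wp_seq, wp_assign, wp_store, wp_ite, wp_skip, ok_var, ok_get, ok_lit, ev_var,
    ev_get, ev_lit, true_and, St.set_reg_self, St.set_reg_of_ne, St.put_reg, ne_eq, reduceCtorEq,
    not_false_eq_true, St.put_fld_of_ne, St.set_fld, St.tick_reg, St.tick_fld, hsrc, hnIn]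
  refine ⟨by omega, fun h0 => ?_, fun h0 => ?_⟩
  · have h1 : 1 ≤ σ.fld .hIn (σ.reg .la) := by omega
    have hsV := hG.graph.src_le _ h1 he
    have hs1 := hG.graph.src_pos _ h1 he
    have hc := h.col _ hsV
    refine ⟨by omega, by omega, by omega, by omega, fun h2 => ?_, fun h2 => ⟨by omega, by omega,
      by omega, ?_⟩⟩
    · refine ⟨_, _, _, _, h.scan hG rfl h0 (.inl ⟨rfl, hc.1 h2, by simp⟩) ?_ ?_ ?_ ?_ ?_⟩
      · intro f h1 h2 h3; simp [h2]
      · intro r h1 h2 h3 h4; simp [h1, h2, h3]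
      · simp
      · simpa using h.linkK
      · simp
    · have h3 : ¬ (_ ∨ _) := fun h3 => hc.2 h3 h2
      rw [not_or] at h3
      refine ⟨_, _, _, _, h.scan hG rfl h0 (.inr ⟨rfl, h3.1, h3.2, by simp⟩) ?_ ?_ ?_ ?_ ?_⟩
      · intro f h1 h2 h3; simp [h1, h2, h3]
      · intro r h1 h2 h3 h4; simp [h1, h2, h3, h4]
      · simp
      · simpa using h.linkK.push h3.1 (by omega)
      · simp
  · have hxF : σ.reg .la ∉ F := fun hx => by
      have := h.nodup
      rw [List.nodup_append] at this
      exact this.2.2 _ List.mem_cons_self _ hx rfl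
    refine ⟨by omega, by omega, ?_⟩
    refine ⟨_, _, _, _, h.finish h0 ?_ ?_ ?_ ?_ ?_⟩
    · intro f h1; simp [h1]
    · intro r h1 h2 h3 h4; simp [h1, h2, h3, h4]
    · simpa using hK
    · simpa using h.linkF.push hxF hne
    · simp

/-- The depth-first search is correct, with at most one round for each edge and for each vertex. -/
theorem wp_dfs (hG : GraphRep V Γ ρ) (hV : V < S) (hE : ρ.reg .nE < S) (hS : S ≤ M)
    (ht : 1 ≤ ρ.reg .t) (htV : ρ.reg .t ≤ V) (hcol : ∀ v ≤ V, ρ.fld .col v = 0) :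
    wp M S dfs (fun σ => (∃ F τ, DfsDone σ V Γ F τ) ∧
      (∀ f, f ≠ .col → f ≠ .hIn → f ≠ .lk1 → f ≠ .lk2 → σ.fld f = ρ.fld f) ∧
      (∀ r, r ≠ .e → r ≠ .x → r ≠ .y → r ≠ .la → r ≠ .fin → σ.reg r = ρ.reg r) ∧
      σ.ticks ≤ ρ.ticks + ρ.reg .nE + V) ρ := by
  have hlen : ∀ {K F τ P σ}, DfsInv ρ V Γ K F τ P σ → P.card + F.length ≤ ρ.reg .nE + V := by
    intro K F τ P σ h
    have h1 := card_le_of_bound h.P_bound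
    have h2 := card_le_of_bound (V := V) (U := F.toFinset)
      fun v hv => h.bound v (.inr (List.mem_toFinset.1 hv))
    rw [List.toFinset_card_of_nodup (List.nodup_append.1 h.nodup).2.1] at h2
    omega
  simp only [dfs, wp_seq, wp_assign, wp_store, ok_var, ok_lit, ev_var, ev_lit, true_and, St.put_reg]
  refine ⟨by omega, by omega, by omega, by omega, by omega, ?_⟩
  refine wp_while (fun σ => ∃ K F τ P, DfsInv ρ V Γ K F τ P σ)
    (ρ.ticks + ρ.reg .nE + V) ⟨[ρ.reg .t], [], fun _ => 0, ∅, ?_⟩ ?_ ?_ ?_ ?_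
  · constructor
    case fld => intro f h1 h2 h3 h4; simp [h1, h3]
    case reg => intro r h1 h2 h3 h4 h5; simp [h4, h5]
    case col =>
      intro v hv
      by_cases h : v = ρ.reg .t
      · simp [h]
      · simpa [h] using hcol v hv
    case linkK =>
      simp [Linked]
      omega
    case linkF => simp [Linked]
    case bottom => exact .inl ⟨[], rfl⟩
    case ptr_le => simpa using hG.adjIn.head_le
    case ptr_dst => simpa using hG.adjIn.key_head
    case scanned =>
      intro e h1 h2 h3
      have := hG.adjIn.le_head e h1 h2
      simp only [ne_eq, reduceCtorEq, not_false_eq_true, St.put_fld_of_ne, St.set_fld] at h3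
      omega
    all_goals simp
    · exact ⟨ht, htV⟩
    · exact .refl _
  · rintro σ ⟨K, F, τ, P, h⟩
    have := h.ticks
    have := hlen h
    omega
  · intros; trivial
  · rintro σ ⟨K, F, τ, P, h⟩ hne
    exact h.wp_step hG hV hE hS hne
  · rintro σ ⟨K, F, τ, P, h⟩ h0
    rw [ev_var] at h0
    have hK := h.linkK
    rw [h0] at hK
    obtain rfl := hK.eq_nil
    have hnE := h.reg .nE (by simp) (by simp) (by simp) (by simp) (by simp)
    have hrt := h.reg .t (by simp) (by simp) (by simp) (by simp) (by simp)
    have hf : ∀ f, f ≠ .col → f ≠ .hIn → f ≠ .lk1 → f ≠ .lk2 → σ.fld f = ρ.fld f := h.fld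
    refine ⟨⟨F, τ, ?_⟩, h.fld, h.reg, ?_⟩
    · constructor
      case graph =>
        rw [hnE, hf .src (by simp) (by simp) (by simp) (by simp),
          hf .dst (by simp) (by simp) (by simp) (by simp),
          hf .lab (by simp) (by simp) (by simp) (by simp)]
        exact hG.graph
      case adjOut =>
        rw [hnE, hf .src (by simp) (by simp) (by simp) (by simp),
          hf .hOut (by simp) (by simp) (by simp) (by simp),
          hf .nOut (by simp) (by simp) (by simp) (by simp)]
        exact hG.adjOut
      case col => simpa using h.col
      case bound => exact fun v hv => h.bound v (.inr hv)
      case nodup => simpa using h.nodup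
      case link => exact h.linkF
      case head =>
        rw [hrt]
        rcases h.bottom with ⟨l, hl⟩ | ⟨-, hl⟩
        · simp at hl
        · exact hl
      case reach => rw [hrt]; exact fun v hv => h.reach v (.inr hv)
      case sorted => exact h.sorted
      case closed =>
        rw [hnE, hf .src (by simp) (by simp) (by simp) (by simp),
          hf .dst (by simp) (by simp) (by simp) (by simp)]
        intro e h1 h2 h3
        simpa using h.scanned e h1 h2 (by rw [h.ptr_fin _ h3]; omega)
      case back =>
        rw [hnE, hf .src (by simp) (by simp) (by simp) (by simp),
          hf .dst (by simp) (by simp) (by simp) (by simp)]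
        exact h.back
    · have := h.ticks
      have := hlen h
      omega

end

end QuantMatch

/-! ### Strongly connected components and longest walks -/

namespace QuantMatch

/-- Treats an edge `e` inside the current component `r`, with target `y`: a nonempty label shows
that there are arbitrarily long walks, and `y` joins the component if it has not done so before. -/
def insideStep : Cmd :=
  .ite (.get .lab ◇.e)
    (.store .inf ◇.r (.lit 1))
    .skip ;;
  .ite (.get .comp ◇.y)
    .skip
    (.store .comp ◇.y ◇.r ;; .store .lk1 ◇.y ◇.la ;; .la ≔ ◇.y)

/-- Treats an edge `e` from the current component `r` to a vertex `y` of another component. -/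
def crossStep : Cmd :=
  .ite (.get .inf (.get .comp ◇.y))
    (.store .inf ◇.r (.lit 1))
    .skip ;;
  .v ≔ .get .val (.get .comp ◇.y) + (Ex.lit 0).lt (.get .lab ◇.e) ;;
  .ite ((Ex.get .val ◇.r).lt ◇.v)
    (.store .val ◇.r ◇.v ;; .store .ch ◇.r ◇.e)
    .skip

/-- One round of the search for longest walks. Register `r` is the vertex that names the current
component, `la` the list of the vertices of this component that remain to be expanded, `e` the
next outgoing edge of the vertex expanded last, and `fin` the list of the vertices that may still
be the first one of a new component. -/
def maxStep : Cmd :=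
  .ite ◇.e
    (.y ≔ .get .dst ◇.e ;;
      .ite (.get .col ◇.y)
        (.ite ((Ex.get .comp ◇.y).eq (.lit 0) + (Ex.get .comp ◇.y).eq ◇.r)
          insideStep
          crossStep)
        .skip ;;
      .e ≔ .get .nOut ◇.e)
    (.ite ◇.la
      (.x ≔ ◇.la ;; .la ≔ .get .lk1 ◇.x ;; .e ≔ .get .hOut ◇.x)
      (.x ≔ ◇.fin ;;
        .fin ≔ .get .lk2 ◇.x ;;
        .ite (.get .comp ◇.x)
          .skip
          (.store .comp ◇.x ◇.x ;; .r ≔ ◇.x ;; .store .lk1 ◇.x ◇.la ;; .la ≔ ◇.x)))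

/-- Determines strongly connected components, in reverse topological order, and longest walks
to `t`. -/
def maxSearch : Cmd :=
  dfs ;;
  .store .comp ◇.t ◇.t ;;
  .store .val ◇.t (.lit 1) ;;
  .r ≔ ◇.t ;;
  .store .lk1 ◇.t (.lit 0) ;;
  .la ≔ ◇.t ;;
  .e ≔ .lit 0 ;;
  .while (◇.e + ◇.la + ◇.fin) maxStep

/-- What is known about an edge `e` after it has been looked at: it lies inside a component, and
has an empty label unless the component is marked as the start of arbitrarily long walks, or it
leads to a component that was completed before and is accounted for in the value of the component
where it starts. -/
def Settled (ρ : St) (c val inf : ℕ → ℕ) (r e : ℕ) : Prop :=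
  c (ρ.fld .dst e) ≠ 0 ∧
    (c (ρ.fld .dst e) = c (ρ.fld .src e) ∧ (ρ.fld .lab e = 0 ∨ inf (c (ρ.fld .src e)) ≠ 0) ∨
    c (ρ.fld .dst e) ≠ c (ρ.fld .src e) ∧ c (ρ.fld .dst e) ≠ r ∧
      (inf (c (ρ.fld .dst e)) ≠ 0 → inf (c (ρ.fld .src e)) ≠ 0) ∧
      val (c (ρ.fld .dst e)) + (lb (ρ.fld .lab e)).length ≤ val (c (ρ.fld .src e)))

/-- The invariant of the search for longest walks. The component of a vertex `v` is named by the
vertex `c v`, and `c v = 0` as long as `v` does not belong to a component. For a vertex `z` that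
names a component, `inf z` tells whether there are arbitrarily long walks from `z` to `t`, `val z`
is the number of letters, plus one, of the longest walk found so far, and `str z` is its label.
The remaining parameters are the current edge `e`, the current component `r`, the list `L` of its
vertices that remain to be expanded, the rest `T` of the list `F` of the depth-first search, and
the set `P` of edges looked at. -/
structure SccInv (ρ : St) (V : ℕ) (Γ : Set (ℕ × ℕ × ℕ)) (F : List ℕ) (τ : ℕ → ℕ)
    (c val inf ch : ℕ → ℕ) (e r : ℕ) (L T : List ℕ) (P : Finset ℕ) (str : ℕ → List ℕ)
    (rk : ℕ → ℕ) : Prop where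
  comp_out : ∀ v ≤ V, v ∉ F → c v = 0
  comp_mem : ∀ v ∈ F, c v ≠ 0 → c v ∈ F ∧ c (c v) = c v
  fresh : ∀ v ∈ F, c v ≠ v → inf v = 0 ∧ val v = 0 ∧ ch v = 0
  fwd : ∀ v ∈ F, c v ≠ 0 → Reach Γ (c v) v
  bwd : ∀ v ∈ F, c v ≠ 0 → Reach Γ v (c v)
  zero : ∀ v ∈ F, c v ≠ 0 → inf (c v) = 0 → Walk Γ (c v) [] v
  suffix : T <:+ F
  rest : ∀ v ∈ F, c v = 0 → v ∈ T
  root : r ∈ F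
  root_comp : c r = r
  dom : ∀ v ∈ F, c v = r → τ v ≤ τ r ∧ ∀ x ∈ F, τ v ≤ τ x → τ x ≤ τ r → Reach Γ x r
  late : ∀ v ∈ T, τ v ≤ τ r
  active : ∀ v ∈ L, v ∈ F ∧ c v = r
  nodup : L.Nodup
  e_le : e ≤ ρ.reg .nE
  cur : e ≠ 0 → ρ.fld .src e ∈ F ∧ c (ρ.fld .src e) = r ∧ ρ.fld .src e ∉ L ∧
    ∀ e' ≤ e, ρ.fld .src e' = ρ.fld .src e → e' ∉ P
  P_bound : ∀ e' ∈ P, 1 ≤ e' ∧ e' ≤ ρ.reg .nE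
  P_src : ∀ e' ∈ P, ρ.fld .src e' ∈ F ∧ c (ρ.fld .src e') ≠ 0 ∧ ρ.fld .src e' ∉ L
  complete : ∀ e', 1 ≤ e' → e' ≤ ρ.reg .nE → ρ.fld .src e' ∈ F → c (ρ.fld .src e') ≠ 0 →
    ρ.fld .src e' ∉ L → e' ∈ P ∨ (e ≠ 0 ∧ ρ.fld .src e' = ρ.fld .src e ∧ e' ≤ e)
  settled : ∀ e' ∈ P, ρ.fld .dst e' ∈ F → Settled ρ c val inf r e'
  long : ∀ z ∈ F, c z = z → inf z ≠ 0 → ∀ k : ℕ, ∃ u, Walk Γ z u (ρ.reg .t) ∧ k ≤ u.length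
  t_comp : c (ρ.reg .t) = ρ.reg .t
  t_val : 1 ≤ val (ρ.reg .t)
  val_le : ∀ z ∈ F, c z = z → val z ≤ rk z + 1
  choice : ∀ z ∈ F, c z = z → ch z ≠ 0 → ch z ≤ ρ.reg .nE ∧ ρ.fld .src (ch z) ∈ F ∧
    c (ρ.fld .src (ch z)) = z ∧ ρ.fld .dst (ch z) ∈ F ∧ c (ρ.fld .dst (ch z)) ≠ 0 ∧
    c (ρ.fld .dst (ch z)) ≠ z ∧ c (ρ.fld .dst (ch z)) ≠ r ∧
    val z = val (c (ρ.fld .dst (ch z))) + (lb (ρ.fld .lab (ch z))).length ∧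
    str z = lb (ρ.fld .lab (ch z)) ++ str (c (ρ.fld .dst (ch z))) ∧
    rk (c (ρ.fld .dst (ch z))) < rk z
  finish : ∀ z ∈ F, c z = z → ch z = 0 → str z = [] ∧ val z = if z = ρ.reg .t then 1 else 0
  rk_lt : ∀ z ∈ F, c z = z → z ≠ r → rk z < rk r
  rk_le : ∀ z ∈ F, c z = z → rk z + T.length ≤ F.length

section

variable {V : ℕ} {Γ : Set (ℕ × ℕ × ℕ)} {ρ : St} {F : List ℕ} {τ : ℕ → ℕ}
  {c val inf ch : ℕ → ℕ} {e r : ℕ} {L T : List ℕ} {P : Finset ℕ} {str : ℕ → List ℕ} {rk : ℕ → ℕ}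

theorem DfsDone.t_mem (hD : DfsDone ρ V Γ F τ) : ρ.reg .t ∈ F := by
  obtain ⟨l, rfl⟩ := hD.head
  exact List.mem_cons_self

theorem DfsDone.time_le (hD : DfsDone ρ V Γ F τ) : ∀ v ∈ F, τ v ≤ τ (ρ.reg .t) := by
  obtain ⟨l, hl⟩ := hD.head
  have hs := hD.sorted
  rw [hl] at hs ⊢
  intro v hv
  rcases List.mem_cons.1 hv with rfl | hv
  · exact le_rfl
  · exact ((List.pairwise_cons.1 hs).1 v hv).le

theorem DfsDone.time_inj (hD : DfsDone ρ V Γ F τ) {v w : ℕ} (hv : v ∈ F) (hw : w ∈ F)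
    (h : τ v = τ w) : v = w := by
  by_contra hne
  have hp : F.Pairwise (fun a b => τ a ≠ τ b) := hD.sorted.imp fun hab => hab.ne'
  have : Std.Symm fun a b => τ a ≠ τ b := ⟨fun _ _ h => h.symm⟩
  exact hp.forall hv hw hne h

/-- Moving on to the next outgoing edge. -/
theorem SccInv.next (hD : DfsDone ρ V Γ F τ)
    (h : SccInv ρ V Γ F τ c val inf ch e r L T P str rk) (he : e ≠ 0)
    (hs : ρ.fld .dst e ∈ F → Settled ρ c val inf r e) :
    e ∉ P ∧ SccInv ρ V Γ F τ c val inf ch (ρ.fld .nOut e) r L T (insert e P) str rk := by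
  obtain ⟨h1, h2, h3, h4⟩ := h.cur he
  have hpos : 1 ≤ e := Nat.one_le_iff_ne_zero.2 he
  have hlt := hD.adjOut.next_lt e hpos h.e_le
  refine ⟨h4 e le_rfl rfl, { h with
    e_le := ?_, cur := ?_, P_bound := ?_, P_src := ?_, complete := ?_, settled := ?_ }⟩
  · exact hlt.le.trans h.e_le
  · intro hz
    have hk := hD.adjOut.key_next e hpos h.e_le hz
    rw [hk]
    refine ⟨h1, h2, h3, fun e' h5 h6 hm => ?_⟩
    rcases Finset.mem_insert.1 hm with rfl | hm
    · omega
    · exact h4 e' (by omega) h6 hm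
  · intro e' hm
    rcases Finset.mem_insert.1 hm with rfl | hm
    · exact ⟨hpos, h.e_le⟩
    · exact h.P_bound e' hm
  · intro e' hm
    rcases Finset.mem_insert.1 hm with rfl | hm
    · exact ⟨h1, by have := (hD.bound r h.root).1; omega, h3⟩
    · exact h.P_src e' hm
  · intro e' h5 h6 h7 h8 h9
    rcases h.complete e' h5 h6 h7 h8 h9 with h10 | ⟨-, h11, h12⟩
    · exact .inl (Finset.mem_insert_of_mem h10)
    · rcases h12.lt_or_eq with h12 | rfl
      · have hle := hD.adjOut.le_next e hpos h.e_le e' h5 h12 h11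
        have hz : ρ.fld .nOut e ≠ 0 := by omega
        exact .inr ⟨hz, by rw [h11, hD.adjOut.key_next e hpos h.e_le hz], hle⟩
      · exact .inl (Finset.mem_insert_self _ _)
  · intro e' hm
    rcases Finset.mem_insert.1 hm with rfl | hm
    · exact hs
    · exact h.settled e' hm

/-- Marking the current component as the start of arbitrarily long walks. -/
theorem SccInv.mark (h : SccInv ρ V Γ F τ c val inf ch e r L T P str rk)
    (hlong : ∀ k : ℕ, ∃ u, Walk Γ r u (ρ.reg .t) ∧ k ≤ u.length) :
    SccInv ρ V Γ F τ c val (Function.update inf r 1) ch e r L T P str rk := by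
  have hmono : ∀ z, inf z ≠ 0 → Function.update inf r 1 z ≠ 0 := fun z hz => by
    by_cases hzr : z = r
    · simp [hzr]
    · rwa [Function.update_of_ne hzr]
  refine { h with fresh := ?_, zero := ?_, settled := ?_, long := ?_ }
  · intro v hv hc
    rw [Function.update_of_ne (fun hvr => hc (by rw [hvr, h.root_comp]))]
    exact h.fresh v hv hc
  · intro v hv hc hi
    refine h.zero v hv hc ?_
    by_contra hne
    exact hmono _ hne hi
  · intro e' hm hd
    obtain ⟨h1, h2⟩ := h.settled e' hm hd
    refine ⟨h1, h2.imp (fun h3 => ⟨h3.1, h3.2.imp_right (hmono _)⟩) fun h3 => ?_⟩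
    refine ⟨h3.1, h3.2.1, fun h4 => ?_, h3.2.2.2⟩
    rw [Function.update_of_ne h3.2.1] at h4
    exact hmono _ (h3.2.2.1 h4)
  · intro z hz hc hi
    by_cases hzr : z = r
    · rw [hzr]; exact hlong
    · rw [Function.update_of_ne hzr] at hi
      exact h.long z hz hc hi

/-- If an edge leads from the current component to a vertex that does not yet belong to a
component, then the current component can be reached from this vertex. This is the reason why
the search in the order of `F` finds strongly connected components. -/
theorem SccInv.dom_step (hD : DfsDone ρ V Γ F τ)
    (h : SccInv ρ V Γ F τ c val inf ch e r L T P str rk) (he : e ≠ 0)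
    (hy : ρ.fld .dst e ∈ F) (hc : c (ρ.fld .dst e) = 0) :
    τ (ρ.fld .dst e) ≤ τ r ∧
      ∀ x ∈ F, τ (ρ.fld .dst e) ≤ τ x → τ x ≤ τ r → Reach Γ x r := by
  obtain ⟨h1, h2, h3, h4⟩ := h.cur he
  have hpos : 1 ≤ e := Nat.one_le_iff_ne_zero.2 he
  obtain ⟨h5, h6⟩ := h.dom _ h1 h2
  refine ⟨h.late _ (h.rest _ hy hc), fun x hx hle hle' => ?_⟩
  -- If `x` is finished before the source of `e`, then `e` leads back in time, and
  -- `DfsDone.back` applies.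
  rcases le_total (τ (ρ.fld .src e)) (τ x) with h7 | h7
  · exact h6 x hx h7 hle'
  · rcases lt_or_ge (τ (ρ.fld .dst e)) (τ (ρ.fld .src e)) with h8 | h8
    · exact (hD.back e hpos h.e_le hy h1 h8 x hx hle h7).trans (h6 _ h1 le_rfl h5)
    · exact h6 x hx (by omega) hle'

/-- Adding the target of the current edge to the current component. -/
theorem SccInv.join (hD : DfsDone ρ V Γ F τ)
    (h : SccInv ρ V Γ F τ c val inf ch e r L T P str rk) (he : e ≠ 0)
    (hy : ρ.fld .dst e ∈ F) (hc : c (ρ.fld .dst e) = 0) (hl : ρ.fld .lab e = 0 ∨ inf r ≠ 0) :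
    SccInv ρ V Γ F τ (Function.update c (ρ.fld .dst e) r) val inf ch e r (ρ.fld .dst e :: L) T P
      str rk := by
  obtain ⟨h1, h2, h3, h4⟩ := h.cur he
  have hpos : 1 ≤ e := Nat.one_le_iff_ne_zero.2 he
  have hr := (hD.bound r h.root).1
  have hdom := h.dom_step hD he hy hc
  have hedge := hD.graph.mem e hpos h.e_le
  set y := ρ.fld .dst e with hy'
  have hy1 := (hD.bound y hy).1
  have hne : ∀ v, c v ≠ 0 → v ≠ y := fun v hv hvy => hv (hvy ▸ hc)
  have hold : ∀ v, c v ≠ 0 → Function.update c y r v = c v := fun v hv =>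
    Function.update_of_ne (hne v hv) _ _
  have hry : r ≠ y := hne r (by rw [h.root_comp]; omega)
  -- `y` does not name a component, before or after this step
  have hroot' : ∀ z, Function.update c y r z = z → c z = z := fun z hz => by
    by_cases hzy : z = y
    · rw [hzy, Function.update_self] at hz
      exact absurd hz hry
    · rwa [Function.update_of_ne hzy] at hz
  refine { h with
    comp_out := ?_, comp_mem := ?_, fresh := ?_, fwd := ?_, bwd := ?_, zero := ?_, rest := ?_
    root_comp := ?_, dom := ?_, active := ?_, nodup := ?_, cur := ?_, P_src := ?_, complete := ?_
    settled := ?_, long := ?_, t_comp := ?_, val_le := ?_, choice := ?_, finish := ?_, rk_lt := ?_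
    rk_le := ?_ }
  · intro v hv hvF
    rw [Function.update_of_ne (fun hvy => hvF (by rwa [hvy]))]
    exact h.comp_out v hv hvF
  · intro v hv
    by_cases hvy : v = y
    · subst hvy
      rw [Function.update_self, Function.update_of_ne hry]
      exact fun _ => ⟨h.root, h.root_comp⟩
    · rw [Function.update_of_ne hvy]
      intro hcv
      obtain ⟨h5, h6⟩ := h.comp_mem v hv hcv
      rw [hold _ (by rwa [h6])]
      exact ⟨h5, h6⟩
  · intro v hv hcv
    refine h.fresh v hv fun h5 => hcv ?_
    rw [hold v (by have := (hD.bound v hv).1; omega), h5]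
  · intro v hv
    by_cases hvy : v = y
    · subst hvy
      rw [Function.update_self]
      have h5 := h.fwd _ h1 (by omega)
      rw [h2] at h5
      exact fun _ => h5.trans ⟨_, .single hedge⟩
    · rw [Function.update_of_ne hvy]
      exact h.fwd v hv
  · intro v hv
    by_cases hvy : v = y
    · subst hvy
      rw [Function.update_self]
      exact fun _ => hdom.2 _ hy le_rfl hdom.1
    · rw [Function.update_of_ne hvy]
      exact h.bwd v hv
  · intro v hv
    by_cases hvy : v = y
    · subst hvy
      rw [Function.update_self]
      intro _ hi
      have h5 := h.zero _ h1 (by omega)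
      rw [h2] at h5
      have h6 := (h5 hi).trans (.single hedge)
      rwa [hl.resolve_right (fun h => h hi), lb_zero, List.append_nil] at h6
    · rw [Function.update_of_ne hvy]
      exact h.zero v hv
  · intro v hv hcv
    by_cases hvy : v = y
    · rw [hvy, Function.update_self] at hcv
      omega
    · rw [Function.update_of_ne hvy] at hcv
      exact h.rest v hv hcv
  · rw [Function.update_of_ne hry, h.root_comp]
  · intro v hv hcv
    by_cases hvy : v = y
    · rw [hvy]; exact hdom
    · rw [Function.update_of_ne hvy] at hcv
      exact h.dom v hv hcv
  · intro v hv
    rcases List.mem_cons.1 hv with rfl | hv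
    · exact ⟨hy, Function.update_self ..⟩
    · obtain ⟨h5, h6⟩ := h.active v hv
      exact ⟨h5, by rw [hold v (by omega), h6]⟩
  · exact List.nodup_cons.2 ⟨fun hm => hne y (by have := (h.active y hm).2; omega) rfl, h.nodup⟩
  · intro _
    have h5 : c (ρ.fld .src e) ≠ 0 := by omega
    rw [hold _ h5]
    refine ⟨h1, h2, ?_, h4⟩
    rw [List.mem_cons, not_or]
    exact ⟨hne _ h5, h3⟩
  · intro e' hm
    obtain ⟨h5, h6, h7⟩ := h.P_src e' hm
    rw [hold _ h6, List.mem_cons, not_or]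
    exact ⟨h5, h6, hne _ h6, h7⟩
  · intro e' h5 h6 h7 h8 h9
    rw [List.mem_cons, not_or] at h9
    rw [Function.update_of_ne h9.1] at h8
    exact h.complete e' h5 h6 h7 h8 h9.2
  · intro e' hm hd
    have h5 := h.settled e' hm hd
    rw [Settled, hold _ (h.P_src e' hm).2.1, hold _ h5.1]
    exact h5
  · exact fun z hz hcz => h.long z hz (hroot' z hcz)
  · have := (hD.bound _ hD.t_mem).1
    rw [hold _ (by rw [h.t_comp]; omega), h.t_comp]
  · exact fun z hz hcz => h.val_le z hz (hroot' z hcz)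
  · intro z hz hcz hch
    have h5 := h.choice z hz (hroot' z hcz) hch
    have h6 := (hD.bound z hz).1
    have h7 : c (ρ.fld .src (ch z)) ≠ 0 := by rw [h5.2.2.1]; omega
    rw [hold _ h7, hold _ h5.2.2.2.2.1]
    exact h5
  · exact fun z hz hcz => h.finish z hz (hroot' z hcz)
  · exact fun z hz hcz => h.rk_lt z hz (hroot' z hcz)
  · exact fun z hz hcz => h.rk_le z hz (hroot' z hcz)

/-- Recording a longer walk, which leaves the current component by the current edge. -/
theorem SccInv.improve (h : SccInv ρ V Γ F τ c val inf ch e r L T P str rk) (he : e ≠ 0)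
    (hy : ρ.fld .dst e ∈ F) (hc : c (ρ.fld .dst e) ≠ 0) (hcr : c (ρ.fld .dst e) ≠ r)
    (hlt : val r < val (c (ρ.fld .dst e)) + (lb (ρ.fld .lab e)).length) :
    SccInv ρ V Γ F τ c
      (Function.update val r (val (c (ρ.fld .dst e)) + (lb (ρ.fld .lab e)).length)) inf
      (Function.update ch r e) e r L T P
      (Function.update str r (lb (ρ.fld .lab e) ++ str (c (ρ.fld .dst e)))) rk := by
  obtain ⟨h1, h2, h3, h4⟩ := h.cur he
  obtain ⟨h5, h6⟩ := h.comp_mem _ hy hc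
  have hrk := h.rk_lt _ h5 h6 hcr
  have hlen : (lb (ρ.fld .lab e)).length ≤ 1 := by
    rw [lb]; split_ifs <;> simp
  refine { h with
    fresh := ?_, settled := ?_, t_val := ?_, val_le := ?_, choice := ?_, finish := ?_ }
  · intro v hv hcv
    have : v ≠ r := fun hvr => hcv (by rw [hvr, h.root_comp])
    rw [Function.update_of_ne this, Function.update_of_ne this]
    exact h.fresh v hv hcv
  · intro e' hm hd
    obtain ⟨h7, h8⟩ := h.settled e' hm hd
    refine ⟨h7, h8.imp_right fun h9 => ⟨h9.1, h9.2.1, h9.2.2.1, ?_⟩⟩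
    rw [Function.update_of_ne h9.2.1]
    by_cases hz : c (ρ.fld .src e') = r
    · have := h9.2.2.2
      rw [hz] at this
      rw [hz, Function.update_self]
      omega
    · rw [Function.update_of_ne hz]
      exact h9.2.2.2
  · by_cases hz : ρ.reg .t = r
    · have := h.t_val
      rw [hz] at this
      rw [hz, Function.update_self]
      omega
    · rw [Function.update_of_ne hz]
      exact h.t_val
  · intro z hz hcz
    by_cases hzr : z = r
    · have := h.val_le _ h5 h6
      rw [hzr, Function.update_self]
      omega
    · rw [Function.update_of_ne hzr]
      exact h.val_le z hz hcz
  · intro z hz hcz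
    by_cases hzr : z = r
    · subst hzr
      intro _
      simp only [Function.update_self]
      rw [Function.update_of_ne hcr, Function.update_of_ne hcr]
      exact ⟨h.e_le, h1, h2, hy, hc, hcr, hcr, rfl, rfl, hrk⟩
    · rw [Function.update_of_ne hzr, Function.update_of_ne hzr, Function.update_of_ne hzr]
      intro hch
      have h7 := h.choice z hz hcz hch
      have h8 := h7.2.2.2.2.2.2.1
      rw [Function.update_of_ne h8, Function.update_of_ne h8]
      exact h7
  · intro z hz hcz
    by_cases hzr : z = r
    · subst hzr
      rw [Function.update_self]
      exact fun h0 => absurd h0 he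
    · rw [Function.update_of_ne hzr, Function.update_of_ne hzr, Function.update_of_ne hzr]
      exact h.finish z hz hcz

/-- Turning to the outgoing edges of a vertex `x` of the current component. -/
theorem SccInv.expand {x : ℕ} (hD : DfsDone ρ V Γ F τ)
    (h : SccInv ρ V Γ F τ c val inf ch 0 r (x :: L) T P str rk) :
    SccInv ρ V Γ F τ c val inf ch (ρ.fld .hOut x) r L T P str rk := by
  obtain ⟨h1, h2⟩ := h.active x List.mem_cons_self
  have hxL := (List.nodup_cons.1 h.nodup)
  have hxV := (hD.bound x h1).2
  refine { h with
    active := ?_, nodup := hxL.2, e_le := hD.adjOut.head_le x hxV, cur := ?_, P_src := ?_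
    complete := ?_ }
  · exact fun v hv => h.active v (List.mem_cons_of_mem _ hv)
  · intro hz
    rw [hD.adjOut.key_head x hxV hz]
    refine ⟨h1, h2, hxL.1, fun e' _ h3 hm => ?_⟩
    exact (h.P_src e' hm).2.2 (h3 ▸ List.mem_cons_self)
  · intro e' hm
    obtain ⟨h3, h4, h5⟩ := h.P_src e' hm
    exact ⟨h3, h4, fun hm => h5 (List.mem_cons_of_mem _ hm)⟩
  · intro e' h3 h4 h5 h6 h7
    by_cases hs : ρ.fld .src e' = x
    · have hle := hD.adjOut.le_head e' h3 h4
      rw [hs] at hle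
      have hz : ρ.fld .hOut x ≠ 0 := by omega
      exact .inr ⟨hz, by rw [hs, hD.adjOut.key_head x hxV hz], hle⟩
    · rcases h.complete e' h3 h4 h5 h6 (by rw [List.mem_cons, not_or]; exact ⟨hs, h7⟩) with
        h8 | h8
      · exact .inl h8
      · exact absurd rfl h8.1

/-- Dropping a vertex that belongs to a component already. -/
theorem SccInv.skip {x : ℕ} (h : SccInv ρ V Γ F τ c val inf ch 0 r [] (x :: T) P str rk)
    (hc : c x ≠ 0) : SccInv ρ V Γ F τ c val inf ch 0 r [] T P str rk := by
  refine { h with suffix := ?_, rest := ?_, late := ?_, rk_le := ?_ }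
  · exact (List.suffix_cons x T).trans h.suffix
  · intro v hv hcv
    rcases List.mem_cons.1 (h.rest v hv hcv) with rfl | h1
    · exact absurd hcv hc
    · exact h1
  · exact fun v hv => h.late v (List.mem_cons_of_mem _ hv)
  · intro z hz hcz
    have := h.rk_le z hz hcz
    rw [List.length_cons] at this
    omega

/-- Starting a new component. -/
theorem SccInv.start {x : ℕ} (hD : DfsDone ρ V Γ F τ)
    (h : SccInv ρ V Γ F τ c val inf ch 0 r [] (x :: T) P str rk) (hc : c x = 0) :
    SccInv ρ V Γ F τ (Function.update c x x) val inf ch 0 x [x] T P (Function.update str x [])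
      (Function.update rk x (F.length - T.length)) := by
  have hxF : x ∈ F := h.suffix.subset List.mem_cons_self
  have hx1 := (hD.bound x hxF).1
  have hne : ∀ v, c v ≠ 0 → v ≠ x := fun v hv hvx => hv (hvx ▸ hc)
  have hold : ∀ v, c v ≠ 0 → Function.update c x x v = c v := fun v hv =>
    Function.update_of_ne (hne v hv) _ _
  -- no component is named `x` so far
  have hnx : ∀ v ∈ F, c v ≠ x := fun v hv hcv => by
    have := (h.comp_mem v hv (by omega)).2
    rw [hcv, hc] at this
    omega
  have hTF : T.length ≤ F.length := by
    have := h.suffix.length_le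
    rw [List.length_cons] at this
    omega
  have hfr := h.fresh x hxF (by omega)
  have hxt : x ≠ ρ.reg .t := fun hxt => by
    have := h.t_comp
    rw [← hxt, hc] at this
    omega
  refine {
    comp_out := ?_, comp_mem := ?_, fresh := ?_, fwd := ?_, bwd := ?_, zero := ?_, suffix := ?_
    rest := ?_, root := hxF, root_comp := Function.update_self .., dom := ?_, late := ?_
    active := ?_, nodup := List.nodup_singleton x, e_le := h.e_le
    cur := fun h0 => absurd rfl h0, P_bound := h.P_bound, P_src := ?_, complete := ?_
    settled := ?_, long := ?_, t_comp := ?_, t_val := h.t_val, val_le := ?_, choice := ?_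
    finish := ?_, rk_lt := ?_, rk_le := ?_ }
  · intro v hv hvF
    rw [Function.update_of_ne (fun hvx => hvF (by rwa [hvx]))]
    exact h.comp_out v hv hvF
  · intro v hv
    by_cases hvx : v = x
    · subst hvx
      simp only [Function.update_self]
      exact fun _ => ⟨hxF, trivial⟩
    · rw [Function.update_of_ne hvx]
      intro hcv
      obtain ⟨h5, h6⟩ := h.comp_mem v hv hcv
      rw [hold _ (by rwa [h6])]
      exact ⟨h5, h6⟩
  · intro v hv hcv
    refine h.fresh v hv fun h5 => hcv ?_
    rw [hold v (by have := (hD.bound v hv).1; omega), h5]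
  · intro v hv
    by_cases hvx : v = x
    · subst hvx
      rw [Function.update_self]
      exact fun _ => .refl v
    · rw [Function.update_of_ne hvx]
      exact h.fwd v hv
  · intro v hv
    by_cases hvx : v = x
    · subst hvx
      rw [Function.update_self]
      exact fun _ => .refl v
    · rw [Function.update_of_ne hvx]
      exact h.bwd v hv
  · intro v hv
    by_cases hvx : v = x
    · subst hvx
      rw [Function.update_self]
      exact fun _ _ => .nil v
    · rw [Function.update_of_ne hvx]
      exact h.zero v hv
  · exact (List.suffix_cons x T).trans h.suffix
  · intro v hv hcv
    by_cases hvx : v = x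
    · rw [hvx, Function.update_self] at hcv
      omega
    · rw [Function.update_of_ne hvx] at hcv
      exact (List.mem_cons.1 (h.rest v hv hcv)).resolve_left hvx
  · intro v hv hcv
    by_cases hvx : v = x
    · subst hvx
      exact ⟨le_rfl, fun w hw h1 h2 => by
        rw [hD.time_inj hw hv (le_antisymm h2 h1)]; exact .refl v⟩
    · rw [Function.update_of_ne hvx] at hcv
      exact absurd hcv (hnx v hv)
  · intro v hv
    have := hD.sorted.sublist h.suffix.sublist
    exact ((List.pairwise_cons.1 this).1 v hv).le
  · intro v hv
    rw [List.mem_singleton.1 hv]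
    exact ⟨hxF, Function.update_self ..⟩
  · intro e' hm
    obtain ⟨h5, h6, h7⟩ := h.P_src e' hm
    rw [hold _ h6, List.mem_singleton]
    exact ⟨h5, h6, hne _ h6⟩
  · intro e' h5 h6 h7 h8 h9
    rw [List.mem_singleton] at h9
    rw [Function.update_of_ne h9] at h8
    rcases h.complete e' h5 h6 h7 h8 List.not_mem_nil with h10 | h10
    · exact .inl h10
    · exact absurd rfl h10.1
  · intro e' hm hd
    obtain ⟨h5, h6⟩ := h.settled e' hm hd
    rw [Settled, hold _ (h.P_src e' hm).2.1, hold _ h5]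
    exact ⟨h5, h6.imp_right fun h7 => ⟨h7.1, hnx _ hd, h7.2.2⟩⟩
  · intro z hz hcz hi
    by_cases hzx : z = x
    · rw [hzx, hfr.1] at hi
      exact absurd rfl hi
    · rw [Function.update_of_ne hzx] at hcz
      exact h.long z hz hcz hi
  · rw [Function.update_of_ne hxt.symm, h.t_comp]
  · intro z hz hcz
    by_cases hzx : z = x
    · rw [hzx, hfr.2.1]
      omega
    · rw [Function.update_of_ne hzx] at hcz ⊢
      exact h.val_le z hz hcz
  · intro z hz hcz hch
    by_cases hzx : z = x
    · rw [hzx, hfr.2.2] at hch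
      exact absurd rfl hch
    · rw [Function.update_of_ne hzx] at hcz
      have h5 := h.choice z hz hcz hch
      have h6 := (hD.bound z hz).1
      have h7 : c (ρ.fld .src (ch z)) ≠ 0 := by rw [h5.2.2.1]; omega
      have h8 := hnx _ h5.2.2.2.1
      rw [hold _ h7, hold _ h5.2.2.2.2.1, Function.update_of_ne hzx, Function.update_of_ne hzx,
        Function.update_of_ne h8, Function.update_of_ne h8]
      exact ⟨h5.1, h5.2.1, h5.2.2.1, h5.2.2.2.1, h5.2.2.2.2.1, h5.2.2.2.2.2.1, h8,
        h5.2.2.2.2.2.2.2⟩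
  · intro z hz hcz hch
    by_cases hzx : z = x
    · subst hzx
      rw [Function.update_self, if_neg hxt]
      exact ⟨rfl, hfr.2.1⟩
    · rw [Function.update_of_ne hzx] at hcz ⊢
      exact h.finish z hz hcz hch
  · intro z hz hcz hzx
    rw [Function.update_of_ne hzx] at hcz
    rw [Function.update_of_ne hzx, Function.update_self]
    have := h.rk_le z hz hcz
    rw [List.length_cons] at this
    omega
  · intro z hz hcz
    by_cases hzx : z = x
    · rw [hzx, Function.update_self]
      omega
    · rw [Function.update_of_ne hzx] at hcz ⊢
      have := h.rk_le z hz hcz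
      rw [List.length_cons] at this
      omega

/-- An edge with a nonempty label inside the current component gives rise to arbitrarily long
walks. -/
theorem SccInv.long_of_edge (hD : DfsDone ρ V Γ F τ)
    (h : SccInv ρ V Γ F τ c val inf ch e r L T P str rk) (he : e ≠ 0)
    (hy : ρ.fld .dst e ∈ F) (hc : c (ρ.fld .dst e) = 0 ∨ c (ρ.fld .dst e) = r)
    (hl : ρ.fld .lab e ≠ 0) (k : ℕ) : ∃ u, Walk Γ r u (ρ.reg .t) ∧ k ≤ u.length := by
  obtain ⟨h1, h2, h3, h4⟩ := h.cur he
  have hpos : 1 ≤ e := Nat.one_le_iff_ne_zero.2 he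
  have hr := (hD.bound r h.root).1
  obtain ⟨u₁, w₁⟩ := h.fwd _ h1 (by omega)
  rw [h2] at w₁
  have hback : Reach Γ (ρ.fld .dst e) r := by
    rcases hc with hc | hc
    · have := h.dom_step hD he hy hc
      exact this.2 _ hy le_rfl this.1
    · have := h.bwd _ hy (by omega)
      rwa [hc] at this
  obtain ⟨u₂, w₂⟩ := hback
  -- a cycle through `r` with a nonempty string, to be repeated
  have hcyc := w₁.trans (.cons (hD.graph.mem e hpos h.e_le) w₂)
  rw [lb_of_ne hl] at hcyc
  induction k with
  | zero =>
    obtain ⟨u, hu⟩ := hD.reach r h.root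
    exact ⟨u, hu, Nat.zero_le _⟩
  | succ k ih =>
    obtain ⟨u, hu, hk⟩ := ih
    refine ⟨_, hcyc.trans hu, ?_⟩
    simp only [List.length_append, List.length_cons, List.length_nil]
    omega

/-- A cross edge to a component with arbitrarily long walks. -/
theorem SccInv.long_of_comp (hD : DfsDone ρ V Γ F τ)
    (h : SccInv ρ V Γ F τ c val inf ch e r L T P str rk) (he : e ≠ 0)
    (hy : ρ.fld .dst e ∈ F) (hc : c (ρ.fld .dst e) ≠ 0) (hi : inf (c (ρ.fld .dst e)) ≠ 0)
    (k : ℕ) : ∃ u, Walk Γ r u (ρ.reg .t) ∧ k ≤ u.length := by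
  obtain ⟨h1, h2, h3, h4⟩ := h.cur he
  have hpos : 1 ≤ e := Nat.one_le_iff_ne_zero.2 he
  have hr := (hD.bound r h.root).1
  obtain ⟨u₁, w₁⟩ := h.fwd _ h1 (by omega)
  rw [h2] at w₁
  obtain ⟨u₂, w₂⟩ := h.bwd _ hy hc
  obtain ⟨h5, h6⟩ := h.comp_mem _ hy hc
  obtain ⟨u, hu, hk⟩ := h.long _ h5 h6 hi k
  refine ⟨_, (w₁.trans (.cons (hD.graph.mem e hpos h.e_le) w₂)).trans hu, ?_⟩
  simp only [List.length_append]
  omega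

end

/-- The state `σ` of the search for longest walks represents the data of `SccInv`; `U` contains
vertices that belong to a component. A round may be counted in `ticks` before the edge or vertex
that pays for it has been added to `P` or `U`; `δ` is the number of such rounds. -/
structure SccRep (ρ : St) (V : ℕ) (Γ : Set (ℕ × ℕ × ℕ)) (F : List ℕ) (τ : ℕ → ℕ) (δ : ℕ)
    (L T : List ℕ) (P U : Finset ℕ) (str : ℕ → List ℕ) (rk : ℕ → ℕ) (σ : St) : Prop where
  fld : ∀ f, f ≠ .comp → f ≠ .val → f ≠ .inf → f ≠ .ch → f ≠ .lk1 → σ.fld f = ρ.fld f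
  reg : ∀ r, r ≠ .e → r ≠ .x → r ≠ .y → r ≠ .v → r ≠ .r → r ≠ .la → r ≠ .fin →
    σ.reg r = ρ.reg r
  scc : SccInv ρ V Γ F τ (σ.fld .comp) (σ.fld .val) (σ.fld .inf) (σ.fld .ch) (σ.reg .e)
    (σ.reg .r) L T P str rk
  linkL : Linked (σ.fld .lk1) (σ.reg .la) L
  linkT : Linked (ρ.fld .lk2) (σ.reg .fin) T
  U_bound : ∀ v ∈ U, 1 ≤ v ∧ v ≤ V
  U_comp : ∀ v ∈ U, σ.fld .comp v ≠ 0
  ticks : σ.ticks + L.length + T.length ≤ ρ.ticks + P.card + U.card + F.length + δ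

section

variable {M S V : ℕ} {Γ : Set (ℕ × ℕ × ℕ)} {ρ σ : St} {F : List ℕ} {τ : ℕ → ℕ} {δ : ℕ}
  {L T : List ℕ} {P U : Finset ℕ} {str : ℕ → List ℕ} {rk : ℕ → ℕ}

theorem SccRep.tick (h : SccRep ρ V Γ F τ δ L T P U str rk σ) :
    SccRep ρ V Γ F τ (δ + 1) L T P U str rk σ.tick :=
  { h with ticks := by have := h.ticks; rw [St.tick_ticks]; omega }

theorem SccRep.set (h : SccRep ρ V Γ F τ δ L T P U str rk σ) {r : Reg}
    (hr : r = .x ∨ r = .y ∨ r = .v) (v : ℕ) :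
    SccRep ρ V Γ F τ δ L T P U str rk (σ.set r v) := by
  have hne : ∀ r', r' ≠ .x → r' ≠ .y → r' ≠ .v → (σ.set r v).reg r' = σ.reg r' := by
    intro r' h1 h2 h3
    refine St.set_reg_of_ne _ _ _ _ ?_
    rcases hr with rfl | rfl | rfl <;> assumption
  refine { h with reg := ?_, scc := ?_, linkL := ?_, linkT := ?_ }
  · intro r' h1 h2 h3 h4 h5 h6 h7
    rw [hne r' h2 h3 h4, h.reg r' h1 h2 h3 h4 h5 h6 h7]
  · rw [hne .e (by simp) (by simp) (by simp), hne .r (by simp) (by simp) (by simp)]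
    exact h.scc
  · rw [hne .la (by simp) (by simp) (by simp)]
    exact h.linkL
  · rw [hne .fin (by simp) (by simp) (by simp)]
    exact h.linkT

theorem SccRep.mark (h : SccRep ρ V Γ F τ δ L T P U str rk σ)
    (hlong : ∀ k : ℕ, ∃ u, Walk Γ (σ.reg .r) u (ρ.reg .t) ∧ k ≤ u.length) :
    SccRep ρ V Γ F τ δ L T P U str rk (σ.put .inf (σ.reg .r) 1) := by
  refine { h with fld := ?_, scc := ?_, linkL := ?_, U_comp := ?_ }
  · intro f h1 h2 h3 h4 h5
    rw [St.put_fld_of_ne _ _ _ _ _ h3, h.fld f h1 h2 h3 h4 h5]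
  · simpa using h.scc.mark hlong
  · simpa using h.linkL
  · simpa using h.U_comp

theorem SccRep.join (hD : DfsDone ρ V Γ F τ) (h : SccRep ρ V Γ F τ δ L T P U str rk σ)
    (he : σ.reg .e ≠ 0) (hy : ρ.fld .dst (σ.reg .e) ∈ F)
    (hc : σ.fld .comp (ρ.fld .dst (σ.reg .e)) = 0)
    (hl : ρ.fld .lab (σ.reg .e) = 0 ∨ σ.fld .inf (σ.reg .r) ≠ 0) :
    SccRep ρ V Γ F τ δ (ρ.fld .dst (σ.reg .e) :: L) T P (insert (ρ.fld .dst (σ.reg .e)) U) str rk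
      (((σ.put .comp (ρ.fld .dst (σ.reg .e)) (σ.reg .r)).put .lk1 (ρ.fld .dst (σ.reg .e))
        (σ.reg .la)).set .la (ρ.fld .dst (σ.reg .e))) := by
  have hb := hD.bound _ hy
  have hr := (hD.bound _ h.scc.root).1
  have hs := h.scc.join hD he hy hc hl
  have hU : ρ.fld .dst (σ.reg .e) ∉ U := fun hm => h.U_comp _ hm hc
  have hL : ρ.fld .dst (σ.reg .e) ∉ L := (List.nodup_cons.1 hs.nodup).1
  constructor
  case fld => intro f h1 h2 h3 h4 h5; simpa [h1, h5] using h.fld f h1 h2 h3 h4 h5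
  case reg =>
    intro r h1 h2 h3 h4 h5 h6 h7
    simpa [h6] using h.reg r h1 h2 h3 h4 h5 h6 h7
  case scc => simpa using hs
  case linkL => simpa using h.linkL.push hL (by omega)
  case linkT => simpa using h.linkT
  case U_bound =>
    intro v hv
    rcases Finset.mem_insert.1 hv with rfl | hv
    · exact hb
    · exact h.U_bound v hv
  case U_comp =>
    intro v hv
    rcases Finset.mem_insert.1 hv with rfl | hv
    · simp; omega
    · have hne : v ≠ ρ.fld .dst (σ.reg .e) := fun h => hU (h ▸ hv)
      simpa [hne] using h.U_comp v hv
  case ticks =>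
    have := h.ticks
    rw [Finset.card_insert_of_notMem hU, List.length_cons]
    simp only [St.set_ticks, St.put_ticks]
    omega

theorem SccRep.improve (h : SccRep ρ V Γ F τ δ L T P U str rk σ) (he : σ.reg .e ≠ 0)
    (hy : ρ.fld .dst (σ.reg .e) ∈ F) (hc : σ.fld .comp (ρ.fld .dst (σ.reg .e)) ≠ 0)
    (hcr : σ.fld .comp (ρ.fld .dst (σ.reg .e)) ≠ σ.reg .r) {v : ℕ}
    (hv : v = σ.fld .val (σ.fld .comp (ρ.fld .dst (σ.reg .e))) +
      (lb (ρ.fld .lab (σ.reg .e))).length) (hlt : σ.fld .val (σ.reg .r) < v) :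
    SccRep ρ V Γ F τ δ L T P U
      (Function.update str (σ.reg .r) (lb (ρ.fld .lab (σ.reg .e)) ++
        str (σ.fld .comp (ρ.fld .dst (σ.reg .e))))) rk
      ((σ.put .val (σ.reg .r) v).put .ch (σ.reg .r) (σ.reg .e)) := by
  subst hv
  refine { h with fld := ?_, scc := ?_, linkL := ?_, U_comp := ?_ }
  · intro f h1 h2 h3 h4 h5; simpa [h2, h4] using h.fld f h1 h2 h3 h4 h5
  · simpa using h.scc.improve he hy hc hcr hlt
  · simpa using h.linkL
  · simpa using h.U_comp

theorem wp_insideStep [hM : Fact (1 < M)] (hD : DfsDone ρ V Γ F τ) (hV : V < S)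
    (hE : ρ.reg .nE < S)
    (h : SccRep ρ V Γ F τ δ L T P U str rk σ) (he : σ.reg .e ≠ 0)
    (hy : σ.reg .y = ρ.fld .dst (σ.reg .e)) (hyF : ρ.fld .dst (σ.reg .e) ∈ F)
    (hc : σ.fld .comp (ρ.fld .dst (σ.reg .e)) = 0 ∨
      σ.fld .comp (ρ.fld .dst (σ.reg .e)) = σ.reg .r) :
    wp M S insideStep (fun σ' => σ'.reg .e = σ.reg .e ∧
      Settled ρ (σ'.fld .comp) (σ'.fld .val) (σ'.fld .inf) (σ'.reg .r) (σ.reg .e) ∧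
      ∃ L U, SccRep ρ V Γ F τ δ L T P U str rk σ') σ := by
  have hM1 := hM.out
  have heE := h.scc.e_le
  have hr := hD.bound _ h.scc.root
  have hyV := hD.bound _ hyF
  have hlab := h.fld .lab (by simp) (by simp) (by simp) (by simp) (by simp)
  obtain ⟨hs1, hs2, -⟩ := h.scc.cur he
  have hs0 : ρ.fld .src (σ.reg .e) ≠ ρ.fld .dst (σ.reg .e) ∨
      σ.fld .comp (ρ.fld .dst (σ.reg .e)) ≠ 0 := by
    by_contra hcon
    rw [not_or, not_not, not_not] at hcon
    rw [hcon.1, hcon.2] at hs2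
    omega
  rw [insideStep, wp_seq]
  have key : ∀ σ₁, SccRep ρ V Γ F τ δ L T P U str rk σ₁ → σ₁.reg = σ.reg →
      σ₁.fld .comp = σ.fld .comp → (ρ.fld .lab (σ.reg .e) = 0 ∨ σ₁.fld .inf (σ.reg .r) ≠ 0) →
      wp M S (.ite (.get .comp ◇.y) .skip
        (.store .comp ◇.y ◇.r ;; .store .lk1 ◇.y ◇.la ;; .la ≔ ◇.y))
      (fun σ' => σ'.reg .e = σ.reg .e ∧
        Settled ρ (σ'.fld .comp) (σ'.fld .val) (σ'.fld .inf) (σ'.reg .r) (σ.reg .e) ∧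
        ∃ L U, SccRep ρ V Γ F τ δ L T P U str rk σ') σ₁ := by
    intro σ₁ h₁ hreg hcomp hl
    simp only [wp_seq, wp_assign, wp_store, wp_ite, wp_skip, ok_var, ok_get, ev_var, ev_get,
      true_and, St.put_reg, hreg, hcomp, hy]
    refine ⟨by omega, fun h0 => ⟨⟨h0, .inl ⟨by rw [hs2, hc.resolve_left h0], by rwa [hs2]⟩⟩,
      L, U, h₁⟩, fun h0 => ⟨by omega, by omega, ?_, ?_, ?_⟩⟩
    · simp [hreg]
    · have hne := hs0.resolve_right (not_not.2 h0)
      simp only [St.set_fld, ne_eq, reduceCtorEq, not_false_eq_true, St.put_fld_of_ne,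
        St.put_fld_self, hcomp]
      refine ⟨?_, .inl ⟨?_, ?_⟩⟩
      · rw [Function.update_self]; omega
      · rw [Function.update_self, Function.update_of_ne hne, hs2]
      · rw [Function.update_of_ne hne, hs2]
        exact hl
    · have := h₁.join hD (by rwa [hreg]) (by rwa [hreg]) (by rwa [hreg, hcomp]) (by rwa [hreg])
      rw [hreg] at this
      exact ⟨_, _, this⟩
  rw [wp_ite]
  refine ⟨by simp only [ok_get, ok_var, ev_var, true_and]; omega, fun h0 => ?_, fun h0 => ?_⟩
  · rw [ev_get, ev_var, hlab] at h0
    rw [wp_store]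
    refine ⟨trivial, hM1, by rw [ev_var]; omega, ?_⟩
    refine key _ (h.mark (h.scc.long_of_edge hD he hyF hc h0)) rfl (by simp) (.inr ?_)
    simp
  · rw [ev_get, ev_var, hlab] at h0
    rw [wp_skip]
    exact key _ h rfl rfl (.inl h0)

theorem wp_crossStep [hM : Fact (1 < M)] (hD : DfsDone ρ V Γ F τ) (hV : V < S)
    (hE : ρ.reg .nE < S) (hS : 3 * S ≤ M)
    (h : SccRep ρ V Γ F τ δ L T P U str rk σ) (he : σ.reg .e ≠ 0)
    (hy : σ.reg .y = ρ.fld .dst (σ.reg .e)) (hyF : ρ.fld .dst (σ.reg .e) ∈ F)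
    (hc : σ.fld .comp (ρ.fld .dst (σ.reg .e)) ≠ 0)
    (hcr : σ.fld .comp (ρ.fld .dst (σ.reg .e)) ≠ σ.reg .r) :
    wp M S crossStep (fun σ' => σ'.reg .e = σ.reg .e ∧
      Settled ρ (σ'.fld .comp) (σ'.fld .val) (σ'.fld .inf) (σ'.reg .r) (σ.reg .e) ∧
      ∃ str, SccRep ρ V Γ F τ δ L T P U str rk σ') σ := by
  have hM1 := hM.out
  have heE := h.scc.e_le
  have hr := hD.bound _ h.scc.root
  have hyV := hD.bound _ hyF
  have hlab := h.fld .lab (by simp) (by simp) (by simp) (by simp) (by simp)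
  obtain ⟨hs1, hs2, -⟩ := h.scc.cur he
  obtain ⟨hz1, hz2⟩ := h.scc.comp_mem _ hyF hc
  have hz := hD.bound _ hz1
  have hFV : F.length ≤ V := by
    have := card_le_of_bound (U := F.toFinset) fun v hv => hD.bound v (List.mem_toFinset.1 hv)
    rwa [List.toFinset_card_of_nodup hD.nodup] at this
  have hval : σ.fld .val (σ.fld .comp (ρ.fld .dst (σ.reg .e))) + 1 < M := by
    have h1 := h.scc.val_le _ hz1 hz2
    have h2 := h.scc.rk_le _ hz1 hz2
    omega
  have hw : (if 0 < ρ.fld .lab (σ.reg .e) then 1 else 0) = (lb (ρ.fld .lab (σ.reg .e))).length := by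
    rw [lb]
    by_cases h0 : ρ.fld .lab (σ.reg .e) = 0
    · simp [h0]
    · simp [h0, Nat.pos_of_ne_zero h0]
  rw [crossStep, wp_seq]
  have key : ∀ σ₁, SccRep ρ V Γ F τ δ L T P U str rk σ₁ → σ₁.reg = σ.reg →
      σ₁.fld .comp = σ.fld .comp → σ₁.fld .val = σ.fld .val → σ₁.fld .lab = ρ.fld .lab →
      (σ₁.fld .inf (σ.fld .comp (ρ.fld .dst (σ.reg .e))) ≠ 0 → σ₁.fld .inf (σ.reg .r) ≠ 0) →
      wp M S (.v ≔ .get .val (.get .comp ◇.y) + (Ex.lit 0).lt (.get .lab ◇.e) ;;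
        .ite ((Ex.get .val ◇.r).lt ◇.v) (.store .val ◇.r ◇.v ;; .store .ch ◇.r ◇.e) .skip)
      (fun σ' => σ'.reg .e = σ.reg .e ∧
        Settled ρ (σ'.fld .comp) (σ'.fld .val) (σ'.fld .inf) (σ'.reg .r) (σ.reg .e) ∧
        ∃ str, SccRep ρ V Γ F τ δ L T P U str rk σ') σ₁ := by
    intro σ₁ h₁ hreg hcomp hv hl hi
    simp only [wp_seq, wp_assign, wp_store, wp_ite, wp_skip, ok_var, ok_get, ok_add, ok_lt, ok_lit,
      ev_var, ev_get, ev_add, ev_lt, ev_lit, true_and, St.put_reg, St.set_reg_self,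
      St.set_reg_of_ne, St.set_fld, ne_eq, reduceCtorEq, not_false_eq_true, hreg, hcomp, hy, hv, hl,
      hw]
    have hlen : (lb (ρ.fld .lab (σ.reg .e))).length ≤ 1 := by
      rw [lb]; split_ifs <;> simp
    have h₂ := h₁.set (r := .v) (by simp)
      (σ.fld .val (σ.fld .comp (ρ.fld .dst (σ.reg .e))) + (lb (ρ.fld .lab (σ.reg .e))).length)
    refine ⟨⟨⟨by omega, by omega⟩, ⟨by omega, by omega⟩, by omega⟩, ⟨by omega, trivial⟩,
      fun hlt => ?_,
      fun hlt => ?_⟩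
    · rw [ite_eq_right_iff, not_forall] at hlt
      obtain ⟨hlt, -⟩ := hlt
      refine ⟨by omega, by omega, ?_, ?_⟩
      · simp only [St.put_fld_self, St.put_fld_of_ne, St.set_fld, ne_eq, reduceCtorEq,
          not_false_eq_true, hcomp, hv]
        refine ⟨hc, .inr ⟨by rwa [hs2], hcr, by rwa [hs2], ?_⟩⟩
        rw [hs2, Function.update_self, Function.update_of_ne hcr]
      · have h₃ := h₂.improve (by simpa [hreg] using he) (by simpa [hreg] using hyF)
          (by simpa [hreg, hcomp] using hc) (by simpa [hreg, hcomp] using hcr)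
          (v := σ.fld .val (σ.fld .comp (ρ.fld .dst (σ.reg .e))) +
            (lb (ρ.fld .lab (σ.reg .e))).length) (by simp [hreg, hcomp, hv])
          (by simpa [hreg, hv] using hlt)
        simp only [St.set_reg_of_ne, ne_eq, reduceCtorEq, not_false_eq_true, hreg] at h₃
        exact ⟨_, h₃⟩
    · rw [ite_eq_right_iff] at hlt
      refine ⟨⟨hc, .inr ⟨by rwa [hs2], hcr, by rwa [hs2], ?_⟩⟩, _, h₂⟩
      rw [hs2]
      by_contra hcon
      exact absurd (hlt (by omega)) (by simp)
  rw [wp_ite]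
  simp only [ok_get, ok_var, ev_get, ev_var, true_and, hy]
  refine ⟨by omega, fun h0 => ?_, fun h0 => ?_⟩
  · rw [wp_store]
    refine ⟨trivial, hM1, by rw [ev_var]; omega, ?_⟩
    refine key _ (h.mark (h.scc.long_of_comp hD he hyF hc h0)) rfl (by simp) (by simp)
      (by simpa using hlab) (fun _ => ?_)
    simp
  · rw [wp_skip]
    exact key _ h rfl rfl rfl hlab fun h1 => absurd h0 h1

/-- Every round of the search for longest walks preserves the invariant. -/
theorem SccRep.wp_step [hM : Fact (2 < M)] (hD : DfsDone ρ V Γ F τ) (hV : V < S)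
    (hE : ρ.reg .nE < S) (hS : 3 * S ≤ M) (h : SccRep ρ V Γ F τ 0 L T P U str rk σ)
    (hne : σ.reg .e + σ.reg .la + σ.reg .fin ≠ 0) :
    wp M S maxStep (fun σ' => ∃ L T P U str rk, SccRep ρ V Γ F τ 0 L T P U str rk σ') σ.tick := by
  have hM2 := hM.out
  have : Fact (1 < M) := ⟨by omega⟩
  have heE := h.scc.e_le
  have hr := hD.bound _ h.scc.root
  have hf : ∀ f, f ≠ .comp → f ≠ .val → f ≠ .inf → f ≠ .ch → f ≠ .lk1 → σ.fld f = ρ.fld f := h.fld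
  have hdst := hf .dst (by simp) (by simp) (by simp) (by simp) (by simp)
  have hcol := hf .col (by simp) (by simp) (by simp) (by simp) (by simp)
  have hhOut := hf .hOut (by simp) (by simp) (by simp) (by simp) (by simp)
  have hlk2 := hf .lk2 (by simp) (by simp) (by simp) (by simp) (by simp)
  rw [maxStep, wp_ite]
  refine ⟨trivial, fun h0 => ?_, fun h0 => ?_⟩
  · rw [ev_var, St.tick_reg] at h0
    have h1 : 1 ≤ σ.reg .e := by omega
    have hyV := hD.graph.dst_le _ h1 heE
    have hcy := hD.col _ hyV
    rw [wp_seq, wp_assign, wp_seq]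
    simp only [ok_get, ok_var, ev_get, ev_var, true_and, St.tick_reg, St.tick_fld, hdst]
    refine ⟨by omega, ?_⟩
    have h₁ := h.tick.set (r := .y) (by simp) (ρ.fld .dst (σ.reg .e))
    -- the last command, after the current edge has been settled
    have key : ∀ σ', σ'.reg .e = σ.reg .e → (ρ.fld .dst (σ.reg .e) ∈ F →
        Settled ρ (σ'.fld .comp) (σ'.fld .val) (σ'.fld .inf) (σ'.reg .r) (σ.reg .e)) →
        (∃ L U str, SccRep ρ V Γ F τ 1 L T P U str rk σ') →
        wp M S (.e ≔ .get .nOut ◇.e)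
          (fun σ' => ∃ L T P U str rk, SccRep ρ V Γ F τ 0 L T P U str rk σ') σ' := by
      rintro σ' he hs ⟨L, U, str, h'⟩
      have hsc := h'.scc
      rw [he] at hsc
      obtain ⟨hP, hn⟩ := hsc.next hD h0 hs
      have hnOut := h'.fld .nOut (by simp) (by simp) (by simp) (by simp) (by simp)
      simp only [wp_assign, ok_get, ok_var, ev_get, ev_var, true_and]
      refine ⟨by omega, L, T, insert (σ.reg .e) P, U, str, rk, { h' with
        reg := ?_, scc := ?_, linkL := ?_, linkT := ?_, ticks := ?_ }⟩
      · intro r h1 h2 h3 h4 h5 h6 h7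
        rw [St.set_reg_of_ne _ _ _ _ h1, h'.reg r h1 h2 h3 h4 h5 h6 h7]
      · simpa [he, hnOut] using hn
      · simpa using h'.linkL
      · simpa using h'.linkT
      · have := h'.ticks
        rw [Finset.card_insert_of_notMem hP, St.set_ticks]
        omega
    rw [wp_ite]
    simp only [ok_get, ok_var, ev_get, ev_var, true_and, St.set_reg_self, St.set_fld, St.tick_fld,
      hcol]
    refine ⟨by omega, fun h2 => ?_, fun h2 => ?_⟩
    · have hyF := hcy.1 h2
      rw [wp_ite]
      simp only [ok_add, ok_eq, ok_get, ok_var, ok_lit, ev_add, ev_eq, ev_get, ev_var, ev_lit,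
        true_and, and_true, St.set_reg_self, St.set_reg_of_ne, St.set_fld, St.tick_fld, St.tick_reg,
        ne_eq, reduceCtorEq, not_false_eq_true]
      refine ⟨⟨⟨by omega, by omega⟩, by omega, by split_ifs <;> omega⟩, fun h3 => ?_, fun h3 => ?_⟩
      · refine (wp_insideStep hD hV hE h₁ (by simpa using h0) (by simp) (by simpa using hyF)
          ?_).mono ?_
        · by_contra hcon
          simp only [ne_eq, reduceCtorEq, not_false_eq_true, St.set_reg_of_ne, St.set_fld,
            St.tick_fld, St.tick_reg, not_or] at hcon
          rw [if_neg hcon.1, if_neg hcon.2] at h3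
          exact h3 rfl
        · rintro σ' ⟨h4, h5, L, U, h6⟩
          simp only [ne_eq, reduceCtorEq, not_false_eq_true, St.set_reg_of_ne, St.tick_reg] at h4 h5
          exact key σ' h4 (fun _ => h5) ⟨L, U, _, h6⟩
      · refine (wp_crossStep hD hV hE hS h₁ (by simpa using h0) (by simp) (by simpa using hyF)
          ?_ ?_).mono ?_
        · intro hcon
          simp only [ne_eq, reduceCtorEq, not_false_eq_true, St.set_reg_of_ne, St.set_fld,
            St.tick_fld, St.tick_reg] at hcon
          rw [if_pos hcon] at h3
          omega
        · intro hcon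
          simp only [ne_eq, reduceCtorEq, not_false_eq_true, St.set_reg_of_ne, St.set_fld,
            St.tick_fld, St.tick_reg] at hcon
          rw [if_pos hcon] at h3
          omega
        · rintro σ' ⟨h4, h5, str, h6⟩
          simp only [ne_eq, reduceCtorEq, not_false_eq_true, St.set_reg_of_ne, St.tick_reg] at h4 h5
          exact key σ' h4 (fun _ => h5) ⟨_, _, _, h6⟩
    · rw [wp_skip]
      exact key _ (by simp) (fun hyF => absurd h2 (hcy.2 hyF)) ⟨_, _, _, h₁⟩
  · rw [ev_var, St.tick_reg] at h0
    have hsc := h.scc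
    rw [h0] at hsc
    rw [wp_ite]
    refine ⟨trivial, fun h1 => ?_, fun h1 => ?_⟩
    · rw [ev_var, St.tick_reg] at h1
      obtain ⟨L, rfl, hL⟩ := h.linkL.exists_cons h1
      have hx := hD.bound _ (h.scc.active _ List.mem_cons_self).1
      simp only [wp_seq, wp_assign, ok_get, ok_var, ev_get, ev_var, true_and, St.tick_reg,
        St.tick_fld, St.set_reg_self, St.set_reg_of_ne, St.set_fld, ne_eq, reduceCtorEq,
        not_false_eq_true, hhOut]
      refine ⟨by omega, by omega, L, T, P, U, str, rk, { h with
        reg := ?_, scc := ?_, linkL := ?_, linkT := ?_, ticks := ?_ }⟩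
      · intro r h1 h2 h3 h4 h5 h6 h7
        simpa [h1, h2, h6] using h.reg r h1 h2 h3 h4 h5 h6 h7
      · simpa using hsc.expand hD
      · simpa using hL
      · simpa using h.linkT
      · have := h.ticks
        rw [List.length_cons] at this
        simp only [St.set_ticks, St.tick_ticks]
        omega
    · rw [ev_var, St.tick_reg] at h1
      have hL := h.linkL
      rw [h1] at hL
      obtain rfl := hL.eq_nil
      obtain ⟨T, rfl, hT⟩ := h.linkT.exists_cons (by omega)
      have hxF := h.scc.suffix.subset List.mem_cons_self
      have hx := hD.bound _ hxF
      simp only [wp_seq, wp_assign, wp_store, wp_ite, wp_skip, ok_get, ok_var, ev_get, ev_var,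
        true_and, St.tick_reg, St.tick_fld, St.set_reg_self, St.set_reg_of_ne, St.set_fld, ne_eq,
        reduceCtorEq, not_false_eq_true, St.put_reg, hlk2]
      have hticks := h.ticks
      rw [List.length_cons, List.length_nil] at hticks
      refine ⟨by omega, by omega, fun h2 => ?_, fun h2 => ⟨by omega, by omega, ?_⟩⟩
      · refine ⟨[], T, P, U, str, rk, { h with
          reg := ?_, scc := ?_, linkL := ?_, linkT := ?_, ticks := ?_ }⟩
        · intro r h1 h2 h3 h4 h5 h6 h7
          simpa [h2, h7] using h.reg r h1 h2 h3 h4 h5 h6 h7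
        · simpa [h0] using hsc.skip h2
        · simpa using h.linkL
        · simpa using hT
        · simp only [St.set_ticks, St.tick_ticks, List.length_nil]
          omega
      · have hU : σ.reg .fin ∉ U := fun hm => h.U_comp _ hm h2
        refine ⟨[σ.reg .fin], T, P, insert (σ.reg .fin) U, Function.update str (σ.reg .fin) [],
          Function.update rk (σ.reg .fin) (F.length - T.length), ?_, ?_, ?_, ?_, ?_, ?_, ?_, ?_⟩
        rotate_left 2
        · simpa [h0] using hsc.start hD h2
        · simpa using h.linkL.push List.not_mem_nil (by omega)
        · simpa using hT
        · intro v hv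
          rcases Finset.mem_insert.1 hv with rfl | hv
          · exact hx
          · exact h.U_bound v hv
        · intro v hv
          rcases Finset.mem_insert.1 hv with rfl | hv
          · simp; omega
          · have hne : v ≠ σ.reg .fin := fun h => hU (h ▸ hv)
            simpa [hne] using h.U_comp v hv
        · rw [Finset.card_insert_of_notMem hU]
          simp only [St.set_ticks, St.tick_ticks, St.put_ticks, List.length_cons, List.length_nil]
          omega
        · intro f h1 h2 h3 h4 h5; simpa [h1, h5] using h.fld f h1 h2 h3 h4 h5
        · intro r h1 h2 h3 h4 h5 h6 h7
          simpa [h2, h5, h6, h7] using h.reg r h1 h2 h3 h4 h5 h6 h7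

/-- When the search is finished, the values decrease along the edges by the number of letters. -/
theorem SccInv.final {c val inf ch : ℕ → ℕ} {r : ℕ} (hD : DfsDone ρ V Γ F τ)
    (h : SccInv ρ V Γ F τ c val inf ch 0 r [] [] P str rk) {x y : ℕ} {u : List ℕ}
    (hw : Walk Γ x u y) (hy : y ∈ F) :
    x ∈ F ∧ (inf (c x) = 0 → inf (c y) = 0 ∧ u.length + val (c y) ≤ val (c x)) := by
  induction hw with
  | nil => exact ⟨hy, fun hi => ⟨hi, by simp⟩⟩
  | @cons a b l u t hm _ ih =>
    obtain ⟨hb, ih⟩ := ih hy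
    obtain ⟨e, h1, h2, rfl, rfl, rfl⟩ := hD.graph.exists_edge _ _ _ hm
    have ha := hD.closed e h1 h2 hb
    have hc : c (ρ.fld .src e) ≠ 0 := fun h0 => absurd (h.rest _ ha h0) List.not_mem_nil
    have hP : e ∈ P := (h.complete e h1 h2 ha hc List.not_mem_nil).resolve_right fun h => h.1 rfl
    refine ⟨ha, fun hi => ?_⟩
    rw [List.length_append]
    rcases (h.settled e hP hb).2 with ⟨h3, h4⟩ | ⟨-, -, h3, h4⟩
    · rw [h3] at ih
      rw [h4.resolve_right (fun h => h hi), lb_zero, List.length_nil, zero_add]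
      exact ih hi
    · have h5 : inf (c (ρ.fld .dst e)) = 0 := by
        by_contra hne
        exact h3 hne hi
      obtain ⟨h6, h7⟩ := ih h5
      exact ⟨h6, by omega⟩

/-- When the search is finished, the vertices of a component without arbitrarily long walks can be
reached from each other by walks with the empty label. -/
theorem SccInv.final_nil {c val inf ch : ℕ → ℕ} {r : ℕ} (hD : DfsDone ρ V Γ F τ)
    (h : SccInv ρ V Γ F τ c val inf ch 0 r [] [] P str rk) {x : ℕ} (hx : x ∈ F)
    (hi : inf (c x) = 0) : Walk Γ x [] (c x) := by
  have hc : c x ≠ 0 := fun h0 => absurd (h.rest _ hx h0) List.not_mem_nil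
  obtain ⟨u, hu⟩ := h.bwd x hx hc
  obtain ⟨h1, h2⟩ := h.comp_mem x hx hc
  have h3 := ((h.final hD hu h1).2 hi).2
  rw [h2] at h3
  rwa [List.length_eq_zero_iff.1 (by omega : u.length = 0)] at hu

/-- When the search is finished, the recorded strings are labels of walks to `t`, and their
lengths are given by the values. -/
theorem SccInv.final_walk {c val inf ch : ℕ → ℕ} {r : ℕ} (hD : DfsDone ρ V Γ F τ)
    (h : SccInv ρ V Γ F τ c val inf ch 0 r [] [] P str rk) {z : ℕ} (hz : z ∈ F) (hcz : c z = z)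
    (hi : inf z = 0) : Walk Γ z (str z) (ρ.reg .t) ∧ val z = (str z).length + 1 := by
  obtain ⟨n, hn⟩ : ∃ n, rk z ≤ n := ⟨_, le_rfl⟩
  induction n using Nat.strong_induction_on generalizing z with
  | _ n ih =>
    obtain ⟨u, hu⟩ := hD.reach z hz
    have hval := ((h.final hD hu hD.t_mem).2 (by rwa [hcz])).2
    rw [h.t_comp, hcz] at hval
    have ht := h.t_val
    by_cases h0 : ch z = 0
    · obtain ⟨h1, h2⟩ := h.finish z hz hcz h0
      have hzt : z = ρ.reg .t := by
        by_contra hne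
        rw [if_neg hne] at h2
        omega
      rw [h1, h2, if_pos hzt, ← hzt]
      exact ⟨.nil z, rfl⟩
    · obtain ⟨h1, h2, h3, h4, h5, h6, h7, h8, h9, h10⟩ := h.choice z hz hcz h0
      have hpos : 1 ≤ ch z := by omega
      have hm := hD.graph.mem _ hpos h1
      have hi' := ((h.final hD (.single hm) h4).2 (by rwa [h3])).1
      obtain ⟨h11, h12⟩ := h.comp_mem _ h4 h5
      obtain ⟨w, hw⟩ := ih _ (h10.trans_le hn) h11 h12 hi' le_rfl
      have hz1 := (hD.bound z hz).1
      have hin := h.zero _ h2 (by omega)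
      rw [h3] at hin
      have := (hin hi).trans (.cons hm ((h.final_nil hD h4 hi').trans w))
      rw [h8, h9, hw, List.length_append]
      exact ⟨by simpa using this, by omega⟩

/-- The bound on the number of rounds that follows from `SccRep.ticks`. -/
theorem SccRep.card_le (hD : DfsDone ρ V Γ F τ) (h : SccRep ρ V Γ F τ δ L T P U str rk σ) :
    P.card + U.card + F.length ≤ ρ.reg .nE + 2 * V := by
  have h1 := card_le_of_bound h.scc.P_bound
  have h2 := card_le_of_bound h.U_bound
  have h3 := card_le_of_bound (U := F.toFinset) fun v hv => hD.bound v (List.mem_toFinset.1 hv)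
  rw [List.toFinset_card_of_nodup hD.nodup] at h3
  omega

/-- When the search is finished, the arrays hold a correct answer: by `SccInv.final` no walk is
longer than the value of the component in which it starts, and by `SccInv.final_walk` this length is
attained, unless the component is marked as the start of arbitrarily long walks. -/
theorem SccRep.solution (hD : DfsDone ρ V Γ F τ)
    (h : SccRep ρ V Γ F τ δ [] [] P U str rk σ) (he : σ.reg .e = 0) (hs : ρ.reg .s ≤ V) :
    ∃ ans, Solution V σ ans ∧
      Variant.Correct {u | Walk Γ (ρ.reg .s) u (ρ.reg .t)} .max ans := by
  have hf : ∀ f, f ≠ .comp → f ≠ .val → f ≠ .inf → f ≠ .ch → f ≠ .lk1 → σ.fld f = ρ.fld f := h.fld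
  have hr : ∀ r, r ≠ .e → r ≠ .x → r ≠ .y → r ≠ .v → r ≠ .r → r ≠ .la → r ≠ .fin →
    σ.reg r = ρ.reg r := h.reg
  have hss := hr .s (by simp) (by simp) (by simp) (by simp) (by simp) (by simp) (by simp)
  have hnE := hr .nE (by simp) (by simp) (by simp) (by simp) (by simp) (by simp) (by simp)
  have hdst := hf .dst (by simp) (by simp) (by simp) (by simp) (by simp)
  have hlab := hf .lab (by simp) (by simp) (by simp) (by simp) (by simp)
  have hsc := h.scc
  rw [he] at hsc
  by_cases hsF : ρ.reg .s ∈ F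
  · have hc : σ.fld .comp (ρ.reg .s) ≠ 0 := fun h0 =>
      absurd (hsc.rest _ hsF h0) List.not_mem_nil
    obtain ⟨h1, h2⟩ := hsc.comp_mem _ hsF hc
    by_cases hi : σ.fld .inf (σ.fld .comp (ρ.reg .s)) = 0
    · have hsol : Solution V σ (.string (str (σ.fld .comp (σ.reg .s)))) := by
        refine .string (R := fun z => z ∈ F ∧ σ.fld .comp z = z) (rk := rk) ?_ ?_ ?_ ?_
        · rwa [hss]
        · rwa [hss]
        · rw [hss]; exact ⟨h1, h2⟩
        · rw [hnE, hdst, hlab]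
          constructor
          · exact fun z hz => (hD.bound z hz.1).2
          · intro z hz
            have h3 := hsc.rk_le z hz.1 hz.2
            have h4 := card_le_of_bound (U := F.toFinset) fun v hv =>
              hD.bound v (List.mem_toFinset.1 hv)
            rw [List.toFinset_card_of_nodup hD.nodup] at h4
            omega
          · exact fun z hz h0 => (hsc.finish z hz.1 hz.2 h0).1
          · intro z hz
            by_cases h0 : σ.fld .ch z = 0
            · omega
            · exact (hsc.choice z hz.1 hz.2 h0).1
          · exact fun z hz h0 => (hD.bound _ (hsc.choice z hz.1 hz.2 h0).2.2.2.1).2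
          · intro z hz h0
            have h3 := hsc.choice z hz.1 hz.2 h0
            exact hsc.comp_mem _ h3.2.2.2.1 h3.2.2.2.2.1
          · exact fun z hz h0 => (hsc.choice z hz.1 hz.2 h0).2.2.2.2.2.2.2.2.2
          · exact fun z hz h0 => (hsc.choice z hz.1 hz.2 h0).2.2.2.2.2.2.2.2.1
      refine ⟨_, hsol, ?_⟩
      rw [hss]
      obtain ⟨h3, h4⟩ := hsc.final_walk hD h1 h2 hi
      refine ⟨by simpa using (hsc.final_nil hD hsF hi).trans h3, fun v hv => ?_⟩
      have h5 := ((hsc.final hD hv hD.t_mem).2 hi).2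
      have h6 := hsc.t_val
      rw [hsc.t_comp] at h5
      omega
    · refine ⟨.unbounded, .unbounded (by rwa [hss]) (by rwa [hss]), fun k => ?_⟩
      obtain ⟨u₁, w₁⟩ := hsc.bwd _ hsF hc
      obtain ⟨u, w, hk⟩ := hsc.long _ h1 h2 hi k
      refine ⟨_, w₁.trans w, ?_⟩
      rw [List.length_append]
      omega
  · refine ⟨.noString, .noString (by rw [hss]; exact hsc.comp_out _ hs hsF), ?_⟩
    exact Set.eq_empty_iff_forall_notMem.2 fun u hu => hsF (hsc.final hD hu hD.t_mem).1

/-- Initially, `t` alone forms the current component. All of its edges remain to be looked at. -/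
theorem SccInv.initial (hD : DfsDone ρ V Γ F τ) (hcomp : ∀ v ≤ V, ρ.fld .comp v = 0)
    (hch : ∀ v ≤ V, ρ.fld .ch v = 0) (hinf : ∀ v ≤ V, ρ.fld .inf v = 0)
    (hval : ∀ v ≤ V, ρ.fld .val v = 0) :
    SccInv ρ V Γ F τ (Function.update (ρ.fld .comp) (ρ.reg .t) (ρ.reg .t))
      (Function.update (ρ.fld .val) (ρ.reg .t) 1) (ρ.fld .inf) (ρ.fld .ch) 0 (ρ.reg .t)
      [ρ.reg .t] F ∅ (fun _ => []) (fun _ => 0) := by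
  have ht := hD.t_mem
  have hc0 : ∀ v ∈ F, v ≠ ρ.reg .t → Function.update (ρ.fld .comp) (ρ.reg .t) (ρ.reg .t) v = 0 :=
    fun v hv hne => by rw [Function.update_of_ne hne, hcomp v (hD.bound v hv).2]
  have hct : ∀ v ∈ F, Function.update (ρ.fld .comp) (ρ.reg .t) (ρ.reg .t) v ≠ 0 → v = ρ.reg .t :=
    fun v hv => by
      contrapose
      intro hne
      rw [hc0 v hv hne]
  have hz : ∀ z ∈ F, Function.update (ρ.fld .comp) (ρ.reg .t) (ρ.reg .t) z = z → z = ρ.reg .t :=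
    fun z hzF h => hct z hzF (by rw [h]; have := (hD.bound z hzF).1; omega)
  constructor
  case comp_out =>
    intro v hv hvF
    rw [Function.update_of_ne (fun h => hvF (by rwa [h])), hcomp v hv]
  case comp_mem =>
    intro v hv h0
    rw [hct v hv h0]
    simp [ht]
  case fresh =>
    intro v hv h0
    have hne : v ≠ ρ.reg .t := fun h => h0 (by simp [h])
    have hvV := (hD.bound v hv).2
    rw [Function.update_of_ne hne]
    exact ⟨hinf v hvV, hval v hvV, hch v hvV⟩
  case fwd => intro v hv h0; rw [hct v hv h0, Function.update_self]; exact .refl _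
  case bwd => intro v hv h0; rw [hct v hv h0, Function.update_self]; exact .refl _
  case zero => intro v hv h0 _; rw [hct v hv h0, Function.update_self]; exact .nil _
  case suffix => exact List.suffix_rfl
  case rest => exact fun v hv _ => hv
  case root => exact ht
  case root_comp => simp
  case dom =>
    exact fun v hv _ => ⟨hD.time_le v hv, fun x hx _ _ => hD.reach x hx⟩
  case late => exact hD.time_le
  case long => exact fun z hzF _ hi => absurd (hinf z (hD.bound z hzF).2) hi
  case t_comp => simp
  case val_le => intro z hzF h; rw [hz z hzF h]; simp
  case choice => exact fun z hzF _ h => absurd (hch z (hD.bound z hzF).2) h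
  case finish => intro z hzF h _; rw [hz z hzF h]; simp
  case rk_lt => exact fun z hzF h hne => absurd (hz z hzF h) hne
  case complete =>
    intro e h1 h2 h3 h4 h5
    exact absurd (List.mem_singleton.2 (hct _ h3 h4)) h5
  all_goals simp
  exact ht

/-- The search for longest walks is correct, in a number of rounds that is linear in the size of the
graph. -/
theorem wp_maxSearch [hM : Fact (2 < M)] (hG : GraphRep V Γ ρ) (hV : V < S) (hE : ρ.reg .nE < S)
    (hS : 3 * S ≤ M) (ht : 1 ≤ ρ.reg .t) (htV : ρ.reg .t ≤ V) (hs : ρ.reg .s ≤ V)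
    (hcol : ∀ v ≤ V, ρ.fld .col v = 0) (hcomp : ∀ v ≤ V, ρ.fld .comp v = 0)
    (hch : ∀ v ≤ V, ρ.fld .ch v = 0) (hinf : ∀ v ≤ V, ρ.fld .inf v = 0)
    (hval : ∀ v ≤ V, ρ.fld .val v = 0) :
    wp M S maxSearch (fun σ => (∃ ans, Solution V σ ans ∧
        Variant.Correct {u | Walk Γ (ρ.reg .s) u (ρ.reg .t)} .max ans) ∧
      σ.reg .s = ρ.reg .s ∧ σ.reg .nE = ρ.reg .nE ∧ σ.fld .comp (σ.reg .s) ≤ V ∧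
      σ.ticks ≤ ρ.ticks + 2 * ρ.reg .nE + 3 * V) ρ := by
  have hM2 := hM.out
  rw [maxSearch, wp_seq]
  refine (wp_dfs hG hV hE (by omega) ht htV hcol).mono ?_
  rintro ρ' ⟨⟨F, τ, hD⟩, hf, hr, htk⟩
  have hrs := hr .s (by simp) (by simp) (by simp) (by simp) (by simp)
  have hrt := hr .t (by simp) (by simp) (by simp) (by simp) (by simp)
  have hrE := hr .nE (by simp) (by simp) (by simp) (by simp) (by simp)
  rw [← hrs, ← hrt, ← hrE]
  rw [← hrs] at hs
  rw [← hrt] at ht htV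
  rw [← hrE] at hE htk
  rw [← hf .comp (by simp) (by simp) (by simp) (by simp)] at hcomp
  rw [← hf .ch (by simp) (by simp) (by simp) (by simp)] at hch
  rw [← hf .inf (by simp) (by simp) (by simp) (by simp)] at hinf
  rw [← hf .val (by simp) (by simp) (by simp) (by simp)] at hval
  simp only [wp_seq, wp_assign, wp_store, ok_var, ok_lit, ev_var, ev_lit, true_and, St.put_reg,
    St.set_reg_of_ne, ne_eq, reduceCtorEq, not_false_eq_true]
  refine ⟨by omega, by omega, by omega, by omega, by omega, by omega, ?_⟩
  have htk' : ∀ {L T P U str rk σ}, SccRep ρ' V Γ F τ 0 L T P U str rk σ →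
      σ.ticks ≤ ρ'.ticks + ρ'.reg .nE + 2 * V := by
    intro L T P U str rk σ h
    have := h.card_le hD
    have := h.ticks
    omega
  refine wp_while (fun σ => ∃ L T P U str rk, SccRep ρ' V Γ F τ 0 L T P U str rk σ)
    (ρ'.ticks + ρ'.reg .nE + 2 * V) ⟨[ρ'.reg .t], F, ∅, {ρ'.reg .t}, fun _ => [], fun _ => 0, ?_⟩
    ?_ ?_ ?_ ?_
  · constructor
    case fld => intro f h1 h2 h3 h4 h5; simp [h1, h2, h5]
    case reg => intro r h1 h2 h3 h4 h5 h6 h7; simp [h1, h5, h6]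
    case scc => simpa using SccInv.initial hD hcomp hch hinf hval
    case linkL =>
      simp [Linked]
      omega
    case linkT => simpa using hD.link
    case U_comp => simp; omega
    case U_bound => simpa using ⟨ht, htV⟩
    case ticks => simp
  · rintro σ ⟨L, T, P, U, str, rk, h⟩
    exact htk' h
  · rintro σ ⟨L, T, P, U, str, rk, h⟩
    have h1 := h.scc.e_le
    have h2 : σ.reg .la ≤ V := by
      by_cases hz : σ.reg .la = 0
      · omega
      · obtain ⟨A', rfl, -⟩ := h.linkL.exists_cons hz
        exact (hD.bound _ (h.scc.active _ List.mem_cons_self).1).2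
    have h3 : σ.reg .fin ≤ V := by
      by_cases hz : σ.reg .fin = 0
      · omega
      · obtain ⟨B', rfl, -⟩ := h.linkT.exists_cons hz
        exact (hD.bound _ (h.scc.suffix.subset List.mem_cons_self)).2
    simp only [ok_add, ok_var, ev_add, ev_var, true_and]
    omega
  · rintro σ ⟨L, T, P, U, str, rk, h⟩ hne
    exact h.wp_step hD hV hE hS hne
  · rintro σ ⟨L, T, P, U, str, rk, h⟩ h0
    simp only [ev_add, ev_var] at h0
    have hL := h.linkL
    have hT := h.linkT
    rw [show σ.reg .la = 0 by omega] at hL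
    rw [show σ.reg .fin = 0 by omega] at hT
    obtain rfl := hL.eq_nil
    obtain rfl := hT.eq_nil
    have hss := h.reg .s (by simp) (by simp) (by simp) (by simp) (by simp) (by simp) (by simp)
    refine ⟨h.solution hD (by omega) hs, hss, ?_, ?_, ?_⟩
    · exact h.reg _ (by simp) (by simp) (by simp) (by simp) (by simp) (by simp) (by simp)
    · rw [hss]
      by_cases hsF : ρ'.reg .s ∈ F
      · by_cases hc : σ.fld .comp (ρ'.reg .s) = 0
        · omega
        · exact (hD.bound _ (h.scc.comp_mem _ hsF hc).1).2
      · rw [h.scc.comp_out _ hs hsF]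
        omega
    · have := htk' h
      omega

end

end QuantMatch

/-! ### Construction of the product graph -/

namespace QuantMatch

/-- The input as numbers: `n` states, `m` transitions from `tp j` to `tq j` with label `ta j`, the
initial state `ini`, the final state `acc`, and a word with the `k` letters `wd i`. States and
letters are counted from `1`, and `0` is the label of ε-transitions. -/
structure Inst where
  n : ℕ
  k : ℕ
  m : ℕ
  ini : ℕ
  acc : ℕ
  tp : ℕ → ℕ
  ta : ℕ → ℕ
  tq : ℕ → ℕ
  wd : ℕ → ℕ

/-- The bounds satisfied by the numbers of an input. -/
structure Inst.Valid (I : Inst) : Prop where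
  ini_pos : 1 ≤ I.ini
  ini_le : I.ini ≤ I.n
  acc_pos : 1 ≤ I.acc
  acc_le : I.acc ≤ I.n
  tp_pos : ∀ j < I.m, 1 ≤ I.tp j
  tp_le : ∀ j < I.m, I.tp j ≤ I.n
  tq_pos : ∀ j < I.m, 1 ≤ I.tq j
  tq_le : ∀ j < I.m, I.tq j ≤ I.n

/-- The properties by which the string relations differ: whether a prefix and a suffix of the word
may be ignored, whether letters may be inserted before, inside and after the word, and whether
letters of the word may be skipped. A prefix may be ignored if `start` holds, and a suffix if
`finish` holds. -/
structure Flags where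
  start : Bool
  finish : Bool
  first : Bool
  middle : Bool
  last : Bool
  skip : Bool

/-- The set that contains `x` if `p` holds and is empty otherwise. -/
def opt (p : Prop) (x : ℕ × ℕ × ℕ) : Set (ℕ × ℕ × ℕ) := {y | p ∧ y = x}

namespace Inst

variable (I : Inst) (fl : Flags)

/-- The first vertex of walks in the product graph. -/
def source : ℕ := (I.k + 1) * I.n + 1

/-- The last vertex of walks in the product graph. -/
def sink : ℕ := (I.k + 1) * I.n + 2

/-- The letter of the word at position `i`, and `0` at the end of the word. -/
def letter (i : ℕ) : ℕ := if i < I.k then I.wd i else 0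

/-- Letters may be inserted after `i` letters of the word. -/
def Stay (i : ℕ) : Prop :=
  fl.middle = true ∨ (fl.first = true ∧ i = 0) ∨ (fl.last = true ∧ i = I.k)

/-- The edges of the product graph at the vertices of layer `i` for the initial and the final
state. The vertex for a state `q` in layer `i`, where `i` letters of the word have been consumed,
is `i * n + q`. -/
def ends (i : ℕ) : Set (ℕ × ℕ × ℕ) :=
  opt (fl.start = true ∨ i = 0) (I.source, i * I.n + I.ini, 0) ∪
    opt (fl.finish = true ∨ i = I.k) (i * I.n + I.acc, I.sink, 0)

/-- The edges of the product graph that stem from the transition `j` in layer `i`. -/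
def trans (i j : ℕ) : Set (ℕ × ℕ × ℕ) :=
  opt (I.ta j = 0 ∨ I.Stay fl i) (i * I.n + I.tp j, i * I.n + I.tq j, I.ta j) ∪
    opt (I.ta j ≠ 0 ∧ I.ta j = I.letter i)
      (i * I.n + I.tp j, i * I.n + I.tq j + I.n, I.ta j) ∪
    opt (fl.skip = true ∧ i < I.k) (i * I.n + I.tp j, i * I.n + I.tp j + I.n, 0)

/-- The product graph. -/
def graph : Set (ℕ × ℕ × ℕ) :=
  {x | ∃ i ≤ I.k, x ∈ I.ends fl i ∨ ∃ j < I.m, x ∈ I.trans fl i j}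

/-- The state contains the input. -/
structure Holds (σ : St) : Prop where
  n : σ.fld .inp 0 = I.n
  ini : σ.fld .inp 2 = I.ini
  acc : σ.fld .inp 3 = I.acc
  m : σ.fld .inp 4 = I.m
  k : σ.fld .inp 5 = I.k
  tp : ∀ j < I.m, σ.fld .inp (j + j + j + 6) = I.tp j
  ta : ∀ j < I.m, σ.fld .inp (j + j + j + 7) = I.ta j
  tq : ∀ j < I.m, σ.fld .inp (j + j + j + 8) = I.tq j
  wd : ∀ i < I.k, σ.fld .inp (I.m + I.m + I.m + 6 + i) = I.wd i

end Inst

/-- Appends an edge, given by expressions for its source, target and label, if a condition is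
satisfied. -/
def emitIf (c a b l : Ex) : Cmd :=
  .ite c (.x ≔ a ;; .y ≔ b ;; .v ≔ l ;; emit) .skip

/-- Clears the entries at position `j` of the arrays that have to be initialised. -/
def clearStep : Cmd :=
  .store .hIn ◇.j (.lit 0) ;;
  .store .hOut ◇.j (.lit 0) ;;
  .store .comp ◇.j (.lit 0) ;;
  .store .col ◇.j (.lit 0) ;;
  .store .val ◇.j (.lit 0) ;;
  .store .inf ◇.j (.lit 0) ;;
  .store .ch ◇.j (.lit 0) ;;
  .j ≔ ◇.j + .lit 1

/-- Emits the edges of the product graph that stem from transition `j` in the current layer. -/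
def transStep (fl : Flags) : Cmd :=
  .p ≔ ◇.base + .get .inp (◇.j + ◇.j + ◇.j + .lit 6) ;;
  .a ≔ .get .inp (◇.j + ◇.j + ◇.j + .lit 7) ;;
  .q ≔ ◇.base + .get .inp (◇.j + ◇.j + ◇.j + .lit 8) ;;
  emitIf ((◇.a).eq (.lit 0) + (.lit fl.middle.toNat + .lit fl.first.toNat * (◇.layer).eq (.lit 0) +
    .lit fl.last.toNat * (◇.layer).eq ◇.k)) ◇.p ◇.q ◇.a ;;
  emitIf ((Ex.lit 0).lt ◇.a * (◇.a).eq ◇.wl) ◇.p (◇.q + ◇.n) ◇.a ;;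
  emitIf (.lit fl.skip.toNat * (◇.layer).lt ◇.k) ◇.p (◇.p + ◇.n) (.lit 0) ;;
  .j ≔ ◇.j + .lit 1

/-- Emits the edges of the product graph in the current layer. -/
def layerStep (fl : Flags) : Cmd :=
  .wl ≔ .lit 0 ;;
  .ite ((◇.layer).lt ◇.k) (.wl ≔ .get .inp (◇.m + ◇.m + ◇.m + .lit 6 + ◇.layer)) .skip ;;
  emitIf (.lit fl.start.toNat + (◇.layer).eq (.lit 0)) ◇.s (◇.base + .get .inp (.lit 2))
    (.lit 0) ;;
  emitIf (.lit fl.finish.toNat + (◇.layer).eq ◇.k) (◇.base + .get .inp (.lit 3)) ◇.t (.lit 0) ;;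
  .j ≔ .lit 0 ;;
  .while ((◇.j).lt ◇.m) (transStep fl) ;;
  .base ≔ ◇.base + ◇.n ;;
  .layer ≔ ◇.layer + .lit 1

/-- Initialises the arrays and constructs the product graph. -/
def build (fl : Flags) : Cmd :=
  .n ≔ .get .inp (.lit 0) ;;
  .m ≔ .get .inp (.lit 4) ;;
  .k ≔ .get .inp (.lit 5) ;;
  .s ≔ (◇.k + .lit 1) * ◇.n + .lit 1 ;;
  .t ≔ ◇.s + .lit 1 ;;
  .j ≔ .lit 0 ;;
  .while ((◇.j).lt (◇.t + .lit 1)) clearStep ;;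
  .nE ≔ .lit 0 ;;
  .base ≔ .lit 0 ;;
  .layer ≔ .lit 0 ;;
  .while ((◇.layer).lt (◇.k + .lit 1)) (layerStep fl)

section

variable {M S V : ℕ} {Γ : Set (ℕ × ℕ × ℕ)} {σ : St} {Q : St → Prop}

theorem union_opt_of {p : Prop} (hp : p) (x : ℕ × ℕ × ℕ) : Γ ∪ opt p x = insert x Γ := by
  ext y
  simp [opt, hp]

theorem union_opt_of_not {p : Prop} (hp : ¬p) (x : ℕ × ℕ × ℕ) : Γ ∪ opt p x = Γ := by
  ext y
  simp [opt, hp]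

/-- The registers that may be changed by the emission of an edge. -/
def Reg.isTemp : Reg → Bool
  | .nE | .x | .y | .v => true
  | _ => false

/-- The conditional emission of an edge adds the edge to the graph if and only if the condition `p`
holds that the expression `c` decides. -/
theorem wp_emitIf [hM : Fact (1 < M)] {p : Prop} {c a b l : Ex} {va vb vl : ℕ} (hS : S ≤ M)
    (hV : V < S) (hE : σ.reg .nE + 1 < S) (h : GraphRep V Γ σ) (hc : c.ok M S σ)
    (hp : c.ev σ ≠ 0 ↔ p) (ha : a.ok M S σ) (hva : a.ev σ = va)
    (hb : ∀ x, b.ok M S (σ.set .x x) ∧ b.ev (σ.set .x x) = vb)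
    (hl : ∀ x y, l.ok M S ((σ.set .x x).set .y y) ∧ l.ev ((σ.set .x x).set .y y) = vl)
    (hab : p → 1 ≤ va ∧ va ≤ V ∧ 1 ≤ vb ∧ vb ≤ V)
    (hQ : ∀ σ', GraphRep V (Γ ∪ opt p (va, vb, vl)) σ' →
      (∀ r, r.isTemp = false → σ'.reg r = σ.reg r) → σ'.reg .nE ≤ σ.reg .nE + 1 →
      σ'.ticks = σ.ticks → (∀ f, f.isGraph = false → σ'.fld f = σ.fld f) → Q σ') :
    wp M S (emitIf c a b l) Q σ := by
  rw [emitIf, wp_ite]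
  refine ⟨hc, fun h0 => ?_, fun h0 => ?_⟩
  · have hp' := hp.1 h0
    obtain ⟨h1, h2, h3, h4⟩ := hab hp'
    simp only [wp_seq, wp_assign]
    refine ⟨ha, (hb _).1, (hl _ _).1, ?_⟩
    rw [hva, (hb va).2, (hl va vb).2]
    refine wp_emit (V := V) (Γ := Γ) hS hV (by simpa using hE) ⟨?_, ?_, ?_⟩ ?_ ?_ ?_ ?_ ?_
    · simpa using h.graph
    · simpa using h.adjIn
    · simpa using h.adjOut
    · simpa using h1
    · simpa using h2
    · simpa using h3
    · simpa using h4
    · intro σ' g1 g2 g3 g4 g5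
      refine hQ σ' ?_ ?_ ?_ ?_ ?_
      · rw [union_opt_of hp']
        simpa using g1
      · intro r hr
        rw [g2 r (by rintro rfl; simp [Reg.isTemp] at hr)]
        cases r <;> simp_all [Reg.isTemp]
      · simpa using g3.le
      · simpa using g4
      · intro f hf
        rw [g5 f hf]
        simp
  · rw [wp_skip]
    refine hQ σ ?_ (fun _ _ => rfl) (Nat.le_succ _) rfl (fun _ _ => rfl)
    rw [union_opt_of_not (fun hp' => hp.2 hp' h0)]
    exact h

variable {I : Inst} {fl : Flags}

theorem ev_eq_le_one (σ : St) (x y : Ex) : (x.eq y).ev σ ≤ 1 := by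
  rw [ev_eq]
  split_ifs <;> omega

theorem ev_lt_le_one (σ : St) (x y : Ex) : (x.lt y).ev σ ≤ 1 := by
  rw [ev_lt]
  split_ifs <;> omega

theorem Inst.layer_le {i : ℕ} (hi : i ≤ I.k) : i * I.n + I.n ≤ (I.k + 1) * I.n := by
  rw [← Nat.succ_mul]
  exact Nat.mul_le_mul_right _ (by omega)

theorem Inst.layer_le' {i : ℕ} (hi : i < I.k) : i * I.n + I.n + I.n ≤ (I.k + 1) * I.n := by
  rw [← Nat.succ_mul, ← Nat.succ_mul]
  exact Nat.mul_le_mul_right _ (by omega)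

/-- The conditions on the size `S` of the arrays and the bound `M` on numbers under which the
product graph can be constructed. -/
structure Inst.Fits (I : Inst) (M S : ℕ) : Prop where
  vertices : I.sink + 1 < S
  edges : (I.k + 1) * (3 * I.m + 2) + 1 < S
  input : 3 * I.m + I.k + 6 ≤ S
  words : 16 * S ≤ M

/-- The part of the state that is fixed during the construction of the edges. -/
structure Inst.Fixed (I : Inst) (ρ σ : St) : Prop where
  holds : I.Holds σ
  n : σ.reg .n = I.n
  m : σ.reg .m = I.m
  k : σ.reg .k = I.k
  s : σ.reg .s = I.source
  t : σ.reg .t = I.sink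
  fld : ∀ f, f.isGraph = false → σ.fld f = ρ.fld f

theorem Inst.Fixed.of_eq {ρ σ σ' : St} (h : I.Fixed ρ σ)
    (hr : ∀ r, r = .n ∨ r = .m ∨ r = .k ∨ r = .s ∨ r = .t → σ'.reg r = σ.reg r)
    (hf : ∀ f, f.isGraph = false → σ'.fld f = σ.fld f) : I.Fixed ρ σ' := by
  have hi := hf .inp rfl
  have hh := h.holds
  constructor
  · constructor <;> rw [hi]
    exacts [hh.n, hh.ini, hh.acc, hh.m, hh.k, hh.tp, hh.ta, hh.tq, hh.wd]
  · rw [hr _ (by simp), h.n]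
  · rw [hr _ (by simp), h.m]
  · rw [hr _ (by simp), h.k]
  · rw [hr _ (by simp), h.s]
  · rw [hr _ (by simp), h.t]
  · exact fun f hf' => (hf f hf').trans (h.fld f hf')

/-- A transition contributes at most three edges in each layer. -/
theorem wp_transStep {ρ : St} {i j B T : ℕ} (hI : I.Valid) (hS : I.Fits M S) (hi : i ≤ I.k)
    (hj : j < I.m) (h : GraphRep I.sink Γ σ) (hF : I.Fixed ρ σ) (hl : σ.reg .layer = i)
    (hb : σ.reg .base = i * I.n) (hw : σ.reg .wl = I.letter i) (hj' : σ.reg .j = j)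
    (hE : σ.reg .nE ≤ B) (hB : B + 3 < S) (ht : σ.ticks = T) :
    wp M S (transStep fl) (fun σ' => GraphRep I.sink (Γ ∪ I.trans fl i j) σ' ∧ I.Fixed ρ σ' ∧
      σ'.reg .layer = i ∧ σ'.reg .base = i * I.n ∧ σ'.reg .wl = I.letter i ∧ σ'.reg .j = j + 1 ∧
      σ'.reg .nE ≤ B + 3 ∧ σ'.ticks = T) σ := by
  obtain ⟨hS1, hS2, hS3, hS4⟩ := hS
  have hM1 : Fact (1 < M) := ⟨by omega⟩
  have h1 := hI.tp_pos j hj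
  have h2 := hI.tp_le j hj
  have h3 := hI.tq_pos j hj
  have h4 := hI.tq_le j hj
  have hlay := I.layer_le hi
  have hsink : I.sink = (I.k + 1) * I.n + 2 := rfl
  have t1 := hF.holds.tp j hj
  have t2 := hF.holds.ta j hj
  have t3 := hF.holds.tq j hj
  have hbool : ∀ b : Bool, b.toNat ≤ 1 := fun b => by cases b <;> simp
  have b1 := hbool fl.middle
  have b2 := hbool fl.first
  have b3 := hbool fl.last
  have b4 := hbool fl.skip
  rw [transStep, wp_seq, wp_assign, wp_seq, wp_assign, wp_seq, wp_assign]
  simp only [ok_add, ok_get, ok_var, ok_lit, ev_add, ev_get, ev_var, ev_lit, St.set_fld,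
    St.set_reg_of_ne, ne_eq, reduceCtorEq, not_false_eq_true, hb, hj', t1, t2, t3, true_and]
  refine ⟨by omega, by omega, by omega, ?_⟩
  set σ₀ := ((σ.set .p (i * I.n + I.tp j)).set .a (I.ta j)).set .q (i * I.n + I.tq j) with hσ₀
  have hF₀ : I.Fixed ρ σ₀ := hF.of_eq
    (by rintro r (rfl | rfl | rfl | rfl | rfl) <;> simp [hσ₀]) (fun _ _ => rfl)
  have hG₀ : GraphRep I.sink Γ σ₀ := by
    constructor
    · simpa [hσ₀] using h.graph
    · simpa [hσ₀] using h.adjIn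
    · simpa [hσ₀] using h.adjOut
  have p0 : σ₀.reg .p = i * I.n + I.tp j := by simp [hσ₀]
  have a0 : σ₀.reg .a = I.ta j := by simp [hσ₀]
  have q0 : σ₀.reg .q = i * I.n + I.tq j := by simp [hσ₀]
  have l0 : σ₀.reg .layer = i := by simpa [hσ₀] using hl
  have bs0 : σ₀.reg .base = i * I.n := by simpa [hσ₀] using hb
  have w0 : σ₀.reg .wl = I.letter i := by simpa [hσ₀] using hw
  have j0 : σ₀.reg .j = j := by simpa [hσ₀] using hj'
  have E0 : σ₀.reg .nE ≤ B := by simpa [hσ₀] using hE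
  have tk0 : σ₀.ticks = T := by simpa [hσ₀] using ht
  clear_value σ₀
  rw [wp_seq]
  refine wp_emitIf (p := I.ta j = 0 ∨ I.Stay fl i) (va := i * I.n + I.tp j)
    (vb := i * I.n + I.tq j) (vl := I.ta j) (by omega) (by omega) (by omega) hG₀ ?_ ?_ trivial p0
    (fun x => ⟨trivial, by simpa using q0⟩) (fun x y => ⟨trivial, by simpa using a0⟩)
    (fun _ => by omega) ?_
  · have g1 := ev_eq_le_one σ₀ ◇.a (.lit 0)
    have g2 := Nat.mul_le_mul b2 (ev_eq_le_one σ₀ ◇.layer (.lit 0))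
    have g3 := Nat.mul_le_mul b3 (ev_eq_le_one σ₀ ◇.layer ◇.k)
    simp only [ok_add, ok_mul, ok_eq, ok_var, ok_lit, ev_mul, ev_add, ev_lit, true_and]
    refine ⟨by omega, ⟨⟨by omega, ⟨by omega, by omega, ?_⟩, ?_⟩, ⟨by omega, ?_⟩, ?_⟩, ?_⟩ <;>
      omega
  · simp only [ev_mul, ev_add, ev_eq, ev_lit, ev_var, a0, l0, hF₀.k, Inst.Stay]
    cases fl.middle <;> cases fl.first <;> cases fl.last <;> by_cases g1 : I.ta j = 0 <;>
      by_cases g2 : i = 0 <;> by_cases g3 : i = I.k <;> simp [g1, g2, g3]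
  intro σ₁ hG₁ r₁ E₁ tk₁ f₁
  have hF₁ : I.Fixed ρ σ₁ := hF₀.of_eq
    (by rintro r (rfl | rfl | rfl | rfl | rfl) <;> exact r₁ _ rfl) f₁
  have p1 : σ₁.reg .p = i * I.n + I.tp j := by rw [r₁ _ rfl, p0]
  have a1 : σ₁.reg .a = I.ta j := by rw [r₁ _ rfl, a0]
  have q1 : σ₁.reg .q = i * I.n + I.tq j := by rw [r₁ _ rfl, q0]
  have l1 : σ₁.reg .layer = i := by rw [r₁ _ rfl, l0]
  have w1 : σ₁.reg .wl = I.letter i := by rw [r₁ _ rfl, w0]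
  rw [wp_seq]
  refine wp_emitIf (p := I.ta j ≠ 0 ∧ I.ta j = I.letter i) (va := i * I.n + I.tp j)
    (vb := i * I.n + I.tq j + I.n) (vl := I.ta j) (by omega) (by omega) (by omega) hG₁ ?_ ?_ trivial
    p1 (fun x => ?_) (fun x y => ⟨trivial, by simpa using a1⟩) ?_ ?_
  · have := Nat.mul_le_mul (ev_lt_le_one σ₁ (.lit 0) ◇.a) (ev_eq_le_one σ₁ ◇.a ◇.wl)
    exact ⟨(ok_lt _ _ _).2 ⟨(ok_lit _ _).2 (by omega), trivial⟩, (ok_eq _ _ _).2 ⟨trivial, trivial⟩,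
      this.trans_lt (by omega)⟩
  · simp only [ev_mul, ev_lt, ev_eq, ev_lit, ev_var, a1, w1]
    by_cases g1 : I.ta j = 0 <;> by_cases g2 : I.ta j = I.letter i <;>
      simp [g1, g2, Nat.pos_iff_ne_zero]
  · simp only [ok_add, ok_var, ev_add, ev_var, ne_eq, reduceCtorEq, not_false_eq_true,
      St.set_reg_of_ne, q1, hF₁.n]
    exact ⟨⟨trivial, trivial, by omega⟩, trivial⟩
  · rintro ⟨g1, g2⟩
    have hik : i < I.k := by
      by_contra hik
      rw [Inst.letter, if_neg hik] at g2
      exact g1 g2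
    have := I.layer_le' hik
    omega
  intro σ₂ hG₂ r₂ E₂ tk₂ f₂
  have hF₂ : I.Fixed ρ σ₂ := hF₁.of_eq
    (by rintro r (rfl | rfl | rfl | rfl | rfl) <;> exact r₂ _ rfl) f₂
  have p2 : σ₂.reg .p = i * I.n + I.tp j := by rw [r₂ _ rfl, p1]
  have l2 : σ₂.reg .layer = i := by rw [r₂ _ rfl, l1]
  rw [wp_seq]
  refine wp_emitIf (p := fl.skip = true ∧ i < I.k) (va := i * I.n + I.tp j)
    (vb := i * I.n + I.tp j + I.n) (vl := 0) (by omega) (by omega) (by omega) hG₂ ?_ ?_ trivial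
    p2 (fun x => ?_) (fun x y => ⟨(ok_lit _ _).2 (by omega), rfl⟩) ?_ ?_
  · have := Nat.mul_le_mul b4 (ev_lt_le_one σ₂ ◇.layer ◇.k)
    exact ⟨(ok_lit _ _).2 (by omega), (ok_lt _ _ _).2 ⟨trivial, trivial⟩, this.trans_lt (by omega)⟩
  · simp only [ev_mul, ev_lt, ev_lit, ev_var, l2, hF₂.k]
    cases fl.skip <;> by_cases g1 : i < I.k <;> simp [g1]
  · simp only [ok_add, ok_var, ev_add, ev_var, ne_eq, reduceCtorEq, not_false_eq_true,
      St.set_reg_of_ne, p2, hF₂.n]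
    exact ⟨⟨trivial, trivial, by omega⟩, trivial⟩
  · rintro ⟨-, hik⟩
    have := I.layer_le' hik
    omega
  intro σ₃ hG₃ r₃ E₃ tk₃ f₃
  have hF₃ : I.Fixed ρ σ₃ := hF₂.of_eq
    (by rintro r (rfl | rfl | rfl | rfl | rfl) <;> exact r₃ _ rfl) f₃
  have j3 : σ₃.reg .j = j := by rw [r₃ _ rfl, r₂ _ rfl, r₁ _ rfl, j0]
  simp only [wp_assign, ok_add, ok_var, ok_lit, ev_add, ev_var, ev_lit, true_and, j3]
  refine ⟨by omega, ⟨?_, ?_, ?_⟩, ?_, ?_, ?_, ?_, ?_, ?_, ?_⟩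
  · rw [Inst.trans, ← Set.union_assoc, ← Set.union_assoc]
    simpa using hG₃.graph
  · simpa using hG₃.adjIn
  · simpa using hG₃.adjOut
  · exact hF₃.of_eq (by rintro r (rfl | rfl | rfl | rfl | rfl) <;> simp) (fun _ _ => rfl)
  · simp [r₃ .layer rfl, l2]
  · simp [r₃ .base rfl, r₂ .base rfl, r₁ .base rfl, bs0]
  · simp [r₃ .wl rfl, r₂ .wl rfl, w1]
  · simp
  · simp; omega
  · simp [tk₃, tk₂, tk₁, tk0]

end

section

variable {M S V : ℕ} {Γ : Set (ℕ × ℕ × ℕ)} {σ : St} {Q : St → Prop} {I : Inst} {fl : Flags}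

/-- A layer contributes at most two edges and three for each transition, in `m` rounds. -/
theorem wp_layerStep {ρ : St} {i B T : ℕ} (hI : I.Valid) (hS : I.Fits M S) (hi : i ≤ I.k)
    (h : GraphRep I.sink Γ σ) (hF : I.Fixed ρ σ) (hl : σ.reg .layer = i)
    (hb : σ.reg .base = i * I.n) (hE : σ.reg .nE ≤ B) (hB : B + (3 * I.m + 2) < S)
    (ht : σ.ticks ≤ T) :
    wp M S (layerStep fl) (fun σ' =>
      GraphRep I.sink (Γ ∪ {x | x ∈ I.ends fl i ∨ ∃ j < I.m, x ∈ I.trans fl i j}) σ' ∧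
      I.Fixed ρ σ' ∧ σ'.reg .layer = i + 1 ∧ σ'.reg .base = (i + 1) * I.n ∧
      σ'.reg .nE ≤ B + (3 * I.m + 2) ∧ σ'.ticks ≤ T + I.m) σ := by
  have hS' := hS
  obtain ⟨hS1, hS2, hS3, hS4⟩ := hS
  have hM1 : Fact (1 < M) := ⟨by omega⟩
  have hlay := I.layer_le hi
  have hsink : I.sink = (I.k + 1) * I.n + 2 := rfl
  have hsource : I.source = (I.k + 1) * I.n + 1 := rfl
  have hbool : ∀ b : Bool, b.toNat ≤ 1 := fun b => by cases b <;> simp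
  have b1 := hbool fl.start
  have b2 := hbool fl.finish
  have i1 := hI.ini_pos
  have i2 := hI.ini_le
  have i3 := hI.acc_pos
  have i4 := hI.acc_le
  rw [layerStep, wp_seq, wp_assign, wp_seq, wp_ite]
  suffices key : ∀ σ₁ : St, GraphRep I.sink Γ σ₁ → I.Fixed ρ σ₁ → σ₁.reg .layer = i →
      σ₁.reg .base = i * I.n → σ₁.reg .wl = I.letter i → σ₁.reg .nE ≤ B → σ₁.ticks ≤ T →
      wp M S (emitIf (.lit fl.start.toNat + (◇.layer).eq (.lit 0)) ◇.s
        (◇.base + .get .inp (.lit 2)) (.lit 0) ;;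
        emitIf (.lit fl.finish.toNat + (◇.layer).eq ◇.k) (◇.base + .get .inp (.lit 3)) ◇.t
          (.lit 0) ;;
        .j ≔ .lit 0 ;; .while ((◇.j).lt ◇.m) (transStep fl) ;; .base ≔ ◇.base + ◇.n ;;
        .layer ≔ ◇.layer + .lit 1) (fun σ' =>
      GraphRep I.sink (Γ ∪ {x | x ∈ I.ends fl i ∨ ∃ j < I.m, x ∈ I.trans fl i j}) σ' ∧
      I.Fixed ρ σ' ∧ σ'.reg .layer = i + 1 ∧ σ'.reg .base = (i + 1) * I.n ∧
      σ'.reg .nE ≤ B + (3 * I.m + 2) ∧ σ'.ticks ≤ T + I.m) σ₁ by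
    have hset : ∀ x y, GraphRep I.sink Γ ((σ.set .wl x).set .wl y) := fun x y =>
      ⟨by simpa using h.graph, by simpa using h.adjIn, by simpa using h.adjOut⟩
    have hset' : ∀ x, GraphRep I.sink Γ (σ.set .wl x) := fun x =>
      ⟨by simpa using h.graph, by simpa using h.adjIn, by simpa using h.adjOut⟩
    have hcond : Ex.ev (σ.set .wl 0) ((◇.layer).lt ◇.k) ≠ 0 ↔ i < I.k := by
      simp [hl, hF.k]
    refine ⟨(ok_lit _ _).2 (by omega), (ok_lt _ _ _).2 ⟨trivial, trivial⟩, fun h0 => ?_,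
      fun h0 => ?_⟩
    · have hik := hcond.1 h0
      rw [wp_assign]
      have hwd := hF.holds.wd i hik
      simp only [ok_add, ok_get, ok_var, ok_lit, ev_add, ev_get, ev_var, ev_lit, St.set_fld,
        St.set_reg_of_ne, ne_eq, reduceCtorEq, not_false_eq_true, hF.m, hl, true_and]
      refine ⟨by omega, key _ (hset _ _) (hF.of_eq ?_ fun _ _ => rfl) ?_ ?_ ?_ ?_ ?_⟩
      · rintro r (rfl | rfl | rfl | rfl | rfl) <;> simp
      · simpa using hl
      · simpa using hb
      · simp [Inst.letter, hik, hwd]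
      · simpa using hE
      · simpa using ht
    · have hik : ¬i < I.k := fun hc => hcond.2 hc h0
      rw [wp_skip]
      refine key _ (hset' _) (hF.of_eq ?_ fun _ _ => rfl) ?_ ?_ ?_ ?_ ?_
      · rintro r (rfl | rfl | rfl | rfl | rfl) <;> simp
      · simpa using hl
      · simpa using hb
      · simp [Inst.letter, hik]
      · simpa using hE
      · simpa using ht
  clear h hF hl hb hE ht
  intro σ₁ hG₁ hF₁ l1 bs1 w1 E1 tk1
  rw [wp_seq]
  refine wp_emitIf (p := fl.start = true ∨ i = 0) (va := I.source) (vb := i * I.n + I.ini)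
    (vl := 0) (by omega) (by omega) (by omega) hG₁ ?_ ?_ trivial hF₁.s (fun x => ?_)
    (fun x y => ⟨(ok_lit _ _).2 (by omega), rfl⟩) (fun _ => by omega) ?_
  · have := ev_eq_le_one σ₁ ◇.layer (.lit 0)
    exact ⟨(ok_lit _ _).2 (by omega), (ok_eq _ _ _).2 ⟨trivial, (ok_lit _ _).2 (by omega)⟩,
      (Nat.add_le_add b1 this).trans_lt (by omega)⟩
  · simp only [ev_add, ev_eq, ev_lit, ev_var, l1]
    cases fl.start <;> by_cases g : i = 0 <;> simp [g]
  · simp only [ok_add, ok_get, ok_var, ok_lit, ev_add, ev_get, ev_var, ev_lit, St.set_fld, ne_eq,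
      reduceCtorEq, not_false_eq_true, St.set_reg_of_ne, bs1, hF₁.holds.ini, true_and, and_true]
    omega
  intro σ₂ hG₂ r₂ E₂ tk₂ f₂
  have hF₂ : I.Fixed ρ σ₂ := hF₁.of_eq
    (by rintro r (rfl | rfl | rfl | rfl | rfl) <;> exact r₂ _ rfl) f₂
  have l2 : σ₂.reg .layer = i := by rw [r₂ _ rfl, l1]
  have bs2 : σ₂.reg .base = i * I.n := by rw [r₂ _ rfl, bs1]
  have w2 : σ₂.reg .wl = I.letter i := by rw [r₂ _ rfl, w1]
  rw [wp_seq]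
  refine wp_emitIf (p := fl.finish = true ∨ i = I.k) (va := i * I.n + I.acc) (vb := I.sink)
    (vl := 0) (by omega) (by omega) (by omega) hG₂ ?_ ?_ ?_ ?_ (fun x => ⟨trivial, ?_⟩)
    (fun x y => ⟨(ok_lit _ _).2 (by omega), rfl⟩) (fun _ => by omega) ?_
  · have := ev_eq_le_one σ₂ ◇.layer ◇.k
    exact ⟨(ok_lit _ _).2 (by omega), (ok_eq _ _ _).2 ⟨trivial, trivial⟩,
      (Nat.add_le_add b2 this).trans_lt (by omega)⟩
  · simp only [ev_add, ev_eq, ev_lit, ev_var, l2, hF₂.k]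
    cases fl.finish <;> by_cases g : i = I.k <;> simp [g]
  · simp only [ok_add, ok_get, ok_var, ok_lit, ev_get, ev_var, ev_lit, bs2, hF₂.holds.acc,
      true_and]
    omega
  · simp [bs2, hF₂.holds.acc]
  · simpa using hF₂.t
  intro σ₃ hG₃ r₃ E₃ tk₃ f₃
  have hF₃ : I.Fixed ρ σ₃ := hF₂.of_eq
    (by rintro r (rfl | rfl | rfl | rfl | rfl) <;> exact r₃ _ rfl) f₃
  rw [wp_seq, wp_assign, wp_seq]
  refine ⟨(ok_lit _ _).2 (by omega), wp_while (fun τ => ∃ j ≤ I.m,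
      GraphRep I.sink (Γ ∪ {x | x ∈ I.ends fl i ∨ ∃ j' < j, x ∈ I.trans fl i j'}) τ ∧
      I.Fixed ρ τ ∧ τ.reg .layer = i ∧ τ.reg .base = i * I.n ∧ τ.reg .wl = I.letter i ∧
      τ.reg .j = j ∧ τ.reg .nE ≤ B + 2 + 3 * j ∧ τ.ticks ≤ T + j) (T + I.m) ?_ ?_ ?_ ?_ ?_⟩
  · refine ⟨0, Nat.zero_le _, ⟨?_, ?_, ?_⟩, hF₃.of_eq ?_ (fun _ _ => rfl), ?_, ?_, ?_, ?_, ?_, ?_⟩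
    · simp only [not_lt_zero, false_and, exists_false, or_false, Set.ofPred_mem_eq, Inst.ends]
      rw [← Set.union_assoc]
      simpa using hG₃.graph
    · simpa using hG₃.adjIn
    · simpa using hG₃.adjOut
    · rintro r (rfl | rfl | rfl | rfl | rfl) <;> simp
    · simp [r₃ .layer rfl, l2]
    · simp [r₃ .base rfl, bs2]
    · simp [r₃ .wl rfl, w2]
    · simp
    · simp
      omega
    · simp [tk₃, tk₂, tk1]
  · rintro τ ⟨j, hj, -, -, -, -, -, -, -, h1⟩
    omega
  · intro τ _
    exact (ok_lt _ _ _).2 ⟨trivial, trivial⟩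
  · rintro τ ⟨j, hj, g1, g2, g3, g4, g5, g6, g7, g8⟩ hc
    have hjm : j < I.m := by simpa [g6, g2.m] using hc
    refine (wp_transStep (σ := τ.tick) (B := B + 2 + 3 * j) (T := τ.ticks + 1) hI hS' hi hjm
      ⟨g1.graph, g1.adjIn, g1.adjOut⟩ (g2.of_eq (fun _ _ => rfl) fun _ _ => rfl) g3 g4 g5 g6 g7
      (by omega) rfl).mono ?_
    rintro τ' ⟨a1, a2, a3, a4, a5, a6, a7, a8⟩
    refine ⟨j + 1, hjm, ?_, a2, a3, a4, a5, a6, by omega, by omega⟩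
    convert a1 using 1
    rw [Set.union_assoc]
    congr 1
    ext x
    simp only [Nat.lt_succ_iff_lt_or_eq, Set.mem_ofPred_eq, Set.mem_union, or_and_right, exists_or,
      exists_eq_left, or_assoc]
  · rintro τ ⟨j, hj, g1, g2, g3, g4, g5, g6, g7, g8⟩ hc
    have hjm : j = I.m := by
      have : ¬j < I.m := by simpa [g6, g2.m] using hc
      omega
    subst hjm
    simp only [wp_seq, wp_assign, ok_add, ok_var, ok_lit, ev_add, ev_var, ev_lit, true_and, ne_eq,
      reduceCtorEq, not_false_eq_true, St.set_reg_of_ne, g3, g4, g2.n]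
    refine ⟨by omega, ⟨by omega, ?_⟩, ⟨?_, ?_, ?_⟩, g2.of_eq ?_ (fun _ _ => rfl), ?_, ?_, ?_, ?_⟩
    · have : I.k ≤ S := by omega
      omega
    · simpa using g1.graph
    · simpa using g1.adjIn
    · simpa using g1.adjOut
    · rintro r (rfl | rfl | rfl | rfl | rfl) <;> simp
    · simp
    · simp [Nat.succ_mul]
    · simpa [add_assoc, add_comm] using g7
    · simpa using g8

theorem wp_clearStep [hM : Fact (1 < M)] {j : ℕ} (hj : σ.reg .j = j) (hjS : j < S) (hS : S < M)
    (hQ : ∀ σ', (∀ r, r ≠ .j → σ'.reg r = σ.reg r) → σ'.reg .j = j + 1 → σ'.ticks = σ.ticks →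
      σ'.fld .inp = σ.fld .inp →
      (∀ f, f = .hIn ∨ f = .hOut ∨ f = .comp ∨ f = .col ∨ f = .val ∨ f = .inf ∨ f = .ch →
        σ'.fld f = Function.update (σ.fld f) j 0) → Q σ') :
    wp M S clearStep Q σ := by
  have := hM.out
  simp only [clearStep, wp_seq, wp_store, wp_assign, ok_var, ok_lit, ok_add, ev_var, ev_lit, ev_add,
    St.put_reg, hj, true_and]
  refine ⟨by omega, hjS, by omega, hjS, by omega, hjS, by omega, hjS, by omega, hjS, by omega, hjS,
    by omega, hjS, by omega, hQ _ ?_ ?_ ?_ ?_ ?_⟩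
  · intro r hr
    simp [hr]
  · simp
  · simp
  · simp
  · rintro f (rfl | rfl | rfl | rfl | rfl | rfl | rfl) <;> simp

/-- The graph without edges. -/
theorem GraphRep.empty {V : ℕ} {σ : St} (hE : σ.reg .nE = 0) (h1 : ∀ v ≤ V, σ.fld .hIn v = 0)
    (h2 : ∀ v ≤ V, σ.fld .hOut v = 0) : GraphRep V ∅ σ := by
  refine ⟨?_, ?_, ?_⟩
  · constructor <;> first | (intros; omega) | simp
  all_goals
    rw [hE]
    constructor <;> intro v hv <;> first | omega | simp [h1 v hv, h2 v hv]

/-- The construction of the product graph is correct, with a number of edges and of rounds in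
`O((k + 1) (m + 1) + (k + 1) n)`. -/
theorem wp_build {ρ : St} (hI : I.Valid) (hS : I.Fits M S) (hH : I.Holds ρ) :
    wp M S (build fl) (fun σ => GraphRep I.sink (I.graph fl) σ ∧ σ.reg .s = I.source ∧
      σ.reg .t = I.sink ∧ σ.reg .nE ≤ (I.k + 1) * (3 * I.m + 2) ∧
      (∀ v ≤ I.sink, σ.fld .comp v = 0) ∧ (∀ v ≤ I.sink, σ.fld .col v = 0) ∧
      (∀ v ≤ I.sink, σ.fld .val v = 0) ∧ (∀ v ≤ I.sink, σ.fld .inf v = 0) ∧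
      (∀ v ≤ I.sink, σ.fld .ch v = 0) ∧
      σ.ticks ≤ ρ.ticks + (I.sink + 1) + (I.k + 1) * (I.m + 1)) ρ := by
  have hS' := hS
  obtain ⟨hS1, hS2, hS3, hS4⟩ := hS
  have hM1 : Fact (1 < M) := ⟨by omega⟩
  have hsink : I.sink = (I.k + 1) * I.n + 2 := rfl
  have hsource : I.source = (I.k + 1) * I.n + 1 := rfl
  simp only [build, wp_seq (p := Cmd.assign _ _), wp_assign, ok_add, ok_mul, ok_get, ok_var, ok_lit,
    ev_add, ev_mul, ev_get, ev_var, ev_lit, ne_eq, reduceCtorEq, not_false_eq_true,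
    St.set_reg_of_ne, St.set_reg_self, St.set_fld, hH.n, hH.m, hH.k, true_and]
  refine ⟨by omega, by omega, by omega, ⟨⟨⟨by omega, by omega⟩, by omega⟩, by omega, by omega⟩,
    ⟨by omega, by omega⟩, by omega, ?_⟩
  rw [wp_seq]
  refine wp_while (fun τ => ∃ j ≤ I.sink + 1, I.Holds τ ∧ τ.reg .n = I.n ∧ τ.reg .m = I.m ∧
    τ.reg .k = I.k ∧ τ.reg .s = I.source ∧ τ.reg .t = I.sink ∧ τ.reg .j = j ∧
    τ.ticks = ρ.ticks + j ∧ ∀ f, f = .hIn ∨ f = .hOut ∨ f = .comp ∨ f = .col ∨ f = .val ∨ f = .inf ∨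
      f = .ch → ∀ v < j, τ.fld f v = 0) (ρ.ticks + (I.sink + 1)) ?_ ?_ ?_ ?_ ?_
  · refine ⟨0, Nat.zero_le _, ?_, ?_, ?_, ?_, ?_, ?_, ?_, ?_, ?_⟩
    · exact ⟨hH.n, hH.ini, hH.acc, hH.m, hH.k, hH.tp, hH.ta, hH.tq, hH.wd⟩
    all_goals simp [hsink, hsource]
  · rintro τ ⟨j, hj, -, -, -, -, -, -, -, h, -⟩
    omega
  · rintro τ ⟨j, hj, -, -, -, -, -, h, -, -⟩
    simp only [ok_lt, ok_var, ok_add, ok_lit, ev_var, ev_lit, h, true_and]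
    omega
  · rintro τ ⟨j, hj, h0, h1, h2, h3, h4, h5, h6, h7, h8⟩ hc
    have hjs : j < I.sink + 1 := by simpa [h5, h6] using hc
    refine wp_clearStep (j := j) h6 (by omega) (by omega) ?_
    intro τ' r1 r2 r3 r4 r5
    refine ⟨j + 1, hjs, ?_, ?_, ?_, ?_, ?_, ?_, r2, ?_, ?_⟩
    · constructor <;> rw [r4, St.tick_fld]
      exacts [h0.n, h0.ini, h0.acc, h0.m, h0.k, h0.tp, h0.ta, h0.tq, h0.wd]
    · rw [r1 _ (by simp), St.tick_reg, h1]
    · rw [r1 _ (by simp), St.tick_reg, h2]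
    · rw [r1 _ (by simp), St.tick_reg, h3]
    · rw [r1 _ (by simp), St.tick_reg, h4]
    · rw [r1 _ (by simp), St.tick_reg, h5]
    · rw [r3, St.tick_ticks, h7]
      omega
    · intro f hf v hv
      rw [r5 f hf]
      by_cases hvj : v = j
      · simp [hvj]
      · simpa [hvj] using h8 f hf v (by omega)
  · rintro τ ⟨j, hj, h0, h1, h2, h3, h4, h5, h6, h7, h8⟩ hc
    have hjs : j = I.sink + 1 := by
      have : ¬j < I.sink + 1 := by simpa [h5, h6] using hc
      omega
    subst hjs
    have hz : ∀ f, f = .hIn ∨ f = .hOut ∨ f = .comp ∨ f = .col ∨ f = .val ∨ f = .inf ∨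
      f = .ch → ∀ v ≤ I.sink, τ.fld f v = 0 := fun f hf v hv => h8 f hf v (by omega)
    rw [wp_seq, wp_assign, wp_seq, wp_assign, wp_seq, wp_assign]
    refine ⟨(ok_lit _ _).2 (by omega), (ok_lit _ _).2 (by omega), (ok_lit _ _).2 (by omega), ?_⟩
    refine wp_while (fun σ => ∃ i ≤ I.k + 1,
      GraphRep I.sink {x | ∃ i' < i, x ∈ I.ends fl i' ∨ ∃ j < I.m, x ∈ I.trans fl i' j} σ ∧
      I.Fixed τ σ ∧ σ.reg .layer = i ∧ σ.reg .base = i * I.n ∧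
      σ.reg .nE ≤ i * (3 * I.m + 2) ∧ σ.ticks ≤ ρ.ticks + (I.sink + 1) + i * (I.m + 1))
      (ρ.ticks + (I.sink + 1) + (I.k + 1) * (I.m + 1)) ?_ ?_ ?_ ?_ ?_
    · refine ⟨0, Nat.zero_le _, ?_, ?_, ?_, ?_, ?_, ?_⟩
      · simp only [not_lt_zero, false_and, exists_false]
        exact GraphRep.empty (by simp) (by simpa using hz .hIn (by simp))
          (by simpa using hz .hOut (by simp))
      · constructor
        · exact ⟨h0.n, h0.ini, h0.acc, h0.m, h0.k, h0.tp, h0.ta, h0.tq, h0.wd⟩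
        all_goals simp [h1, h2, h3, h4, h5]
      all_goals simp [h7]
    · rintro σ ⟨i, hi, -, -, -, -, -, h⟩
      have := Nat.mul_le_mul_right (I.m + 1) hi
      omega
    · rintro σ ⟨i, hi, -, hF, -⟩
      simp only [ok_lt, ok_var, ok_add, ok_lit, ev_var, ev_lit, hF.k, true_and]
      omega
    · rintro σ ⟨i, hi, g1, g2, g3, g4, g5, g6⟩ hc
      have hik : i < I.k + 1 := by simpa [g3, g2.k] using hc
      have e1 := Nat.mul_le_mul_right (3 * I.m + 2) hik
      have e2 := Nat.succ_mul i (3 * I.m + 2)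
      have e3 := Nat.succ_mul i (I.m + 1)
      refine (wp_layerStep (σ := σ.tick) (B := i * (3 * I.m + 2)) (T := σ.ticks + 1) hI hS'
        (Nat.lt_succ_iff.1 hik) ⟨g1.graph, g1.adjIn, g1.adjOut⟩
        (g2.of_eq (fun _ _ => rfl) fun _ _ => rfl) g3 g4 g5 ?_ le_rfl).mono ?_
      · rw [Nat.succ_eq_add_one] at e1 e2
        omega
      · rintro σ' ⟨a1, a2, a3, a4, a5, a6⟩
        refine ⟨i + 1, hik, ?_, a2, a3, a4, ?_, ?_⟩
        · convert a1 using 1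
          ext x
          simp only [Nat.lt_succ_iff_lt_or_eq, Set.mem_ofPred_eq, Set.mem_union, or_and_right,
            exists_or, exists_eq_left]
        · rwa [← e2] at a5
        · rw [Nat.succ_eq_add_one] at e3
          omega
    · rintro σ ⟨i, hi, g1, g2, g3, g4, g5, g6⟩ hc
      have hik : i = I.k + 1 := by
        have : ¬i < I.k + 1 := by simpa [g3, g2.k] using hc
        omega
      subst hik
      refine ⟨?_, g2.s, g2.t, g5, ?_, ?_, ?_, ?_, ?_, g6⟩
      · simpa only [Inst.graph, Nat.lt_succ_iff] using g1
      all_goals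
        rw [g2.fld _ rfl]
        exact hz _ (by simp)

end

end QuantMatch

/-! ### Walks in the product graph and candidates -/

namespace QuantMatch

/-- The properties of the string relations. -/
def flags : StringRel → Flags
  | .isInfix => ⟨true, true, false, false, false, false⟩
  | .isPrefix => ⟨false, true, false, false, false, false⟩
  | .extension => ⟨false, false, true, false, true, false⟩
  | .leftExtension => ⟨false, false, true, false, false, false⟩
  | .subsequence => ⟨true, true, false, false, false, true⟩
  | .supersequence => ⟨false, false, true, true, true, false⟩

section Matching

variable {α : Type*} (fl : Flags) (w : List α)

/-- `Matches fl w i u`: the string `u` can be matched with the part of `w` from position `i` on. -/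
inductive Matches : ℕ → List α → Prop
  | finish {i} : fl.finish = true ∨ i = w.length → Matches i []
  | stay {i u} (a : α) : (fl.middle = true ∨ (fl.first = true ∧ i = 0) ∨
      (fl.last = true ∧ i = w.length)) → Matches i u → Matches i (a :: u)
  | advance {i u a} : w[i]? = some a → Matches (i + 1) u → Matches i (a :: u)
  | skip {i u} : fl.skip = true → i < w.length → Matches (i + 1) u → Matches i u

variable {fl w}

theorem drop_eq_cons {i : ℕ} {a : α} (h : w[i]? = some a) : w.drop i = a :: w.drop (i + 1) := by
  obtain ⟨hi, rfl⟩ := List.getElem?_eq_some_iff.1 h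
  exact List.drop_eq_getElem_cons hi

theorem of_drop_eq_cons {i : ℕ} {a : α} {y : List α} (h : w.drop i = a :: y) :
    w[i]? = some a ∧ w.drop (i + 1) = y := by
  have h1 : w[i]? = some a := by
    have := List.getElem?_drop (xs := w) (i := i) (j := 0)
    rw [h] at this
    simpa using this.symm
  refine ⟨h1, ?_⟩
  rw [drop_eq_cons h1] at h
  exact (List.cons.inj h).2

theorem Matches.stay_append {i : ℕ} (x : List α) {v : List α}
    (h : fl.middle = true ∨ (fl.first = true ∧ i = 0) ∨ (fl.last = true ∧ i = w.length))
    (hv : Matches fl w i v) : Matches fl w i (x ++ v) := by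
  induction x with
  | nil => exact hv
  | cons a x ih => exact .stay a h ih

theorem Matches.advance_append {x y v : List α} : ∀ {i : ℕ}, w.drop i = x ++ y →
    Matches fl w (i + x.length) v → Matches fl w i (x ++ v) := by
  induction x with
  | nil => exact fun _ hv => hv
  | cons a x ih =>
    intro i h hv
    obtain ⟨h1, h2⟩ := of_drop_eq_cons h
    refine .advance h1 (ih h2 ?_)
    rwa [show i + 1 + x.length = i + (a :: x).length by rw [List.length_cons]; omega]

theorem Matches.of_sublist (h1 : fl.skip = true) (h2 : fl.finish = true) {u y : List α}
    (h : u.Sublist y) : ∀ {i : ℕ}, w.drop i = y → Matches fl w i u := by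
  induction h with
  | slnil => exact fun _ => .finish (.inl h2)
  | cons a _ ih =>
    intro i hi
    obtain ⟨h3, h4⟩ := of_drop_eq_cons hi
    exact .skip h1 (List.getElem?_eq_some_iff.1 h3).1 (ih h4)
  | cons_cons a _ ih =>
    intro i hi
    obtain ⟨h3, h4⟩ := of_drop_eq_cons hi
    exact .advance h3 (ih h4)

theorem Matches.of_supersequence (h1 : fl.middle = true) {u y : List α} (h : y.Sublist u) :
    ∀ {i : ℕ}, i ≤ w.length → w.drop i = y → Matches fl w i u := by
  induction h with
  | slnil =>
    intro i hi h
    exact .finish (.inr (le_antisymm hi (List.drop_eq_nil_iff.1 h)))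
  | cons a _ ih => exact fun hi h => .stay a (.inl h1) (ih hi h)
  | cons_cons a _ ih =>
    intro i _ hi
    obtain ⟨h3, h4⟩ := of_drop_eq_cons hi
    exact .advance h3 (ih (List.getElem?_eq_some_iff.1 h3).1 h4)

/-- What it means, for each of the relations, that a string can be matched with the part of the
word from position `i` on. -/
def Rest (w : List α) : StringRel → ℕ → List α → Prop
  | .isInfix, i, u => u <+: w.drop i
  | .isPrefix, i, u => u <+: w.drop i
  | .extension, i, u => ∃ v v', (i ≠ 0 → v = []) ∧ u = v ++ w.drop i ++ v'
  | .leftExtension, i, u => ∃ v, (i ≠ 0 → v = []) ∧ u = v ++ w.drop i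
  | .subsequence, i, u => u.Sublist (w.drop i)
  | .supersequence, i, u => (w.drop i).Sublist u

/-- The part of the word from position `i` on is related to every string that can be matched with
it. -/
theorem Matches.rest {rel : StringRel} {i : ℕ} {u : List α} (h : Matches (flags rel) w i u) :
    Rest w rel i u := by
  induction h with
  | finish h =>
    cases rel <;> simp_all [flags, Rest]
  | @stay i u a h _ ih =>
    cases rel <;> simp [flags] at h
    · obtain ⟨v, v', h1, h2⟩ := ih
      rcases h with rfl | rfl
      · exact ⟨a :: v, v', by simp, by simp [h2]⟩
      · by_cases h0 : w.length = 0
        · exact ⟨a :: v, v', by simp [h0], by simp [h2]⟩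
        · exact ⟨[], a :: u, by simp, by simp⟩
    · obtain ⟨v, h1, h2⟩ := ih
      subst h
      exact ⟨a :: v, by simp, by simp [h2]⟩
    · exact ih.cons a
  | @advance i u a h _ ih =>
    cases rel <;> simp only [Rest, drop_eq_cons h] at ih ⊢
    · exact List.cons_prefix_cons.2 ⟨rfl, ih⟩
    · exact List.cons_prefix_cons.2 ⟨rfl, ih⟩
    · obtain ⟨v, v', h1, h2⟩ := ih
      exact ⟨[], v', by simp, by simp [h2, h1]⟩
    · obtain ⟨v, h1, h2⟩ := ih
      exact ⟨[], by simp, by simp [h2, h1]⟩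
    · exact ih.cons_cons a
    · exact ih.cons_cons a
  | skip h1 h2 _ ih =>
    cases rel <;> simp [flags] at h1
    rw [Rest, List.drop_eq_getElem_cons h2]
    exact List.Sublist.cons _ ih

/-- The string relations in terms of matchings. -/
theorem holds_iff (rel : StringRel) (u : List α) : rel.Holds u w ↔
    ∃ i ≤ w.length, ((flags rel).start = true ∨ i = 0) ∧ Matches (flags rel) w i u := by
  constructor
  · cases rel
    · rintro ⟨v, v', rfl⟩
      refine ⟨v.length, by simp, .inl rfl, ?_⟩
      have := Matches.advance_append (fl := flags .isInfix) (w := v ++ u ++ v') (i := v.length)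
        (x := u) (y := v') (v := []) (by simp) (.finish (.inl rfl))
      simpa using this
    · rintro ⟨v, rfl⟩
      refine ⟨0, by simp, .inr rfl, ?_⟩
      have := Matches.advance_append (fl := flags .isPrefix) (w := u ++ v) (i := 0)
        (x := u) (y := v) (v := []) (by simp) (.finish (.inl rfl))
      simpa using this
    · rintro ⟨v, v', rfl⟩
      refine ⟨0, by simp, .inr rfl, ?_⟩
      rw [List.append_assoc]
      refine .stay_append v (.inr (.inl ⟨rfl, rfl⟩)) (.advance_append (y := []) (by simp) ?_)
      have := Matches.stay_append (fl := flags .extension) (w := w) (i := w.length) v' (v := [])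
        (.inr (.inr ⟨rfl, rfl⟩)) (.finish (.inr rfl))
      simpa using this
    · rintro ⟨v, rfl⟩
      refine ⟨0, by simp, .inr rfl, .stay_append v (.inr (.inl ⟨rfl, rfl⟩)) ?_⟩
      have := Matches.advance_append (fl := flags .leftExtension) (w := w) (i := 0)
        (x := w) (y := []) (v := []) (by simp) (.finish (.inr (by simp)))
      simpa using this
    · exact fun h => ⟨0, by simp, .inr rfl, .of_sublist rfl rfl h (by simp)⟩
    · exact fun h => ⟨0, by simp, .inr rfl, .of_supersequence rfl h (by simp) (by simp)⟩
  · rintro ⟨i, hi, h0, h⟩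
    have hr := h.rest
    cases rel <;> simp only [flags, Bool.false_eq_true, false_or] at h0 <;>
      simp only [Rest] at hr
    · obtain ⟨v', h'⟩ := hr
      exact ⟨w.take i, v', by rw [List.append_assoc, h', List.take_append_drop]⟩
    · obtain ⟨v', h'⟩ := hr
      subst h0
      exact ⟨v', by simpa using h'.symm⟩
    · obtain ⟨v, v', -, h'⟩ := hr
      subst h0
      exact ⟨v, v', by simpa using h'⟩
    · obtain ⟨v, -, h'⟩ := hr
      subst h0
      exact ⟨v, by simpa using h'⟩
    · exact List.Sublist.trans hr (List.drop_sublist _ _)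
    · subst h0
      rwa [List.drop_zero] at hr

end Matching

section Automaton

variable {A : EpsAutomaton} {l : List A.Transition} {w : List (Fin A.σ)} {fl : Flags}

/-- `Accepts A p u`: the string `u` labels a path from `p` to the final state. -/
inductive Accepts (A : EpsAutomaton) : Fin A.n → List (Fin A.σ) → Prop
  | nil : Accepts A A.final []
  | eps {p q u} : (p, none, q) ∈ A.δ → Accepts A q u → Accepts A p u
  | letter {p q a u} : (p, some a, q) ∈ A.δ → Accepts A q u → Accepts A p (a :: u)

/-- The accepted language in terms of paths labelled with strings. -/
theorem mem_language_iff {u : List (Fin A.σ)} : u ∈ A.language ↔ Accepts A A.init u := by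
  have h1 : ∀ p x', A.toεNFA.IsPath p A.final x' → Accepts A p x'.reduceOption := by
    intro p x' h
    generalize hf : A.final = f at h
    induction h with
    | nil => subst hf; exact .nil
    | cons t s f a x hm _ ih =>
      cases a with
      | none => exact .eps hm (ih hf)
      | some a => exact .letter hm (ih hf)
  have h2 : ∀ p u, Accepts A p u → ∃ x', x'.reduceOption = u ∧ A.toεNFA.IsPath p A.final x' := by
    intro p u h
    induction h with
    | nil => exact ⟨[], rfl, .nil _⟩
    | eps hm _ ih =>
      obtain ⟨x, rfl, hx⟩ := ih
      exact ⟨none :: x, rfl, .cons _ _ _ _ _ hm hx⟩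
    | letter hm _ ih =>
      obtain ⟨x, rfl, hx⟩ := ih
      exact ⟨some _ :: x, rfl, .cons _ _ _ _ _ hm hx⟩
  rw [EpsAutomaton.language, εNFA.mem_accepts_iff_exists_path]
  constructor
  · rintro ⟨s₁, s₂, x', rfl, rfl, rfl, h⟩
    exact h1 _ _ h
  · intro h
    obtain ⟨x', hx, h'⟩ := h2 _ _ h
    exact ⟨_, _, x', rfl, rfl, hx, h'⟩

/-- The number for a letter. -/
def letterCode {σ : ℕ} (a : Fin σ) : ℕ := a + 1

/-- The number for the label of a transition. -/
def labelCode {σ : ℕ} (a : Option (Fin σ)) : ℕ := a.elim 0 letterCode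

/-- The input as numbers. -/
def ofInput (A : EpsAutomaton) (l : List A.Transition) (w : List (Fin A.σ)) : Inst where
  n := A.n
  k := w.length
  m := l.length
  ini := A.init + 1
  acc := A.final + 1
  tp j := l[j]?.elim 0 fun x => x.1 + 1
  ta j := l[j]?.elim 0 fun x => labelCode x.2.1
  tq j := l[j]?.elim 0 fun x => x.2.2 + 1
  wd i := w[i]?.elim 0 letterCode

theorem ofInput_valid : (ofInput A l w).Valid := by
  constructor
  · simp [ofInput]
  · exact A.init.isLt
  · simp [ofInput]
  · exact A.final.isLt
  all_goals
    intro j (hj : j < l.length)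
    simp only [ofInput, List.getElem?_eq_getElem hj, Option.elim_some]
    omega

/-- The vertex of the product graph for state `p` in layer `i`. -/
def vertex (A : EpsAutomaton) (i : ℕ) (p : Fin A.n) : ℕ := i * A.n + (p + 1)

theorem vertex_succ (i : ℕ) (p : Fin A.n) : vertex A (i + 1) p =
    i * (ofInput A l w).n + (p + 1) + (ofInput A l w).n := by
  simp only [vertex, ofInput, Nat.succ_mul]
  omega

theorem vertex_inj {i i' : ℕ} {p p' : Fin A.n} (h : vertex A i p = vertex A i' p') :
    i = i' ∧ p = p' := by
  have hn : 0 < A.n := by have := p.isLt; omega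
  simp only [vertex, ← add_assoc, add_left_inj] at h
  have h1 := congrArg (· / A.n) h
  have h2 := congrArg (· % A.n) h
  simp only [Nat.mul_comm _ A.n, Nat.mul_add_div hn, Nat.div_eq_of_lt p.isLt,
    Nat.div_eq_of_lt p'.isLt, Nat.mul_add_mod, Nat.mod_eq_of_lt p.isLt,
    Nat.mod_eq_of_lt p'.isLt, add_zero] at h1 h2
  exact ⟨h1, Fin.ext h2⟩

/-- The vertices in the layers are numbered below the source and the sink. -/
theorem vertex_lt {i : ℕ} (hi : i ≤ w.length) (p : Fin A.n) :
    vertex A i p < (ofInput A l w).source := by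
  have h1 : i * A.n + A.n ≤ (w.length + 1) * A.n := (ofInput A l w).layer_le hi
  have h2 := p.isLt
  simp only [vertex, Inst.source, ofInput]
  omega

theorem letterCode_inj {σ : ℕ} {a b : Fin σ} (h : letterCode a = letterCode b) : a = b := by
  simpa [letterCode, Fin.ext_iff] using h

theorem letter_ofInput {i : ℕ} {a : Fin A.σ} :
    (ofInput A l w).letter i = letterCode a ↔ w[i]? = some a := by
  by_cases hi : i < w.length
  · have : (ofInput A l w).letter i = letterCode w[i] := by simp [Inst.letter, ofInput, hi]
    rw [this, List.getElem?_eq_getElem hi, Option.some.injEq]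
    exact ⟨letterCode_inj, fun h => by rw [h]⟩
  · simp [Inst.letter, ofInput, hi, letterCode]

/-- The edges of the product graph in terms of the automaton. -/
inductive Edge (A : EpsAutomaton) (w : List (Fin A.σ)) (fl : Flags) : ℕ → ℕ → ℕ → Prop
  | start {i} : i ≤ w.length → fl.start = true ∨ i = 0 →
      Edge A w fl ((w.length + 1) * A.n + 1) (vertex A i A.init) 0
  | finish {i} : i ≤ w.length → fl.finish = true ∨ i = w.length →
      Edge A w fl (vertex A i A.final) ((w.length + 1) * A.n + 2) 0
  | eps {i p q} : i ≤ w.length → (p, none, q) ∈ A.δ → Edge A w fl (vertex A i p) (vertex A i q) 0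
  | stay {i p q a} : i ≤ w.length → (p, some a, q) ∈ A.δ →
      (fl.middle = true ∨ (fl.first = true ∧ i = 0) ∨ (fl.last = true ∧ i = w.length)) →
      Edge A w fl (vertex A i p) (vertex A i q) (letterCode a)
  | advance {i p q a} : (p, some a, q) ∈ A.δ → w[i]? = some a →
      Edge A w fl (vertex A i p) (vertex A (i + 1) q) (letterCode a)
  | skip {i p a q} : (p, a, q) ∈ A.δ → fl.skip = true → i < w.length →
      Edge A w fl (vertex A i p) (vertex A (i + 1) p) 0

/-- The numerical description of the product graph agrees with the one by the automaton. -/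
theorem mem_graph_iff (hl : A.Lists l) {x y c : ℕ} :
    (x, y, c) ∈ (ofInput A l w).graph fl ↔ Edge A w fl x y c := by
  constructor
  · rintro ⟨i, hi : i ≤ w.length, (⟨h, hx⟩ | ⟨h, hx⟩) | ⟨j, hj : j < l.length, hx⟩⟩
    · simp only [Prod.mk.injEq] at hx
      obtain ⟨rfl, rfl, rfl⟩ := hx
      exact .start hi h
    · simp only [Prod.mk.injEq] at hx
      obtain ⟨rfl, rfl, rfl⟩ := hx
      exact .finish hi h
    · have hm : l[j] ∈ A.δ := (hl.2 _).1 (List.getElem_mem hj)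
      rcases hlj : l[j] with ⟨p, a, q⟩
      rw [hlj] at hm
      have hlj' : l[j]? = some (p, a, q) := by rw [List.getElem?_eq_getElem hj, hlj]
      have hp : (ofInput A l w).tp j = p + 1 := by simp [ofInput, hlj']
      have hq : (ofInput A l w).tq j = q + 1 := by simp [ofInput, hlj']
      have ha : (ofInput A l w).ta j = labelCode a := by simp [ofInput, hlj']
      rcases hx with (⟨h, hx⟩ | ⟨h, hx⟩) | ⟨h, hx⟩ <;>
        simp only [hp, hq, ha, Prod.mk.injEq] at h hx <;>
        obtain ⟨rfl, rfl, rfl⟩ := hx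
      · cases a with
        | none => exact .eps hi hm
        | some a => exact .stay hi hm (h.resolve_left (Nat.succ_ne_zero _))
      · cases a with
        | none => exact absurd rfl h.1
        | some a =>
          have := letter_ofInput.1 h.2.symm
          rw [← vertex_succ]
          exact .advance hm this
      · rw [← vertex_succ]
        exact .skip hm h.1 h.2
  · have key : ∀ p a q, (p, a, q) ∈ A.δ → ∃ j < l.length, (ofInput A l w).tp j = p + 1 ∧
        (ofInput A l w).tq j = q + 1 ∧ (ofInput A l w).ta j = labelCode a := by
      intro p a q hm
      obtain ⟨j, hj, hlj⟩ := List.getElem_of_mem ((hl.2 _).2 hm)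
      have hlj' : l[j]? = some (p, a, q) := by rw [List.getElem?_eq_getElem hj, hlj]
      exact ⟨j, hj, by simp [ofInput, hlj'], by simp [ofInput, hlj'], by simp [ofInput, hlj']⟩
    intro h
    cases h with
    | start hi h => exact ⟨_, hi, .inl (.inl ⟨h, rfl⟩)⟩
    | finish hi h => exact ⟨_, hi, .inl (.inr ⟨h, rfl⟩)⟩
    | eps hi hm =>
      obtain ⟨j, hj, hp, hq, ha⟩ := key _ _ _ hm
      exact ⟨_, hi, .inr ⟨j, hj, .inl (.inl ⟨.inl ha, by rw [hp, hq, ha]; rfl⟩)⟩⟩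
    | stay hi hm h =>
      obtain ⟨j, hj, hp, hq, ha⟩ := key _ _ _ hm
      exact ⟨_, hi, .inr ⟨j, hj, .inl (.inl ⟨.inr h, by rw [hp, hq, ha]; rfl⟩)⟩⟩
    | @advance i p q a hm h =>
      obtain ⟨j, hj, hp, hq, ha⟩ := key _ _ _ hm
      refine ⟨i, (List.getElem?_eq_some_iff.1 h).1.le, .inr ⟨j, hj, .inl (.inr ⟨⟨?_, ?_⟩, ?_⟩)⟩⟩
      · rw [ha]
        exact Nat.succ_ne_zero _
      · rw [ha]
        exact (letter_ofInput.2 h).symm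
      · rw [hp, hq, ha]
        rw [← vertex_succ]
        rfl
    | @skip i p a q hm h hi =>
      obtain ⟨j, hj, hp, hq, ha⟩ := key _ _ _ hm
      refine ⟨i, hi.le, .inr ⟨j, hj, .inr ⟨⟨h, hi⟩, ?_⟩⟩⟩
      rw [hp, ← vertex_succ]
      rfl

theorem lb_letterCode {σ : ℕ} (a : Fin σ) : lb (letterCode a) = [letterCode a] :=
  lb_of_ne (Nat.succ_ne_zero _)

/-- A walk from a vertex to the sink projects to a path in the automaton and a matching with the
rest of the word. -/
theorem Walk.of_vertex (hl : A.Lists l) {i : ℕ} {p : Fin A.n} {u' : List ℕ} (hi : i ≤ w.length)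
    (h : Walk ((ofInput A l w).graph fl) (vertex A i p) u' (ofInput A l w).sink) :
    ∃ u, u' = u.map letterCode ∧ Accepts A p u ∧ Matches fl w i u := by
  generalize hx : vertex A i p = x at h
  generalize ht : (ofInput A l w).sink = t at h
  induction h generalizing i p with
  | nil x =>
    have := vertex_lt (l := l) hi p
    rw [hx, ← ht, Inst.sink, Inst.source] at this
    omega
  | @cons x y c v t he hw ih =>
    rw [mem_graph_iff hl] at he
    cases he with
    | start =>
      have := vertex_lt (l := l) hi p
      exact absurd hx this.ne
    | @finish i' _ h =>
      obtain ⟨rfl, rfl⟩ := vertex_inj hx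
      have hv : v = [] := by
        cases hw with
        | nil => rfl
        | @cons _ b c _ _ he =>
          exfalso
          rw [mem_graph_iff hl] at he
          generalize hz : (w.length + 1) * A.n + 2 = z at he
          have key : ∀ j ≤ w.length, ∀ q, vertex A j q ≠ z := by
            intro j hj q hq
            have := vertex_lt (l := l) hj q
            rw [hq, ← hz] at this
            simp only [Inst.source, ofInput] at this
            omega
          cases he with
          | start => omega
          | finish h1 => exact key _ h1 _ rfl
          | eps h1 => exact key _ h1 _ rfl
          | stay h1 => exact key _ h1 _ rfl
          | advance _ h1 => exact key _ (List.getElem?_eq_some_iff.1 h1).1.le _ rfl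
          | skip _ _ h1 => exact key _ h1.le _ rfl
      subst hv
      exact ⟨[], rfl, .nil, .finish h⟩
    | eps _ hm =>
      obtain ⟨rfl, rfl⟩ := vertex_inj hx
      obtain ⟨u, rfl, h1, h2⟩ := ih hi rfl ht
      exact ⟨u, rfl, .eps hm h1, h2⟩
    | stay _ hm h =>
      obtain ⟨rfl, rfl⟩ := vertex_inj hx
      obtain ⟨u, rfl, h1, h2⟩ := ih hi rfl ht
      exact ⟨_ :: u, by rw [lb_letterCode]; rfl, .letter hm h1, .stay _ h h2⟩
    | advance hm h =>
      obtain ⟨rfl, rfl⟩ := vertex_inj hx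
      obtain ⟨u, rfl, h1, h2⟩ := ih (List.getElem?_eq_some_iff.1 h).1 rfl ht
      exact ⟨_ :: u, by rw [lb_letterCode]; rfl, .letter hm h1, .advance h h2⟩
    | skip hm h h' =>
      obtain ⟨rfl, rfl⟩ := vertex_inj hx
      obtain ⟨u, rfl, h1, h2⟩ := ih h' rfl ht
      exact ⟨u, rfl, h1, .skip h h' h2⟩

/-- A path in the automaton and a matching of its string with the rest of the word combine to a walk
to the sink. Skips are available only at states with an outgoing transition; at the last state of a
path, the rest of the word is ignored instead. -/
theorem Walk.to_sink (hl : A.Lists l) (hfl : fl.skip = true → fl.finish = true) {i : ℕ}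
    {p : Fin A.n} {u : List (Fin A.σ)} (hi : i ≤ w.length) (h : Accepts A p u)
    (h' : Matches fl w i u) :
    Walk ((ofInput A l w).graph fl) (vertex A i p) (u.map letterCode) (ofInput A l w).sink := by
  have edge : ∀ {x y c}, Edge A w fl x y c → Walk ((ofInput A l w).graph fl) x (lb c) y :=
    fun he => .single ((mem_graph_iff hl).2 he)
  -- Transitions with the empty label can be taken in every layer, so only the first letter matters.
  have letter : ∀ {i a u v} {z : List ℕ}, i ≤ w.length → (∀ {p q}, (p, some a, q) ∈ A.δ →
      Accepts A q u → Walk ((ofInput A l w).graph fl) (vertex A i p) z (ofInput A l w).sink) →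
      v = a :: u → ∀ {p}, Accepts A p v →
      Walk ((ofInput A l w).graph fl) (vertex A i p) z (ofInput A l w).sink := by
    intro i a u v z hi hw hv p h
    induction h with
    | nil => cases hv
    | eps hm _ ih => exact (edge (.eps hi hm)).trans (ih hv)
    | letter hm h =>
      cases hv
      exact hw hm h
  have finish : ∀ {i v p}, i ≤ w.length → fl.finish = true ∨ i = w.length → v = [] → Accepts A p v →
      Walk ((ofInput A l w).graph fl) (vertex A i p) [] (ofInput A l w).sink := by
    intro i v p hi hs hv h
    induction h with
    | nil => exact edge (.finish hi hs)
    | eps hm _ ih => exact (edge (.eps hi hm)).trans (ih hv)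
    | letter => cases hv
  induction h' generalizing p with
  | finish hs => exact finish hi hs rfl h
  | stay a hs _ ih =>
    refine letter hi (fun hm h => ?_) rfl h
    have := (edge (.stay hi hm hs)).trans (ih hi h)
    rwa [lb_letterCode] at this
  | advance ha _ ih =>
    refine letter hi (fun hm h => ?_) rfl h
    have := (edge (.advance hm ha)).trans (ih (List.getElem?_eq_some_iff.1 ha).1 h)
    rwa [lb_letterCode] at this
  | skip hs hi' _ ih =>
    cases h with
    | nil => exact finish hi (.inl (hfl hs)) rfl .nil
    | eps hm h => exact (edge (.skip hm hs hi')).trans (ih hi' (.eps hm h))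
    | letter hm h => exact (edge (.skip hm hs hi')).trans (ih hi' (.letter hm h))

/-- The strings on walks through the product graph are the candidates. -/
theorem walk_iff (rel : StringRel) (hl : A.Lists l) {u' : List ℕ} :
    Walk ((ofInput A l w).graph (flags rel)) (ofInput A l w).source u' (ofInput A l w).sink ↔
      ∃ u ∈ rel.candidates A w, u' = u.map letterCode := by
  simp only [StringRel.candidates, Set.mem_ofPred_eq, holds_iff, mem_language_iff]
  constructor
  · intro h
    generalize hx : (ofInput A l w).source = x at h
    cases h with
    | nil => simp [Inst.source, Inst.sink] at hx
    | @cons _ y c v _ he hw =>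
      rw [mem_graph_iff hl] at he
      have key : ∀ i ≤ w.length, ∀ p, vertex A i p ≠ x := fun i hi p h =>
        absurd (h.trans hx.symm) (vertex_lt (l := l) hi p).ne
      cases he with
      | start hi h =>
        obtain ⟨u, rfl, h1, h2⟩ := Walk.of_vertex hl hi hw
        exact ⟨u, ⟨⟨_, hi, h, h2⟩, h1⟩, rfl⟩
      | finish h1 => exact absurd rfl (key _ h1 _)
      | eps h1 => exact absurd rfl (key _ h1 _)
      | stay h1 => exact absurd rfl (key _ h1 _)
      | advance _ h1 => exact absurd rfl (key _ (List.getElem?_eq_some_iff.1 h1).1.le _)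
      | skip _ _ h1 => exact absurd rfl (key _ h1.le _)
  · rintro ⟨u, ⟨⟨i, hi, hs, hm⟩, ha⟩, rfl⟩
    exact (Walk.single ((mem_graph_iff hl).2 (.start hi hs))).trans
      (Walk.to_sink hl (by cases rel <;> simp [flags]) hi ha hm)

/-- An answer for the strings of numbers yields an answer for the strings of letters. -/
theorem exists_answer {σ : ℕ} {C : Set (List (Fin σ))} {C' : Set (List ℕ)} {var : Variant}
    {ans' : Answer ℕ} (hC : ∀ u', u' ∈ C' ↔ ∃ u ∈ C, u' = u.map letterCode)
    (h : var.Correct C' ans') : ∃ ans : Answer (Fin σ), var.Correct C ans ∧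
      match ans with
      | .noString => ans' = .noString
      | .string u => ans' = .string (u.map letterCode)
      | .unbounded => ans' = .unbounded := by
  have hmem : ∀ u ∈ C, u.map letterCode ∈ C' := fun u hu => (hC _).2 ⟨u, hu, rfl⟩
  cases ans' with
  | noString =>
    refine ⟨.noString, ?_, rfl⟩
    have : C' = ∅ → C = ∅ := fun h => by
      refine Set.eq_empty_of_forall_notMem fun u hu => ?_
      have := hmem u hu
      rw [h] at this
      exact this
    cases var <;> exact this h
  | string u' =>
    have hu' : u' ∈ C' := by cases var <;> exact h.1
    obtain ⟨u, hu, rfl⟩ := (hC _).1 hu'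
    refine ⟨.string u, ?_, rfl⟩
    cases var
    all_goals
      refine ⟨hu, fun v hv => ?_⟩
      simpa using h.2 _ (hmem v hv)
  | unbounded =>
    refine ⟨.unbounded, ?_, rfl⟩
    cases var with
    | min => exact h
    | max =>
      intro k
      obtain ⟨u', hu', hk⟩ := h k
      obtain ⟨u, hu, rfl⟩ := (hC _).1 hu'
      exact ⟨u, hu, by simpa using hk⟩

end Automaton

end QuantMatch

/-! ### The program on the word RAM -/

namespace QuantMatch

open WordRAM

/-- Constructs the product graph, solves the problem there and reads off the answer. -/
def solve (rel : StringRel) : Variant → Cmd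
  | .min => build (flags rel) ;; minSearch ;; report
  | .max => build (flags rel) ;; maxSearch ;; report

/-- The structured program solves the problem, in `O((k + 1) (m + 1))` rounds. -/
theorem wp_solve {M S : ℕ} {I : Inst} {ρ : St} (rel : StringRel) (var : Variant) (hI : I.Valid)
    (hS : I.Fits M S) (hH : I.Holds ρ) (h0 : ρ.ticks = 0) (hn : I.n ≤ I.m + 1) :
    wp M S (solve rel var) (fun σ => (∃ ans, Reported I.sink ans σ ∧
        var.Correct {u | Walk (I.graph (flags rel)) I.source u I.sink} ans) ∧
      σ.ticks ≤ 23 * ((I.k + 1) * (I.m + 1))) ρ := by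
  have hS' := hS
  obtain ⟨hS1, hS2, hS3, hS4⟩ := hS
  have hM : Fact (2 < M) := ⟨by omega⟩
  have hsink : I.sink = (I.k + 1) * I.n + 2 := rfl
  have hsource : I.source = (I.k + 1) * I.n + 1 := rfl
  have e1 : (I.k + 1) * I.n ≤ (I.k + 1) * (I.m + 1) := Nat.mul_le_mul_left _ hn
  have e2 : (I.k + 1) * (3 * I.m + 2) ≤ 3 * ((I.k + 1) * (I.m + 1)) := by nlinarith
  have e3 : 1 ≤ (I.k + 1) * (I.m + 1) := Nat.mul_pos (Nat.succ_pos _) (Nat.succ_pos _)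
  cases var with
  | min =>
    rw [solve, wp_seq]
    refine (wp_build (fl := flags rel) hI hS' hH).mono ?_
    rintro σ ⟨g1, g2, g3, g4, g5, g6, g7, g8, g9, g10⟩
    rw [wp_seq]
    refine (wp_minSearch g1 (by omega) (by omega) (by omega) (by omega) (by omega) (by omega)
      (by omega) g5 g9 g8).mono ?_
    rintro σ' ⟨⟨ans, a1, a2⟩, a3, a4, a5, a6⟩
    refine (wp_report (V := I.sink) (by omega) (by omega) (by omega) a5 (by omega) a1).mono ?_
    rintro σ'' ⟨b1, b2⟩
    rw [g2, g3] at a2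
    exact ⟨⟨ans, b1, a2⟩, by omega⟩
  | max =>
    rw [solve, wp_seq]
    refine (wp_build (fl := flags rel) hI hS' hH).mono ?_
    rintro σ ⟨g1, g2, g3, g4, g5, g6, g7, g8, g9, g10⟩
    rw [wp_seq]
    refine (wp_maxSearch g1 (by omega) (by omega) (by omega) (by omega) (by omega) (by omega)
      g6 g5 g9 g8 g7).mono ?_
    rintro σ' ⟨⟨ans, a1, a2⟩, a3, a4, a5, a6⟩
    refine (wp_report (V := I.sink) (by omega) (by omega) (by omega) a5 (by omega) a1).mono ?_
    rintro σ'' ⟨b1, b2⟩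
    rw [g2, g3] at a2
    exact ⟨⟨ans, b1, a2⟩, by omega⟩

section Input

variable {A : EpsAutomaton} {l : List A.Transition} {w : List (Fin A.σ)}

theorem size_eq (hl : A.Lists l) : A.size = l.length := by
  classical
  rw [EpsAutomaton.size, ← List.toFinset_card_of_nodup hl.1]
  congr 1
  ext x
  rw [List.mem_toFinset, hl.2]

/-- Every state but the initial one is the target of a transition. -/
theorem n_le (h : A.Trimmed) : A.n ≤ A.size + 1 := by
  classical
  have h1 : Finset.univ.erase A.init ⊆ A.δ.image fun x => x.2.2 := by
    intro q hq
    rcases (h q).1.cases_tail with h2 | ⟨p, -, a, ha⟩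
    · exact absurd h2 (Finset.ne_of_mem_erase hq)
    · exact Finset.mem_image.2 ⟨_, ha, rfl⟩
  have h2 := (Finset.card_le_card h1).trans Finset.card_image_le
  rw [Finset.card_erase_of_mem (Finset.mem_univ _), Finset.card_univ, Fintype.card_fin] at h2
  rw [EpsAutomaton.size]
  omega

/-- Different letters label different transitions. -/
theorem sigma_le (h : A.UsesAllLetters) : A.σ ≤ A.size := by
  classical
  have h1 : Finset.univ.image some ⊆ A.δ.image fun x => x.2.1 := by
    intro a ha
    obtain ⟨a, -, rfl⟩ := Finset.mem_image.1 ha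
    obtain ⟨p, q, hm⟩ := h a
    exact Finset.mem_image.2 ⟨_, hm, rfl⟩
  have h2 := (Finset.card_le_card h1).trans Finset.card_image_le
  rwa [Finset.card_image_of_injective _ (Option.some_injective _), Finset.card_univ,
    Fintype.card_fin] at h2

theorem length_flatMap_encodeTransition (l : List A.Transition) :
    (l.flatMap A.encodeTransition).length = 3 * l.length := by
  induction l with
  | nil => rfl
  | cons x l ih =>
    rw [List.flatMap_cons, List.length_append, ih, List.length_cons,
      EpsAutomaton.encodeTransition]
    simp only [List.length_cons, List.length_nil]
    omega

/-- The coercion of letters to numbers in `encodeInput` applies to the whole word first. -/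
theorem encodeInput_eq : A.encodeInput l w =
    [A.n, A.σ, (A.init : ℕ) + 1, (A.final : ℕ) + 1, l.length, w.length] ++
      l.flatMap A.encodeTransition ++ w.map letterCode := by
  have h : ∀ w : List (Fin A.σ), (do let a ← w; pure (a : ℕ)) = w.map Fin.val := fun w => by
    induction w with
    | nil => rfl
    | cons a w ih => exact congrArg _ ih
  rw [EpsAutomaton.encodeInput, h, List.map_map]
  rfl

theorem length_encodeInput : (A.encodeInput l w).length = 3 * l.length + w.length + 6 := by
  rw [encodeInput_eq, List.length_append, List.length_append, List.length_map,
    length_flatMap_encodeTransition]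
  simp only [List.length_cons, List.length_nil]
  omega

theorem getElem?_flatMap_encodeTransition {l : List A.Transition} {j c : ℕ} {x : A.Transition}
    (hc : c < 3) (hx : l[j]? = some x) :
    (l.flatMap A.encodeTransition)[j + j + j + c]? = (A.encodeTransition x)[c]? := by
  have hlen : ∀ y, (A.encodeTransition y).length = 3 := fun _ => rfl
  induction l generalizing j with
  | nil => simp at hx
  | cons y l ih =>
    rw [List.flatMap_cons]
    cases j with
    | zero =>
      simp only [List.getElem?_cons_zero, Option.some.injEq] at hx
      rw [List.getElem?_append_left (by rw [hlen]; omega), hx]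
      simp
    | succ j =>
      rw [List.getElem?_cons_succ] at hx
      rw [List.getElem?_append_right (by rw [hlen]; omega), ← ih hx, hlen]
      congr 1
      omega

theorem getElem?_encodeInput_transition {j c : ℕ} {x : A.Transition} (hc : c < 3)
    (hx : l[j]? = some x) :
    (A.encodeInput l w)[j + j + j + (6 + c)]? = (A.encodeTransition x)[c]? := by
  have hj := (List.getElem?_eq_some_iff.1 hx).1
  rw [encodeInput_eq, List.getElem?_append_left, List.getElem?_append_right,
    ← getElem?_flatMap_encodeTransition hc hx]
  · congr 1
    simp only [List.length_cons, List.length_nil]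
    omega
  · simp only [List.length_cons, List.length_nil]
    omega
  · rw [List.length_append, length_flatMap_encodeTransition]
    simp only [List.length_cons, List.length_nil]
    omega

theorem getElem?_encodeInput_word {i : ℕ} {a : Fin A.σ} (ha : w[i]? = some a) :
    (A.encodeInput l w)[l.length + l.length + l.length + 6 + i]? = some (letterCode a) := by
  have hlen : ([A.n, A.σ, (A.init : ℕ) + 1, (A.final : ℕ) + 1, l.length, w.length] ++
      l.flatMap A.encodeTransition).length = l.length + l.length + l.length + 6 := by
    rw [List.length_append, length_flatMap_encodeTransition]
    simp only [List.length_cons, List.length_nil]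
    omega
  rw [encodeInput_eq, List.getElem?_append_right (by omega), hlen,
    Nat.add_sub_cancel_left, List.getElem?_map, ha]
  rfl

/-- All numbers in the input are smaller than the length of the input. -/
theorem mem_encodeInput_lt (hA : A.Trimmed) (hA' : A.UsesAllLetters) (hl : A.Lists l) {v : ℕ}
    (hv : v ∈ A.encodeInput l w) : v < 3 * l.length + w.length + 6 := by
  have h1 := n_le hA
  have h2 := sigma_le hA'
  rw [size_eq hl] at h1 h2
  have h3 := A.init.isLt
  have h4 := A.final.isLt
  simp only [encodeInput_eq, List.mem_append, List.mem_flatMap, List.mem_map,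
    List.mem_cons, List.not_mem_nil, or_false, EpsAutomaton.encodeTransition] at hv
  rcases hv with (hv | ⟨⟨p, a, q⟩, -, hv⟩) | ⟨a, -, rfl⟩
  · omega
  · have h5 := p.isLt
    have h6 := q.isLt
    cases a with
    | none =>
      simp only [Option.elim_none] at hv
      omega
    | some a =>
      have h7 := a.isLt
      simp only [Option.elim_some] at hv
      omega
  · have := a.isLt
    rw [letterCode]
    omega

/-- The state of a structured program that is represented by a state of the word RAM. -/
def abstraction {W : ℕ} (S : ℕ) (s : State W) : St where
  reg r := (s.reg r.code).toNat
  fld f i := (s.mem (BitVec.ofNat W (f.code * S + i))).toNat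
  ticks := 0

/-- The first array of the structured program is the input. -/
theorem holds_abstraction {W S : ℕ} {s : State W} (hA : A.Trimmed) (hA' : A.UsesAllLetters)
    (hl : A.Lists l) (hW : 3 * l.length + w.length + 6 ≤ 2 ^ W)
    (hs : s.HoldsInput (A.encodeInput l w)) : (ofInput A l w).Holds (abstraction S s) := by
  have key : ∀ i v, (A.encodeInput l w)[i]? = some v → (abstraction S s).fld .inp i = v := by
    intro i v h
    obtain ⟨hi, rfl⟩ := List.getElem?_eq_some_iff.1 h
    have h1 := mem_encodeInput_lt hA hA' hl (List.getElem_mem hi)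
    have h2 : Fld.inp.code * S + i = i := by simp [Fld.code, Fld.ctorIdx]
    simp only [abstraction, h2, hs i hi, BitVec.toNat_ofNat]
    exact Nat.mod_eq_of_lt (by omega)
  constructor
  · exact key _ _ rfl
  · exact key _ _ rfl
  · exact key _ _ rfl
  · exact key _ _ rfl
  · exact key _ _ rfl
  all_goals
    intro j hj
    have hj' := List.getElem?_eq_getElem hj
    refine key _ _ ?_
  · rw [getElem?_encodeInput_transition (c := 0) (by omega) hj']
    simp [ofInput, hj', EpsAutomaton.encodeTransition]
  · rw [getElem?_encodeInput_transition (c := 1) (by omega) hj']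
    simp [ofInput, hj', EpsAutomaton.encodeTransition, labelCode]
    rfl
  · rw [getElem?_encodeInput_transition (c := 2) (by omega) hj']
    simp [ofInput, hj', EpsAutomaton.encodeTransition]
  · refine (getElem?_encodeInput_word hj').trans ?_
    simp [ofInput, hj']

/-- Arrays whose length is the square of the length of the input are large enough, and words of four
times the logarithm of the latter suffice for their addresses. -/
theorem fits {W : ℕ} (hn : A.n ≤ l.length + 1)
    (hW : (3 * l.length + w.length + 6) ^ 4 ≤ 2 ^ W) :
    (ofInput A l w).Fits (2 ^ W)
      ((3 * l.length + w.length + 6) * (3 * l.length + w.length + 6)) := by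
  have h1 : (w.length + 1) * A.n ≤ (w.length + 1) * (l.length + 1) := Nat.mul_le_mul_left _ hn
  constructor
  · change (w.length + 1) * A.n + 2 + 1 < _
    nlinarith
  · change (w.length + 1) * (3 * l.length + 2) + 1 < _
    nlinarith
  · exact Nat.le_mul_self _
  · refine le_trans ?_ hW
    have : 16 ≤ (3 * l.length + w.length + 6) * (3 * l.length + w.length + 6) := by nlinarith
    calc _ ≤ _ := Nat.mul_le_mul_right _ this
      _ = _ := by ring

end Input

/-- Computes the common length of the arrays, the square of the length of the input. -/
def prologue : Program :=
  .seq (.instr (.const 100 4)) (.seq (.instr (.load 100 100)) (.seq (.instr (.const 101 5))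
    (.seq (.instr (.load 101 101)) (.seq (.instr (.const 102 3))
      (.seq (.instr (.op .mul 100 100 102)) (.seq (.instr (.op .add 100 100 101))
        (.seq (.instr (.const 101 6))
        (.seq (.instr (.op .add 100 100 101)) (.instr (.op .mul 99 100 100))))))))))

/-- Computes the address of the output. -/
def epilogue : Program := .seq (.instr (.const 100 15)) (.instr (.op .mul 1 100 99))

theorem exec_prologue {W m k : ℕ} (s : State W) (hm : s.mem (BitVec.ofNat W 4) = BitVec.ofNat W m)
    (hk : s.mem (BitVec.ofNat W 5) = BitVec.ofNat W k) :
    ∃ s', Exec prologue s 10 s' ∧ s'.mem = s.mem ∧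
      s'.reg 99 = BitVec.ofNat W ((3 * m + k + 6) * (3 * m + k + 6)) := by
  refine ⟨_, .seq (.instr _ _) (.seq (.instr _ _) (.seq (.instr _ _) (.seq (.instr _ _)
    (.seq (.instr _ _) (.seq (.instr _ _) (.seq (.instr _ _) (.seq (.instr _ _)
      (.seq (.instr _ _) (.instr _ _))))))))), rfl, ?_⟩
  simp [Instr.exec, BinOp.eval, hm, hk, BitVec.ofNat_add, BitVec.ofNat_mul, BitVec.mul_comm]

theorem exec_epilogue {W S : ℕ} (s : State W) (hS : s.reg 99 = BitVec.ofNat W S) :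
    ∃ s', Exec epilogue s 2 s' ∧ s'.mem = s.mem ∧ s'.reg 0 = s.reg 0 ∧ s'.reg 2 = s.reg 2 ∧
      s'.reg 1 = BitVec.ofNat W (15 * S) := by
  refine ⟨_, .seq (.instr _ _) (.instr _ _), rfl, ?_, ?_, ?_⟩ <;>
    simp [Instr.exec, BinOp.eval, hS, BitVec.ofNat_mul]

/-- A reported answer is an output in the required format: the array `out` has number `15`, so
that the string starts at the address `15 * S`. -/
theorem outputs {W S V σ : ℕ} {τ : St} {s s' : State W} {ans' : Answer ℕ} {ans : Answer (Fin σ)}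
    (hr : Represents S τ s) (hV : V < S) (h : Reported V ans' τ) (hm : s'.mem = s.mem)
    (h0 : s'.reg 0 = s.reg 0) (h2 : s'.reg 2 = s.reg 2) (h1 : s'.reg 1 = BitVec.ofNat W (15 * S))
    (ha : match ans with
      | .noString => ans' = .noString
      | .string u => ans' = .string (u.map letterCode)
      | .unbounded => ans' = .unbounded) : s'.Outputs ans := by
  have hk : (s.reg 0).toNat = τ.reg .kind := hr.reg .kind
  have hlen : (s.reg 2).toNat = τ.reg .len := hr.reg .len
  cases ans with
  | noString =>
    subst ha
    rw [State.Outputs, h0, hk, h]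
  | unbounded =>
    subst ha
    rw [State.Outputs, h0, hk, h]
  | string u =>
    subst ha
    obtain ⟨g1, g2, g3⟩ := h
    have hu : τ.reg .len = u.length := by simpa using congrArg List.length g3
    refine ⟨by rw [h0, hk, g1], by rw [h2, hlen, hu], fun i hi => ?_⟩
    have h3 := hr.fld .out i (by omega)
    rw [hm, h1, ← BitVec.ofNat_add]
    refine h3.trans ?_
    have h4 := congrArg (·[i]?) g3
    simpa [hu, hi, letterCode] using h4

end QuantMatch

open QuantMatch WordRAM in
theorem mainTheorem3 (rel : StringRel) (var : Variant) :
    ∃ (P : WordRAM.Program) (κ c : ℕ),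
      ∀ (A : EpsAutomaton), A.Trimmed → A.UsesAllLetters →
      ∀ (l : List A.Transition), A.Lists l →
      ∀ (w : List (Fin A.σ)) (W : ℕ), (A.encodeInput l w).length ^ κ ≤ 2 ^ W →
      ∀ s : WordRAM.State W, s.HoldsInput (A.encodeInput l w) →
        ∃ (t : ℕ) (s' : WordRAM.State W) (ans : Answer (Fin A.σ)),
          WordRAM.Exec P s t s' ∧
          t ≤ c * (max w.length 1 * max A.size 1) ∧
          s'.Outputs ans ∧
          var.Correct (rel.candidates A w) ans := by
  -- There are at most `23 * (4 * x)` rounds, for `x = max |w| 1 * max m 1`, which accounts for the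
  -- constant `93`; prologue and epilogue take `12` steps.
  refine ⟨.seq prologue (.seq (solve rel var).code epilogue), 4, 93 * (solve rel var).cost + 12, ?_⟩
  intro A hA hA' l hl w W hW s hs
  rw [length_encodeInput] at hW
  have hn := n_le hA
  rw [size_eq hl] at hn ⊢
  have hfit := fits (w := w) hn hW
  have hN : 3 * l.length + w.length + 6 ≤ 2 ^ W := (Nat.le_self_pow (by omega) _).trans hW
  obtain ⟨s₁, x₁, m₁, r₁⟩ := exec_prologue (m := l.length) (k := w.length) s
    (hs 4 (by rw [length_encodeInput]; omega))
    (hs 5 (by rw [length_encodeInput]; omega))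
  have hs₁ : s₁.HoldsInput (A.encodeInput l w) := fun i hi => by rw [m₁, hs i hi]
  set S := (3 * l.length + w.length + 6) * (3 * l.length + w.length + 6) with hS
  have hrep : Represents S (abstraction S s₁) s₁ := by
    refine ⟨fun _ => rfl, fun _ _ _ => rfl, ?_⟩
    have := hfit.words
    have h6 : 0 < S := by positivity
    rw [r₁, BitVec.toNat_ofNat]
    exact Nat.mod_eq_of_lt (by omega)
  obtain ⟨τ, hev, ⟨ans', hans, hcor⟩, hticks⟩ := wp_solve rel var ofInput_valid hfit
    (holds_abstraction (S := S) hA hA' hl hN hs₁) rfl hn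
  obtain ⟨t, s₂, x₂, hrep₂, ht⟩ := Cmd.exec_code hfit.words hev s₁ hrep
  obtain ⟨s₃, x₃, m₃, h0, h2, h1⟩ := exec_epilogue (S := S) s₂ (by
    rw [← hrep₂.stride, BitVec.ofNat_toNat, BitVec.setWidth_eq])
  obtain ⟨ans, hcor', hmatch⟩ := exists_answer (fun _ => walk_iff rel hl) hcor
  refine ⟨_, s₃, ans, .seq x₁ (.seq x₂ x₃), ?_,
    outputs hrep₂ (by have := hfit.vertices; omega) hans m₃ h0 h2 h1 hmatch, hcor'⟩
  have e1 : (w.length + 1) * (l.length + 1) ≤ 4 * (max w.length 1 * max l.length 1) := by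
    calc _ ≤ (2 * max w.length 1) * (2 * max l.length 1) := Nat.mul_le_mul (by omega) (by omega)
      _ = _ := by ring
  have e2 : 1 ≤ max w.length 1 * max l.length 1 :=
    Nat.mul_pos (by omega) (by omega)
  have e3 : τ.ticks - (abstraction S s₁).ticks + 1 ≤ 93 * (max w.length 1 * max l.length 1) := by
    have : τ.ticks ≤ 23 * ((w.length + 1) * (l.length + 1)) := hticks
    omega
  have e4 := ht.trans (Nat.mul_le_mul_left _ e3)
  calc 10 + (t + 2) ≤ (solve rel var).cost * (93 * (max w.length 1 * max l.length 1)) + 12 := by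
        omega
    _ ≤ (93 * (solve rel var).cost + 12) * (max w.length 1 * max l.length 1) := by nlinarith
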